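/- Let $S=\mathbb{C}[x,y,z]$ with its standard grading, let $d\ge 1$, and let $f\in S_d$ be a square-free homogeneous polynomial of degree $d$, so that $C: f=0$ is a reduced curve in $\mathbb{P}^2$. Let $J_f=(f_x,f_y,f_z)$ be the Jacobian ideal and $M(f)=S/J_f$ the Milnor algebra, a graded $S$-module. Let $\tau(f)$ be the total Tjurina number of $C$, i.e. the sum over the points $p\in\mathbb{P}^2$ of $\dim_{\mathbb{C}}\mathcal{O}_p/(g,g_u,g_v)$, where $g=0$ is a local equation of $C$ at $p$ in affine coordinates $u,v$. Define $$st(f)=\min\{q\in\mathbb{Z} : \dim_{\mathbb{C}} M(f)_k=\tau(f)\ \text{for all } k\ge q\},$$ and let $reg(f)$ be the Castelnuovo–Mumford regularity of the graded $S$-module $M(f)$, i.e. $reg(f)=\sup_{i,j}(a_{i,j}-i)$ for a minimal graded free resolution $\cdots\to F_1\to F_0\to M(f)\to 0$ with $F_i=\bigoplus_j S(-a_{i,j})$. Let $AR(f)$ be the graded $S$-module of triples $(a,b,c)\in S^3$ with $af_x+bf_y+cf_z=0$; the curve $C$ is called free if there is an isomorphism of graded modules $AR(f)\cong S(-d_1)\oplus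 S(-d_2)$ for some integers $d_1,d_2\ge 0$. Both invariants are integers if $d\ge 2$; if $d=1$, then $M(f)=0$ and by convention $st(f)=reg(f)=-\infty$ (with $-\infty-1=-\infty$). Then $$st(f)-1\le reg(f)\le st(f),$$ and the equality $reg(f)=st(f)$ holds if and only if $C$ is a free curve. -/

import Mathlib

noncomputable section

namespace PlaneCurve

open MvPolynomial

/-! ### Graded modules over a polynomial ring and Castelnuovo–Mumford regularity -/

/-- The degree `n` piece `S_n` (`n ∈ ℤ`) of the polynomial ring `S = k[x_s : s ∈ σ]` with its standard
grading; it is zero for `n < 0`. -/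
def polyPiece (σ k : Type*) [CommSemiring k] (n : ℤ) : Submodule k (MvPolynomial σ k) :=
  if 0 ≤ n then homogeneousSubmodule σ k n.toNat else ⊥

/-- A minimal graded free resolution
`⋯ → F₂ → F₁ → F₀ → M → 0`, `F_i = ⨁_j S(-a_{i,j})` of finite rank,
of a module `M` over `S = k[x_s : s ∈ σ]` whose degree `n` piece is `ℳ n`. The free module `F_i` is
`Fin (rank i) → S`, whose `j`-th standard basis vector has degree `shift i j = a_{i,j}`. -/
structure MinimalGradedFreeResolution (σ : Type*) {k M : Type*} [Field k] [AddCommGroup M]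
    [Module (MvPolynomial σ k) M] [Module k M] (ℳ : ℤ → Submodule k M) where
  /-- the rank of `F_i` -/
  rank : ℕ → ℕ
  /-- the degrees `a_{i,j}` of the generators of `F_i` -/
  shift : ∀ i, Fin (rank i) → ℤ
  /-- the differential `F_{i+1} → F_i` -/
  diff : ∀ i, (Fin (rank (i + 1)) → MvPolynomial σ k) →ₗ[MvPolynomial σ k]
    (Fin (rank i) → MvPolynomial σ k)
  /-- the augmentation `F_0 → M` -/
  aug : (Fin (rank 0) → MvPolynomial σ k) →ₗ[MvPolynomial σ k] M
  /-- the differentials are homogeneous of degree zero -/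
  diff_homogeneous : ∀ i l j, diff i (Pi.single l 1) j ∈ polyPiece σ k (shift (i + 1) l - shift i j)
  /-- the augmentation is homogeneous of degree zero -/
  aug_homogeneous : ∀ j, aug (Pi.single j 1) ∈ ℳ (shift 0 j)
  aug_surjective : Function.Surjective aug
  exact_zero : Function.Exact (diff 0) aug
  exact_succ : ∀ i, Function.Exact (diff (i + 1)) (diff i)
  /-- minimality: `F_{i+1}` is mapped into `𝔪 F_i`, where `𝔪` is the ideal of the variables -/
  minimal : ∀ i v j, constantCoeff (diff i v j) = 0

/-- The number `sup_{i,j} (a_{i,j} - i)` attached to a resolution with `F_i = ⨁_j S(-a_{i,j})`. -/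
def MinimalGradedFreeResolution.regularity {σ k M : Type*} [Field k] [AddCommGroup M]
    [Module (MvPolynomial σ k) M] [Module k M] {ℳ : ℤ → Submodule k M}
    (F : MinimalGradedFreeResolution σ ℳ) : EReal :=
  ⨆ (i : ℕ) (j : Fin (F.rank i)), (((F.shift i j - i : ℤ) : ℝ) : EReal)

/-- The Castelnuovo–Mumford regularity of a finitely generated graded module: the number
`sup_{i,j} (a_{i,j} - i)` of its minimal graded free resolution. That resolution is unique up to
isomorphism, so the infimum runs over a single value. The zero module has regularity `-∞`. -/
def regularity (σ : Type*) {k M : Type*} [Field k] [AddCommGroup M]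
    [Module (MvPolynomial σ k) M] [Module k M] (ℳ : ℤ → Submodule k M) : EReal :=
  ⨅ F : MinimalGradedFreeResolution σ ℳ, F.regularity

/-! ### The Milnor algebra -/

/-- The Jacobian ideal `J_f = (f_x, f_y, f_z)`. -/
def jacobianIdeal (f : MvPolynomial (Fin 3) ℂ) : Ideal (MvPolynomial (Fin 3) ℂ) :=
  Ideal.span (Set.range fun i => pderiv i f)

/-- The Milnor (Jacobian) algebra `M(f) = S / J_f`. -/
abbrev MilnorAlgebra (f : MvPolynomial (Fin 3) ℂ) : Type :=
  MvPolynomial (Fin 3) ℂ ⧸ jacobianIdeal f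

/-- The graded piece `M(f)_n`, the image of `S_n`. -/
def milnorPiece (f : MvPolynomial (Fin 3) ℂ) (n : ℤ) : Submodule ℂ (MilnorAlgebra f) :=
  (polyPiece (Fin 3) ℂ n).map (Ideal.Quotient.mkₐ ℂ (jacobianIdeal f)).toLinearMap

/-- The regularity `reg(f)` of the graded `S`-module `M(f)`. -/
def reg (f : MvPolynomial (Fin 3) ℂ) : EReal :=
  regularity (Fin 3) (milnorPiece f)

/-! ### The total Tjurina number and the stability threshold -/

/-- The maximal ideal of the polynomials that vanish at the point `p` of affine space. -/
def pointIdeal {σ : Type} (p : σ → ℂ) : Ideal (MvPolynomial σ ℂ) :=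
  RingHom.ker (eval p)

instance {σ : Type} (p : σ → ℂ) : (pointIdeal p).IsPrime :=
  RingHom.ker_isPrime (eval p)

/-- The Tjurina number at the point `p` of affine space of the hypersurface `g = 0`:
`dim_ℂ 𝒪_p / (g, ∂g/∂u_s : s ∈ σ)`, where `𝒪_p` is the local ring of affine space at `p`. -/
def localTjurina {σ : Type} (g : MvPolynomial σ ℂ) (p : σ → ℂ) : ℕ :=
  Module.finrank ℂ
    (Localization.AtPrime (pointIdeal p) ⧸
      (Ideal.span (insert g (Set.range fun s => pderiv s g))).map
        (algebraMap (MvPolynomial σ ℂ) (Localization.AtPrime (pointIdeal p))))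

/-- The equation of the curve `f = 0` in the affine chart `x_i = 1` of the projective plane. -/
def dehomogenize (i : Fin 3) (f : MvPolynomial (Fin 3) ℂ) : MvPolynomial {j : Fin 3 // j ≠ i} ℂ :=
  aeval (fun j : Fin 3 => if h : j ≠ i then X ⟨j, h⟩ else 1) f

lemma exists_rep_ne_zero (p : Projectivization ℂ (Fin 3 → ℂ)) : ∃ i, p.rep i ≠ 0 :=
  Function.ne_iff.mp p.rep_nonzero

/-- An affine chart `x_i = 1` containing the point `p` of the projective plane. -/
def chart (p : Projectivization ℂ (Fin 3 → ℂ)) : Fin 3 :=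
  (exists_rep_ne_zero p).choose

/-- The Tjurina number of the plane curve `f = 0` at the point `p`, computed in an affine chart
(the choice of the chart does not matter). It is zero unless `p` is a singular point of the curve. -/
def tjurinaAt (f : MvPolynomial (Fin 3) ℂ) (p : Projectivization ℂ (Fin 3 → ℂ)) : ℕ :=
  localTjurina (dehomogenize (chart p) f)
    (fun j : {j : Fin 3 // j ≠ chart p} => p.rep j / p.rep (chart p))

/-- The total Tjurina number `τ(f)` of the plane curve `f = 0`. -/
def totalTjurina (f : MvPolynomial (Fin 3) ℂ) : ℕ :=
  ∑ᶠ p : Projectivization ℂ (Fin 3 → ℂ), tjurinaAt f p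

/-- The stability threshold
`st(f) = min {q ∈ ℤ : dim M(f)_n = τ(f) for all n ≥ q}`. It is `-∞` if all integers `q` qualify,
which is the case when `M(f) = 0`. -/
def st (f : MvPolynomial (Fin 3) ℂ) : EReal :=
  sInf ((fun q : ℤ => ((q : ℝ) : EReal)) ''
    {q : ℤ | ∀ n : ℤ, q ≤ n → Module.finrank ℂ (milnorPiece f n) = totalTjurina f})

/-! ### Free curves -/

/-- The `S`-module `AR(f)` of Jacobian syzygies: the triples `(a, b, c)` with
`a f_x + b f_y + c f_z = 0`. -/
def AR (f : MvPolynomial (Fin 3) ℂ) :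
    Submodule (MvPolynomial (Fin 3) ℂ) (Fin 3 → MvPolynomial (Fin 3) ℂ) :=
  LinearMap.ker (Fintype.linearCombination (MvPolynomial (Fin 3) ℂ) fun i => pderiv i f)

/-- The curve `f = 0` is free: `AR(f) ≅ S(-d₁) ⊕ S(-d₂)` as graded modules for some `d₁, d₂ ≥ 0`, that
is, `AR(f)` has a basis of two homogeneous syzygies, the `l`-th one with entries in `S_{d_l}`. -/
def IsFreeCurve (f : MvPolynomial (Fin 3) ℂ) : Prop :=
  ∃ (d : Fin 2 → ℕ) (b : Module.Basis (Fin 2) (MvPolynomial (Fin 3) ℂ) (AR f)),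
    ∀ l i, ((b l : AR f) : Fin 3 → MvPolynomial (Fin 3) ℂ) i ∈ homogeneousSubmodule (Fin 3) ℂ (d l)

end PlaneCurve

end

/-!
Write `S = ℂ[x, y, z]`, `J = J_f`, `H(i) = dim M(f)_i`, and suppose `d ≥ 2`. The argument compares the
Hilbert function `H` with the graded free resolution
`0 → ⨁ S(-e_l) → ⨁ S(-D_j) → S(1-d)^r → J → 0`, `r ≤ 3`, of the Jacobian ideal.

* *Stabilization.* Suppose `H(i) = τ` for large `i`. The alternating sum of the functions
  `dim S(-s)_i` then differs from `τ` only through the truncation of `(i+2)(i+1)/2` for `i ≤ -3`. Let `A`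
  be the largest of the `D_j` and `e_l`. Hence `H(i) = τ` for `i ≥ A - 2`, and `H(A-3) - τ` is the number
  of `l` with `e_l = A` minus the number of `j` with `D_j = A`.
* *No mixing.* The largest shift `A` occurs in one of the two modules only: if there are second syzygies
  at all, one of them has larger degree than every first syzygy (`exists_shift_gt`). Otherwise a first
  syzygy of maximal degree would occur in no relation, so that it splits off from the syzygy module; the
  complement is reflexive of rank at most one over a factorial ring, hence free, and there would be no
  second syzygies. So `H(A-3) < τ` if there are no second syzygies, that is, if the curve is free, and
  `H(A-3) > τ` otherwise (`IdealResolution.exists_stabilization`).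
* *Conclusion.* In both cases `st(f) = A - 2`. The regularity is `A - 2` in the first case, attained by a
  first syzygy, and `A - 3` in the second, attained by a second syzygy
  (`MinimalGradedFreeResolution.exists_regularity_eq`, `st_reg_of_eventually_eq`). As `A` and the sign of
  `H(A-3) - τ` depend on `H` only, all minimal resolutions have the same regularity, with no need to
  construct isomorphisms between them. That the resolution stops after second syzygies is Hilbert's
  syzygy theorem, obtained from a Koszul argument (`ker_eq_bot_of_third_syzygy`).

It remains to see that `H` is eventually equal to the total Tjurina number
(`exists_forall_finrank_milnorPiece_eq`). A reduced curve has finitely many singular points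
(`finite_singularPoints`): the partial derivatives have no common factor, and `S` has dimension three.
For a homogeneous ideal `I` with finitely many projective zeros and a linear form `ℓ` vanishing at none
of them, `dim (S/I)_i` is eventually equal to the dimension of `S/(I + (ℓ - 1))`
(`exists_forall_finrank_quotientPiece_eq`). By the Chinese remainder theorem that ring is, for `I = J`, a
product over the singular points (`exists_finrank_eq_sum`). The factor at `p` has the dimension of the
local algebra at `p` in a coordinate chart, because both are eventual values of the Hilbert function of
`S/(J + I_p^N)` for large `N`, where `I_p` is the homogeneous ideal of `p` (`finrank_eq_localTjurina`).

For `d = 1` the Milnor algebra is zero, both invariants are `-∞`, and a line is free.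
-/

noncomputable section

open MvPolynomial

namespace PlaneCurve

/-! ### Homogeneous maps between graded free modules -/

section GradedFree

variable {σ k : Type*} [Field k]

lemma mem_polyPiece_iff {n : ℤ} {p : MvPolynomial σ k} :
    p ∈ polyPiece σ k n ↔ ∀ d, coeff d p ≠ 0 → (d.degree : ℤ) = n := by
  unfold polyPiece
  split_ifs with h
  · rw [mem_homogeneousSubmodule]
    constructor
    · intro hp d hd
      have := hp hd
      have h2 : d.degree = n.toNat := by
        rwa [Finsupp.degree_eq_weight_one]
      omega
    · intro hp d hd
      have h2 := hp d hd
      have h3 : d.degree = n.toNat := by omega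
      rwa [Finsupp.degree_eq_weight_one] at h3
  · rw [Submodule.mem_bot]
    constructor
    · rintro rfl d hd
      simp at hd
    · intro hp
      ext d
      by_contra hd
      have := hp d (by simpa using hd)
      omega

/-- The component of degree `n` of a polynomial, for an integer `n`. It is zero for `n < 0`. -/
def polyComp (n : ℤ) : MvPolynomial σ k →ₗ[k] MvPolynomial σ k :=
  if 0 ≤ n then homogeneousComponent n.toNat else 0

lemma coeff_polyComp (n : ℤ) (p : MvPolynomial σ k) (d : σ →₀ ℕ) :
    coeff d (polyComp n p) = if (d.degree : ℤ) = n then coeff d p else 0 := by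
  unfold polyComp
  split_ifs with h h' h'
  · rw [coeff_homogeneousComponent, if_pos (by omega)]
  · rw [coeff_homogeneousComponent, if_neg (by omega)]
  · omega
  · simp

lemma polyComp_mem (n : ℤ) (p : MvPolynomial σ k) : polyComp n p ∈ polyPiece σ k n := by
  rw [mem_polyPiece_iff]
  intro d hd
  rw [coeff_polyComp] at hd
  by_contra h
  simp [h] at hd

lemma polyComp_of_mem {n : ℤ} {p : MvPolynomial σ k} (hp : p ∈ polyPiece σ k n) :
    polyComp n p = p := by
  rw [mem_polyPiece_iff] at hp
  ext d
  rw [coeff_polyComp]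
  split_ifs with h
  · rfl
  · by_contra h'
    exact h (hp d (Ne.symm h'))

lemma polyComp_of_mem_of_ne {m n : ℤ} {p : MvPolynomial σ k} (hp : p ∈ polyPiece σ k m)
    (h : m ≠ n) : polyComp n p = 0 := by
  rw [mem_polyPiece_iff] at hp
  ext d
  rw [coeff_polyComp, coeff_zero]
  split_ifs with hd
  · by_contra h'
    exact h ((hp d h').symm.trans hd)
  · rfl

lemma polyPiece_mul_mem {m n : ℤ} {p q : MvPolynomial σ k} (hp : p ∈ polyPiece σ k m)
    (hq : q ∈ polyPiece σ k n) : p * q ∈ polyPiece σ k (m + n) := by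
  classical
  rw [mem_polyPiece_iff] at *
  intro d hd
  rw [coeff_mul] at hd
  obtain ⟨⟨u, v⟩, huv, hne⟩ := Finset.exists_ne_zero_of_sum_ne_zero hd
  have hu := hp u (left_ne_zero_of_mul hne)
  have hv := hq v (right_ne_zero_of_mul hne)
  rw [Finset.HasAntidiagonal.mem_antidiagonal] at huv
  rw [← huv, map_add]
  push_cast
  dsimp only at *
  omega

/-- The components of `p` in the degrees `0, …, deg p` add up to `p`. -/
lemma sum_polyComp (p : MvPolynomial σ k) :
    ∑ i ∈ Finset.range (p.totalDegree + 1), polyComp (i : ℤ) p = p := by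
  conv_rhs => rw [← sum_homogeneousComponent p]
  refine Finset.sum_congr rfl fun i _ => ?_
  simp [polyComp]

lemma ext_polyComp {p q : MvPolynomial σ k} (h : ∀ n, polyComp n p = polyComp n q) : p = q := by
  ext d
  have := congrArg (coeff d) (h d.degree)
  simpa [coeff_polyComp] using this

lemma polyComp_mul {a : ℤ} {c : MvPolynomial σ k} (hc : c ∈ polyPiece σ k a) (n : ℤ)
    (p : MvPolynomial σ k) : polyComp n (p * c) = polyComp (n - a) p * c := by
  conv_lhs => rw [← sum_polyComp p]
  conv_rhs => rw [← sum_polyComp p]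
  simp only [Finset.sum_mul, map_sum]
  refine Finset.sum_congr rfl fun i _ => ?_
  have hi := polyComp_mem (i : ℤ) p
  by_cases h : (i : ℤ) = n - a
  · have h2 := polyPiece_mul_mem hi hc
    rw [← h, polyComp_of_mem hi, polyComp_of_mem]
    rwa [h, sub_add_cancel, ← h] at h2
  · rw [polyComp_of_mem_of_ne hi h, polyComp_of_mem_of_ne (polyPiece_mul_mem hi hc) (by omega),
      zero_mul]

lemma polyPiece_eq_bot {n : ℤ} (hn : n < 0) : polyPiece σ k n = ⊥ := by
  simp [polyPiece, not_le.mpr hn]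

lemma polyPiece_natCast (n : ℕ) : polyPiece σ k (n : ℤ) = homogeneousSubmodule σ k n := by
  simp [polyPiece]

lemma mem_polyPiece_zero {p : MvPolynomial σ k} (hp : p ∈ polyPiece σ k 0) :
    p = C (constantCoeff p) := by
  have h := polyComp_of_mem hp
  rw [← h]
  simp [polyComp]

lemma constantCoeff_of_mem_polyPiece {n : ℤ} (hn : n ≠ 0) {p : MvPolynomial σ k}
    (hp : p ∈ polyPiece σ k n) : constantCoeff p = 0 := by
  by_contra h
  rw [constantCoeff_eq] at h
  have := mem_polyPiece_iff.mp hp 0 h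
  simp at this
  exact hn this.symm

instance [Finite σ] (n : ℤ) : FiniteDimensional k (polyPiece σ k n) := by
  refine Module.Finite.iff_fg.mpr ?_
  unfold polyPiece
  split_ifs
  · exact homogeneousSubmodule_fg σ k _
  · exact Submodule.fg_bot

/-- The degree `n` piece of the graded free module `⨁_j S(-a_j)`. -/
def freePiece {ι : Type*} (a : ι → ℤ) (n : ℤ) : Submodule k (ι → MvPolynomial σ k) :=
  Submodule.pi Set.univ fun j => polyPiece σ k (n - a j)

/-- The component of degree `n` of an element of the graded free module `⨁_j S(-a_j)`. -/
def freeComp {ι : Type*} (a : ι → ℤ) (n : ℤ) :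
    (ι → MvPolynomial σ k) →ₗ[k] (ι → MvPolynomial σ k) :=
  LinearMap.pi fun j => polyComp (n - a j) ∘ₗ LinearMap.proj j

variable {ι κ : Type*}

@[simp]
lemma freeComp_apply (a : ι → ℤ) (n : ℤ) (v : ι → MvPolynomial σ k) (j : ι) :
    freeComp a n v j = polyComp (n - a j) (v j) := rfl

lemma mem_freePiece {a : ι → ℤ} {n : ℤ} {v : ι → MvPolynomial σ k} :
    v ∈ freePiece a n ↔ ∀ j, v j ∈ polyPiece σ k (n - a j) := by
  simp [freePiece]

lemma freeComp_mem (a : ι → ℤ) (n : ℤ) (v : ι → MvPolynomial σ k) :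
    freeComp a n v ∈ freePiece a n :=
  mem_freePiece.mpr fun _ => polyComp_mem _ _

lemma freeComp_of_mem {a : ι → ℤ} {n : ℤ} {v : ι → MvPolynomial σ k} (hv : v ∈ freePiece a n) :
    freeComp a n v = v :=
  funext fun j => polyComp_of_mem (mem_freePiece.mp hv j)

lemma freeComp_of_mem_of_ne {a : ι → ℤ} {m n : ℤ} {v : ι → MvPolynomial σ k}
    (hv : v ∈ freePiece a m) (h : m ≠ n) : freeComp a n v = 0 :=
  funext fun j => polyComp_of_mem_of_ne (mem_freePiece.mp hv j) (by omega)

lemma ext_freeComp {a : ι → ℤ} {v w : ι → MvPolynomial σ k}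
    (h : ∀ n, freeComp a n v = freeComp a n w) : v = w := by
  funext j
  refine ext_polyComp fun n => ?_
  have := congrFun (h (n + a j)) j
  simpa using this

lemma freeComp_smul {a : ι → ℤ} {m : ℤ} {w : ι → MvPolynomial σ k} (hw : w ∈ freePiece a m) (n : ℤ)
    (p : MvPolynomial σ k) : freeComp a n (p • w) = polyComp (n - m) p • w := by
  funext j
  have := polyComp_mul (mem_freePiece.mp hw j) (n - a j) p
  simp only [freeComp_apply, Pi.smul_apply, smul_eq_mul, this]
  congr 2
  ring_nf

/-- An element of a graded free module is the sum of finitely many of its components. -/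
lemma exists_sum_freeComp [Finite ι] (a : ι → ℤ) (v : ι → MvPolynomial σ k) :
    ∃ s : Finset ℤ, v = ∑ n ∈ s, freeComp a n v := by
  classical
  cases nonempty_fintype ι
  let N := fun j => (Finset.range ((v j).totalDegree + 1)).image fun i : ℕ => (i : ℤ) + a j
  refine ⟨Finset.univ.biUnion N, ?_⟩
  refine ext_freeComp (a := a) fun m => ?_
  rw [map_sum]
  by_cases hm : m ∈ Finset.univ.biUnion N
  · rw [Finset.sum_eq_single m]
    · rw [freeComp_of_mem (freeComp_mem _ _ _)]
    · intro b _ hb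
      exact freeComp_of_mem_of_ne (freeComp_mem _ _ _) hb
    · intro h
      exact absurd hm h
  · rw [Finset.sum_eq_zero]
    · funext j
      ext d
      rw [freeComp_apply, coeff_polyComp]
      split_ifs with h
      · by_contra hne
        apply hm
        have h1 : d.degree ≤ (v j).totalDegree := by
          rw [Finsupp.degree_apply]
          exact le_totalDegree (mem_support_iff.mpr (by simpa using hne))
        simp only [N, Finset.mem_biUnion, Finset.mem_univ, true_and, Finset.mem_image,
          Finset.mem_range]
        exact ⟨j, d.degree, by omega, by omega⟩
      · simp
    · intro n hn
      refine freeComp_of_mem_of_ne (freeComp_mem _ _ _) ?_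
      rintro rfl
      exact hm hn

variable [Finite ι] [DecidableEq ι]

/-- A functional on a graded free module which is homogeneous of degree `b` on the basis
commutes with taking components. -/
lemma polyComp_apply_of_homogeneous {a : ι → ℤ} {b : ℤ}
    {φ : (ι → MvPolynomial σ k) →ₗ[MvPolynomial σ k] MvPolynomial σ k}
    (hφ : ∀ l, φ (Pi.single l 1) ∈ polyPiece σ k (a l - b)) (n : ℤ) (v : ι → MvPolynomial σ k) :
    polyComp (n - b) (φ v) = φ (freeComp a n v) := by
  cases nonempty_fintype ι
  rw [LinearMap.pi_apply_eq_sum_univ φ v, LinearMap.pi_apply_eq_sum_univ φ (freeComp a n v),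
    map_sum]
  refine Finset.sum_congr rfl fun l _ => ?_
  have := polyComp_mul (hφ l) (n - b) (v l)
  have h2 : ∀ i : ι, (fun j => if l = j then (1 : MvPolynomial σ k) else 0) i =
      (Pi.single l 1 : ι → MvPolynomial σ k) i := by
    intro i
    simp [Pi.single_apply, eq_comm]
  rw [funext h2, smul_eq_mul, smul_eq_mul, this, freeComp_apply]
  congr 2
  ring_nf

/-- A linear map between graded free modules which is homogeneous of degree zero on the basis
commutes with taking components. -/
lemma freeComp_apply_of_homogeneous {a : ι → ℤ} {b : κ → ℤ}
    {φ : (ι → MvPolynomial σ k) →ₗ[MvPolynomial σ k] (κ → MvPolynomial σ k)}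
    (hφ : ∀ l j, φ (Pi.single l 1) j ∈ polyPiece σ k (a l - b j)) (n : ℤ)
    (v : ι → MvPolynomial σ k) :
    freeComp b n (φ v) = φ (freeComp a n v) := by
  funext j
  exact polyComp_apply_of_homogeneous (φ := LinearMap.proj j ∘ₗ φ) (fun l => hφ l j) n v

lemma map_freePiece {a : ι → ℤ} {b : κ → ℤ}
    {φ : (ι → MvPolynomial σ k) →ₗ[MvPolynomial σ k] (κ → MvPolynomial σ k)}
    (hφ : ∀ l j, φ (Pi.single l 1) j ∈ polyPiece σ k (a l - b j)) (n : ℤ) :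
    (freePiece a n).map (φ.restrictScalars k) =
      freePiece b n ⊓ (LinearMap.range φ).restrictScalars k := by
  ext w
  simp only [Submodule.mem_map, LinearMap.coe_restrictScalars, Submodule.mem_inf,
    Submodule.restrictScalars_mem, LinearMap.mem_range]
  constructor
  · rintro ⟨v, hv, rfl⟩
    refine ⟨?_, v, rfl⟩
    rw [← freeComp_of_mem hv, ← freeComp_apply_of_homogeneous hφ]
    exact freeComp_mem _ _ _
  · rintro ⟨hw, v, rfl⟩
    refine ⟨freeComp a n v, freeComp_mem _ _ _, ?_⟩
    rw [← freeComp_apply_of_homogeneous hφ, freeComp_of_mem hw]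

lemma map_freePiece_functional {a : ι → ℤ} {b : ℤ}
    {φ : (ι → MvPolynomial σ k) →ₗ[MvPolynomial σ k] MvPolynomial σ k}
    (hφ : ∀ l, φ (Pi.single l 1) ∈ polyPiece σ k (a l - b)) (n : ℤ) :
    (freePiece a n).map (φ.restrictScalars k) =
      polyPiece σ k (n - b) ⊓ (LinearMap.range φ).restrictScalars k := by
  ext w
  simp only [Submodule.mem_map, LinearMap.coe_restrictScalars, Submodule.mem_inf,
    Submodule.restrictScalars_mem, LinearMap.mem_range]
  constructor
  · rintro ⟨v, hv, rfl⟩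
    refine ⟨?_, v, rfl⟩
    rw [← freeComp_of_mem hv, ← polyComp_apply_of_homogeneous hφ]
    exact polyComp_mem _ _
  · rintro ⟨hw, v, rfl⟩
    refine ⟨freeComp a n v, freeComp_mem _ _ _, ?_⟩
    rw [← polyComp_apply_of_homogeneous hφ, polyComp_of_mem hw]

end GradedFree

section Dimension

variable {k : Type*} [Field k]

/-- The dimension `(n + 2)(n + 1) / 2` of the space of ternary forms of degree `n`, and `0` for `n < 0`.
The polynomial expression vanishes for `n = -1, -2` as well. -/
def ternaryDim (n : ℤ) : ℤ := if 0 ≤ n then (n + 2) * (n + 1) / 2 else 0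

lemma two_mul_ternaryDim {n : ℤ} (hn : -2 ≤ n) : 2 * ternaryDim n = (n + 2) * (n + 1) := by
  unfold ternaryDim
  split_ifs with h
  · refine Int.mul_ediv_cancel' ?_
    rw [mul_comm]
    have := Int.even_mul_succ_self (n + 1)
    rw [add_assoc] at this
    exact this.two_dvd
  · have : n = -2 ∨ n = -1 := by omega
    rcases this with rfl | rfl <;> norm_num

lemma ternaryDim_of_neg {n : ℤ} (hn : n < 0) : ternaryDim n = 0 := by
  simp [ternaryDim, not_le.mpr hn]

lemma finrank_homogeneousSubmodule (n : ℕ) :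
    Module.finrank k (homogeneousSubmodule (Fin 3) k n) = (n + 2).choose 2 := by
  rw [homogeneousSubmodule_eq_finsupp_supported,
    (AddMonoidAlgebra.supportedEquivFinsupp (R := k) (S := k)
      {d : Fin 3 →₀ ℕ | d.degree = n}).finrank_eq]
  have h : {d : Fin 3 →₀ ℕ | d.degree = n} =
      ((Finset.univ : Finset (Fin 3)).finsuppAntidiag n : Set (Fin 3 →₀ ℕ)) := by
    ext d
    simp [Finset.mem_finsuppAntidiag, Finsupp.degree_eq_sum]
  rw [h, Module.finrank_finsupp_self]
  simp only [Finset.coe_sort_coe, Fintype.card_coe, Finset.card_finsuppAntidiag_nat_eq_choose,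
    Finset.card_univ, Fintype.card_fin]
  rw [show 3 + n - 1 = n + 2 by omega, Nat.choose_symm_add]

lemma finrank_polyPiece (n : ℤ) :
    (Module.finrank k (polyPiece (Fin 3) k n) : ℤ) = ternaryDim n := by
  by_cases h : 0 ≤ n
  · lift n to ℕ using h
    rw [polyPiece_natCast, finrank_homogeneousSubmodule]
    have := two_mul_ternaryDim (n := n) (by omega)
    have h2 := Nat.triangle_succ (n + 1)
    have h3 : (n + 2).choose 2 * 2 = (n + 2) * (n + 1) := by
      rw [Nat.choose_two_right]
      exact Nat.div_mul_cancel (by simpa [mul_comm] using (Nat.even_mul_succ_self (n+1)).two_dvd)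
    zify at h3
    linarith
  · rw [polyPiece_eq_bot (by omega), ternaryDim_of_neg (by omega)]
    simp

/-- A graded piece of a free module is the product of graded pieces of the polynomial ring. -/
def freePieceEquiv {σ ι : Type*} (a : ι → ℤ) (n : ℤ) :
    freePiece (σ := σ) (k := k) a n ≃ₗ[k] (∀ j, polyPiece σ k (n - a j)) where
  toFun v j := ⟨v.1 j, mem_freePiece.mp v.2 j⟩
  invFun w := ⟨fun j => w j, mem_freePiece.mpr fun j => (w j).2⟩
  map_add' _ _ := rfl
  map_smul' _ _ := rfl
  left_inv _ := rfl
  right_inv _ := rfl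

instance {σ ι : Type*} [Finite σ] [Finite ι] (a : ι → ℤ) (n : ℤ) :
    FiniteDimensional k (freePiece (σ := σ) (k := k) a n) :=
  Module.Finite.equiv (freePieceEquiv a n).symm

lemma finrank_freePiece {ι : Type*} [Fintype ι] (a : ι → ℤ) (n : ℤ) :
    (Module.finrank k (freePiece (σ := Fin 3) (k := k) a n) : ℤ) = ∑ j, ternaryDim (n - a j) := by
  rw [(freePieceEquiv a n).finrank_eq, Module.finrank_pi_fintype]
  push_cast
  exact Finset.sum_congr rfl fun j _ => finrank_polyPiece _

end Dimension

/-! ### Syzygies: a Koszul argument and Nakayama's lemma -/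

section Koszul

variable {R : Type*} [CommRing R] {ι κ μ : Type*}

lemma mem_smul_top_of_forall_mem [Finite ι] {I : Ideal R} {v : ι → R} (hv : ∀ j, v j ∈ I) :
    v ∈ I • (⊤ : Submodule R (ι → R)) := by
  classical
  cases nonempty_fintype ι
  rw [← Finset.univ_sum_single v]
  refine Submodule.sum_mem _ fun j _ => ?_
  have : Pi.single j (v j) = v j • (Pi.single j 1 : ι → R) := by
    rw [← Pi.single_smul, smul_eq_mul, mul_one]
  rw [this]
  exact Submodule.smul_mem_smul (hv j) trivial

lemma apply_mem_of_mem_smul {I : Ideal R} {N : Submodule R (ι → R)} {v : ι → R}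
    (hv : v ∈ I • N) (j : ι) : v j ∈ I := by
  induction hv using Submodule.smul_induction_on' with
  | smul r hr n hn => exact I.mul_mem_right _ hr
  | add x _ y _ hx hy => exact I.add_mem hx hy

lemma apply_mem_of_forall_mem [Finite ι] {I : Ideal R} (d : (ι → R) →ₗ[R] (κ → R)) {v : ι → R}
    (hv : ∀ j, v j ∈ I) (i : κ) : d v i ∈ I := by
  have h := Submodule.mem_map_of_mem (f := d) (mem_smul_top_of_forall_mem hv)
  rw [Submodule.map_smul''] at h
  exact apply_mem_of_mem_smul h i

/-- The condition `I F ∩ ker d = I ker d` on a map `d : F → G` of free modules and an ideal `I`; it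
says that `F / ker d` has no first torsion with respect to `R / I`. -/
def KernelPure (I : Ideal R) (d : (ι → R) →ₗ[R] (κ → R)) : Prop :=
  ∀ v, d v = 0 → (∀ j, v j ∈ I) → v ∈ I • LinearMap.ker d

lemma kernelPure_bot (d : (ι → R) →ₗ[R] (κ → R)) : KernelPure ⊥ d := by
  intro v _ hv
  rw [show v = 0 from funext hv]
  exact zero_mem _

/-- The inductive step of the Koszul argument: purity of the kernel for `I` extends to `I + (a)` when
`a` is regular modulo `I` and elements of the image of `d` with entries in `I` come from elements with
entries in `I`. -/
lemma KernelPure.sup_span [Finite ι] {I : Ideal R} {a : R} (ha : ∀ p, a * p ∈ I → p ∈ I)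
    {d : (ι → R) →ₗ[R] (κ → R)} (hd : KernelPure I d)
    (hlift : ∀ v, (∀ j, d v j ∈ I) → ∃ u, (∀ j, u j ∈ I) ∧ d u = d v) :
    KernelPure (I ⊔ Ideal.span {a}) d := by
  intro v hv hvI
  have h : ∀ j, ∃ y ∈ I, ∃ c, y + c * a = v j := by
    intro j
    obtain ⟨y, hy, z, hz, hyz⟩ := Submodule.mem_sup.mp (hvI j)
    obtain ⟨c, rfl⟩ := Ideal.mem_span_singleton'.mp hz
    exact ⟨y, hy, c, hyz⟩
  choose w hw c hc using h
  have hvw : v = w + a • c := by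
    funext j
    rw [← hc j]
    simp [mul_comm]
  have h1 : ∀ i, d c i ∈ I := by
    intro i
    apply ha
    have h2 : d w i + a * d c i = 0 := by
      have := congrFun hv i
      rw [hvw, map_add, map_smul] at this
      simpa using this
    rw [← neg_eq_iff_add_eq_zero] at h2
    rw [← h2]
    exact I.neg_mem (apply_mem_of_forall_mem d hw i)
  obtain ⟨u, hu, hduc⟩ := hlift c h1
  have h3 : v = (w + a • u) + a • (c - u) := by
    rw [hvw, smul_sub]
    abel
  have h4 : c - u ∈ LinearMap.ker d := by
    rw [LinearMap.mem_ker, map_sub, hduc, sub_self]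
  have h5 : d (w + a • u) = 0 := by
    have : w + a • u = v - a • (c - u) := by
      rw [eq_sub_iff_add_eq]
      exact h3.symm
    rw [this, map_sub, map_smul, LinearMap.mem_ker.mp h4, hv]
    simp
  rw [h3]
  refine Submodule.add_mem _ ?_ ?_
  · refine Submodule.smul_mono_left le_sup_left (hd _ h5 fun j => ?_)
    exact I.add_mem (hw j) (I.mul_mem_left _ (hu j))
  · exact Submodule.smul_mem_smul (le_sup_right (a := I) (Ideal.mem_span_singleton_self a)) h4

lemma KernelPure.exists_lift [Finite ι] {I : Ideal R}
    {d : (ι → R) →ₗ[R] (κ → R)} {d' : (κ → R) →ₗ[R] (μ → R)}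
    (hd' : KernelPure I d') (hex : LinearMap.range d = LinearMap.ker d')
    (v : ι → R) (hv : ∀ j, d v j ∈ I) : ∃ u, (∀ j, u j ∈ I) ∧ d u = d v := by
  have h : d v ∈ I • LinearMap.ker d' := by
    refine hd' _ ?_ hv
    rw [← LinearMap.mem_ker, ← hex]
    exact LinearMap.mem_range_self d v
  rw [← hex, ← Submodule.map_top, ← Submodule.map_smul''] at h
  obtain ⟨u, hu, hdu⟩ := h
  exact ⟨u, apply_mem_of_mem_smul hu, hdu⟩

end Koszul

section Nakayama

variable {σ k : Type*} [Field k]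

lemma mem_span_range_X_iff {p : MvPolynomial σ k} :
    p ∈ Ideal.span (Set.range (X : σ → MvPolynomial σ k)) ↔ constantCoeff p = 0 := by
  rw [← Set.image_univ, mem_ideal_span_X_image]
  constructor
  · intro h
    by_contra hne
    obtain ⟨i, _, hi⟩ := h 0 (mem_support_iff.mpr hne)
    exact hi rfl
  · intro h m hm
    by_contra! hz
    have : m = 0 := Finsupp.ext fun i => hz i trivial
    rw [this, mem_support_iff, ← constantCoeff_eq] at hm
    exact hm h

lemma mem_of_X_mul_mem_span {s : Set σ} {i : σ} (hi : i ∉ s) {p : MvPolynomial σ k}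
    (h : X i * p ∈ Ideal.span (X '' s)) : p ∈ Ideal.span (X '' s) := by
  classical
  rw [mem_ideal_span_X_image] at *
  intro m hm
  obtain ⟨j, hj, hne⟩ := h (Finsupp.single i 1 + m) (by
    rw [mem_support_iff, coeff_X_mul]
    exact mem_support_iff.mp hm)
  refine ⟨j, hj, ?_⟩
  have : i ≠ j := fun hij => hi (hij ▸ hj)
  simpa [Finsupp.single_apply, this] using hne

lemma ne_zero_of_sub_one_mem {r : MvPolynomial σ k}
    (hr : r - 1 ∈ Ideal.span (Set.range (X : σ → MvPolynomial σ k))) : r ≠ 0 := by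
  rintro rfl
  rw [mem_span_range_X_iff] at hr
  simp at hr

/-- A submodule `N` of a free module with `N = 𝔪 N` is zero, with no homogeneity assumed: Nakayama's
lemma makes an element of `1 + 𝔪` annihilate `N`, and free modules are torsion-free. -/
lemma eq_bot_of_le_smul [Finite σ] {ι : Type*} [Finite ι]
    {N : Submodule (MvPolynomial σ k) (ι → MvPolynomial σ k)}
    (h : N ≤ Ideal.span (Set.range (X : σ → MvPolynomial σ k)) • N) : N = ⊥ := by
  obtain ⟨r, hr, hrN⟩ := Submodule.exists_sub_one_mem_and_smul_eq_zero_of_fg_of_le_smul _ N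
    (IsNoetherian.noetherian N) h
  rw [eq_bot_iff]
  intro v hv
  exact (smul_eq_zero.mp (hrN v hv)).resolve_left (ne_zero_of_sub_one_mem hr)

/-- For one variable the purity of the kernel only uses that the target is torsion-free. -/
lemma kernelPure_span_X {ι κ : Type*} [Finite ι] (i : σ)
    (d : (ι → MvPolynomial σ k) →ₗ[MvPolynomial σ k] (κ → MvPolynomial σ k)) :
    KernelPure (Ideal.span (X '' {i})) d := by
  have h := KernelPure.sup_span (I := ⊥) (a := X i) (fun p hp => by simpa using hp)
    (kernelPure_bot d) (fun v hv => ⟨0, fun j => Submodule.zero_mem _, by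
      rw [map_zero]
      exact (funext hv).symm⟩)
  rwa [bot_sup_eq, ← Set.image_singleton] at h

/-- The third syzygies over a polynomial ring in three variables are free, in the following form: in an
exact sequence `F₃ → F₂ → F₁ → F₀` of free modules the first map is injective if its kernel lies in
`𝔪 F₃`. -/
lemma ker_eq_bot_of_third_syzygy {ι₀ ι₁ ι₂ ι₃ : Type*} [Finite ι₁] [Finite ι₂]
    [Finite ι₃]
    {θ : (ι₁ → MvPolynomial (Fin 3) k) →ₗ[MvPolynomial (Fin 3) k] (ι₀ → MvPolynomial (Fin 3) k)}
    {p : (ι₂ → MvPolynomial (Fin 3) k) →ₗ[MvPolynomial (Fin 3) k] (ι₁ → MvPolynomial (Fin 3) k)}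
    {q : (ι₃ → MvPolynomial (Fin 3) k) →ₗ[MvPolynomial (Fin 3) k] (ι₂ → MvPolynomial (Fin 3) k)}
    (hp : LinearMap.range p = LinearMap.ker θ) (hq : LinearMap.range q = LinearMap.ker p)
    (hmin : ∀ v, q v = 0 → ∀ j, constantCoeff (v j) = 0) : LinearMap.ker q = ⊥ := by
  let I : Set (Fin 3) → Ideal (MvPolynomial (Fin 3) k) := fun s => Ideal.span (X '' s)
  have hI : ∀ (s : Set (Fin 3)) (i : Fin 3), I s ⊔ Ideal.span {X i} = I (s ∪ {i}) := by
    intro s i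
    simp only [I]
    rw [Set.image_union, Set.image_singleton, Ideal.span_union]
  have hreg : ∀ (s : Set (Fin 3)) (i : Fin 3), i ∉ s → ∀ f, X i * f ∈ I s → f ∈ I s :=
    fun s i hi f hf => mem_of_X_mul_mem_span hi hf
  have hp2 : KernelPure (I ({0} ∪ {1})) p := by
    rw [← hI]
    exact KernelPure.sup_span (hreg _ _ (by simp)) (kernelPure_span_X 0 p)
      ((kernelPure_span_X 0 θ).exists_lift hp)
  have hq2 : KernelPure (I ({0} ∪ {1})) q := by
    rw [← hI]
    exact KernelPure.sup_span (hreg _ _ (by simp)) (kernelPure_span_X 0 q)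
      ((kernelPure_span_X 0 p).exists_lift hq)
  have hq3 : KernelPure (I (({0} ∪ {1}) ∪ {2})) q := by
    rw [← hI]
    exact KernelPure.sup_span (hreg _ _ (by simp)) hq2 (hp2.exists_lift hq)
  have huniv : I (({0} ∪ {1}) ∪ {2}) = Ideal.span (Set.range X) := by
    rw [← Set.image_univ]
    simp only [I]
    congr 2
    ext i
    fin_cases i <;> simp
  rw [huniv] at hq3
  refine eq_bot_of_le_smul fun v hv => ?_
  exact hq3 v hv fun j => mem_span_range_X_iff.mpr (hmin v hv j)

end Nakayama

/-! ### Reflexive modules of rank one and the degrees of second syzygies -/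

section Reflexive

/-- A submodule of rank at most one of a free module over a unique factorization domain is cyclic if
the ambient module has no torsion modulo it. -/
lemma exists_eq_span_singleton_of_saturated {R ι : Type*} [CommRing R] [IsDomain R]
    [UniqueFactorizationMonoid R] [IsNoetherianRing R] [Finite ι] (N : Submodule R (ι → R))
    (hsat : ∀ (s : R) v, s ≠ 0 → s • v ∈ N → v ∈ N)
    (hrank : ∀ u ∈ N, ∀ v ∈ N, ∃ b c : R, (b ≠ 0 ∨ c ≠ 0) ∧ b • u = c • v) :
    ∃ u ∈ N, ∀ v ∈ N, ∃ c : R, v = c • u := by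
  by_cases hN : N = ⊥
  · exact ⟨0, N.zero_mem, fun v hv => ⟨0, by simpa [hN] using hv⟩⟩
  obtain ⟨u₁, hu₁, hu₁0⟩ := Submodule.exists_mem_ne_zero_of_ne_bot hN
  -- take a maximal cyclic submodule
  obtain ⟨_, ⟨u, ⟨huN, hu0⟩, rfl⟩, hmax⟩ := set_has_maximal_iff_noetherian.mpr
    (inferInstance : IsNoetherian R (ι → R))
    ((fun u : ι → R => Submodule.span R {u}) '' {u | u ∈ N ∧ u ≠ 0}) ⟨_, u₁, ⟨hu₁, hu₁0⟩, rfl⟩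
  refine ⟨u, huN, fun v hv => ?_⟩
  obtain ⟨b, c, hbc, h⟩ := hrank u huN v hv
  by_cases hc : c = 0
  · have hb : b ≠ 0 := by simpa [hc] using hbc
    rw [hc, zero_smul, smul_eq_zero] at h
    exact absurd h (by simp [hb, hu0])
  obtain ⟨c', b', g, hrel, hgc, hgb⟩ := UniqueFactorizationMonoid.exists_reduced_factors c hc b
  have hg : g ≠ 0 := by
    rintro rfl
    simp at hgc
    exact hc hgc.symm
  have h2 : b' • u = c' • v := by
    rw [← hgc, ← hgb, mul_smul, mul_smul] at h
    exact smul_right_injective _ hg h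
  have h3 : ∀ i, ∃ w, u i = c' * w := by
    intro i
    have : c' ∣ b' * u i := ⟨v i, congrFun h2 i⟩
    exact hrel.dvd_of_dvd_mul_left this
  choose w hw using h3
  have huw : u = c' • w := funext hw
  have hwN : w ∈ N := by
    refine hsat c' w ?_ (huw ▸ huN)
    rintro rfl
    simp at huw
    exact hu0 huw
  have hw0 : w ≠ 0 := by
    rintro rfl
    simp at huw
    exact hu0 huw
  have hle : Submodule.span R {u} ≤ Submodule.span R {w} := by
    rw [Submodule.span_singleton_le_iff_mem, Submodule.mem_span_singleton]
    exact ⟨c', huw.symm⟩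
  have heq := eq_of_le_of_not_lt hle (hmax _ ⟨w, ⟨hwN, hw0⟩, rfl⟩)
  have hwu : w ∈ Submodule.span R {u} := heq ▸ Submodule.mem_span_singleton_self w
  obtain ⟨t, ht⟩ := Submodule.mem_span_singleton.mp hwu
  refine ⟨t * b', ?_⟩
  have hct : c' * t = 1 := by
    have : (c' * t) • u = (1 : R) • u := by
      rw [mul_smul, ht, one_smul, ← huw]
    exact smul_left_injective R hu0 this
  rw [mul_smul, h2, smul_smul, mul_comm t, hct, one_smul]

/-- Any three elements of the kernel of a nonzero functional on a free module of rank at most three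
are linearly dependent. -/
lemma exists_dependence_of_mem_ker {R : Type*} [CommRing R] [IsDomain R]
    [IsNoetherianRing R] {r : ℕ} (hr : r ≤ 3)
    {θ : (Fin r → R) →ₗ[R] R} (hθ : θ ≠ 0) {u v w : Fin r → R} (hu : θ u = 0) (hv : θ v = 0)
    (hw : θ w = 0) : ∃ a b c : R, (a ≠ 0 ∨ b ≠ 0 ∨ c ≠ 0) ∧ a • u + b • v + c • w = 0 := by
  have h1 := (LinearMap.ker θ).finrank_quotient_add_finrank
  rw [θ.quotKerEquivRange.finrank_eq, Module.finrank_fin_fun] at h1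
  have h2 : Module.finrank R (LinearMap.range θ) ≠ 0 := by
    intro h0
    rw [Module.finrank_eq_zero_iff_isTorsion] at h0
    apply hθ
    ext1 i
    by_contra hne
    obtain ⟨a, ha⟩ := h0 (x := ⟨(θ ∘ₗ LinearMap.single R (fun _ => R) i) 1, by simp⟩)
    have := congrArg Subtype.val ha
    simp only [Submonoid.smul_def] at this
    rcases smul_eq_zero.mp this with h | h
    · exact nonZeroDivisors.coe_ne_zero a h
    · exact hne (LinearMap.ext_ring h)
  have h3 : ¬ LinearIndependent R
      (![⟨u, hu⟩, ⟨v, hv⟩, ⟨w, hw⟩] : Fin 3 → LinearMap.ker θ) := by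
    intro h
    have := h.fintype_card_le_finrank
    simp only [Fintype.card_fin] at this
    omega
  obtain ⟨g, hg, i, hi⟩ := Fintype.not_linearIndependent_iff.mp h3
  refine ⟨g 0, g 1, g 2, ?_, ?_⟩
  · by_contra! h
    fin_cases i
    · exact hi h.1
    · exact hi h.2.1
    · exact hi h.2.2
  · have := congrArg Subtype.val hg
    simpa [Fin.sum_univ_three] using this

variable {σ k : Type*} [Field k] [Finite σ]

/-- If one generator occurs in no relation of a minimal presentation of the kernel of a nonzero
functional on a free module of rank `≤ 3`, then there are no relations at all: the kernel is the direct
sum of the submodule spanned by that generator and of a reflexive module of rank at most one, hence free. -/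
lemma ker_eq_bot_of_row_eq_zero {r m : ℕ} (hr : r ≤ 3)
    {θ : (Fin r → MvPolynomial σ k) →ₗ[MvPolynomial σ k] MvPolynomial σ k} (hθ : θ ≠ 0)
    {p : (Fin m → MvPolynomial σ k) →ₗ[MvPolynomial σ k] (Fin r → MvPolynomial σ k)}
    (hp : LinearMap.range p = LinearMap.ker θ)
    (hmin : ∀ w, p w = 0 → ∀ j, constantCoeff (w j) = 0)
    (j₀ : Fin m) (hrow : ∀ w, p w = 0 → w j₀ = 0) : LinearMap.ker p = ⊥ := by
  have hθp : ∀ w, θ (p w) = 0 := fun w => by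
    rw [← LinearMap.mem_ker, ← hp]
    exact LinearMap.mem_range_self p w
  let e : Fin m → MvPolynomial σ k := Pi.single j₀ 1
  have he : e j₀ = 1 := Pi.single_eq_same j₀ 1
  let N : Submodule (MvPolynomial σ k) (Fin r → MvPolynomial σ k) :=
    (LinearMap.ker (LinearMap.proj (R := MvPolynomial σ k) (φ := fun _ => MvPolynomial σ k) j₀)).map p
  have hN : ∀ u, u ∈ N ↔ ∃ w, w j₀ = 0 ∧ p w = u := fun u => by
    simp [N, Submodule.mem_map]
  obtain ⟨u₀, hu₀, hcyc⟩ := exists_eq_span_singleton_of_saturated N (by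
    intro s v hs hv
    obtain ⟨w', hw', hpw'⟩ := (hN _).mp hv
    have hv0 : θ v = 0 := by
      have : s * θ v = 0 := by
        rw [← smul_eq_mul, ← map_smul, ← hpw', hθp]
      exact (mul_eq_zero.mp this).resolve_left hs
    rw [← LinearMap.mem_ker, ← hp] at hv0
    obtain ⟨w, rfl⟩ := hv0
    refine (hN _).mpr ⟨w, ?_, rfl⟩
    have := hrow (s • w - w') (by rw [map_sub, map_smul, hpw', sub_self])
    simpa [hw', hs] using this) (by
    intro u hu v hv
    obtain ⟨w, hw, rfl⟩ := (hN _).mp hu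
    obtain ⟨w', hw', rfl⟩ := (hN _).mp hv
    obtain ⟨a, b, c, hne, h⟩ := exists_dependence_of_mem_ker hr hθ (hθp e) (hθp w) (hθp w')
    have ha : a = 0 := by
      have := hrow (a • e + b • w + c • w') (by simpa using h)
      simpa [he, hw, hw'] using this
    refine ⟨b, -c, ?_, ?_⟩
    · simpa [ha] using hne
    · rw [ha, zero_smul, zero_add] at h
      rw [neg_smul]
      exact eq_neg_of_add_eq_zero_left h)
  obtain ⟨w₀, hw₀, hpw₀, hw₀0⟩ : ∃ w₀, w₀ j₀ = 0 ∧ p w₀ = u₀ ∧ (u₀ = 0 → w₀ = 0) := by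
    by_cases h : u₀ = 0
    · exact ⟨0, rfl, by simp [h], fun _ => rfl⟩
    · obtain ⟨w, hw, hpw⟩ := (hN _).mp hu₀
      exact ⟨w, hw, hpw, fun h' => absurd h' h⟩
  -- the presentation splits: `e` and `w₀` span a complement of the kernel
  let P := Submodule.span (MvPolynomial σ k) {e, w₀}
  have hdisj : ∀ w ∈ P, p w = 0 → w = 0 := by
    intro w hw hpw
    obtain ⟨a, c, rfl⟩ := Submodule.mem_span_pair.mp hw
    have ha : a = 0 := by
      have := hrow _ hpw
      simpa [he, hw₀] using this
    rw [ha, zero_smul, zero_add] at hpw ⊢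
    rw [map_smul, hpw₀, smul_eq_zero] at hpw
    rcases hpw with hc | hu
    · rw [hc, zero_smul]
    · rw [hw₀0 hu, smul_zero]
  have htop : (⊤ : Submodule (MvPolynomial σ k) (Fin m → MvPolynomial σ k)) ≤
      P ⊔ Ideal.span (Set.range (X : σ → MvPolynomial σ k)) • ⊤ := by
    intro w _
    obtain ⟨c, hc⟩ := hcyc (p (w - w j₀ • e)) ((hN _).mpr ⟨_, by simp [he], rfl⟩)
    have hker : p (w - w j₀ • e - c • w₀) = 0 := by
      rw [map_sub, hc, map_smul, hpw₀, sub_self]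
    have hw : w = (w j₀ • e + c • w₀) + (w - w j₀ • e - c • w₀) := by abel
    rw [hw]
    refine Submodule.add_mem_sup (Submodule.mem_span_pair.mpr ⟨_, _, rfl⟩) ?_
    exact mem_smul_top_of_forall_mem fun j => mem_span_range_X_iff.mpr (hmin _ hker j)
  obtain ⟨s, hs, hsP⟩ := Submodule.exists_sub_one_mem_and_smul_le_of_fg_of_le_sup
    (Module.Finite.fg_top) le_rfl htop
  rw [eq_bot_iff]
  intro w hw
  have h1 : s • w ∈ P := hsP (Submodule.smul_mem_pointwise_smul w s ⊤ trivial)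
  have h2 := hdisj _ h1 (by rw [map_smul, LinearMap.mem_ker.mp hw, smul_zero])
  exact (smul_eq_zero.mp h2).resolve_left (ne_zero_of_sub_one_mem hs)

/-- In a minimal presentation `q` of the kernel of a nonzero functional on a free module of rank
`≤ 3`, with at least one relation, some relation has larger degree than all generators. Otherwise a
generator of maximal degree would occur in no relation. -/
lemma exists_shift_gt {r m n : ℕ} (hr : r ≤ 3)
    {θ : (Fin r → MvPolynomial σ k) →ₗ[MvPolynomial σ k] MvPolynomial σ k} (hθ : θ ≠ 0)
    {p : (Fin m → MvPolynomial σ k) →ₗ[MvPolynomial σ k] (Fin r → MvPolynomial σ k)}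
    {q : (Fin n → MvPolynomial σ k) →ₗ[MvPolynomial σ k] (Fin m → MvPolynomial σ k)}
    (hp : LinearMap.range p = LinearMap.ker θ) (hq : LinearMap.range q = LinearMap.ker p)
    (hmin : ∀ v j, constantCoeff (q v j) = 0) {D : Fin m → ℤ} {e : Fin n → ℤ}
    (hhom : ∀ l j, q (Pi.single l 1) j ∈ polyPiece σ k (e l - D j))
    (hinj : LinearMap.ker q = ⊥) (hn : 0 < n) : ∃ l, ∀ j, D j < e l := by
  by_contra! hle
  have hq0 : q (Pi.single ⟨0, hn⟩ 1) ≠ 0 := by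
    intro h
    have : (Pi.single ⟨0, hn⟩ 1 : Fin n → MvPolynomial σ k) = 0 := by
      rw [← Submodule.mem_bot (R := MvPolynomial σ k), ← hinj]
      exact h
    simpa using congrFun this ⟨0, hn⟩
  obtain ⟨j₁, -⟩ := Function.ne_iff.mp hq0
  have : Nonempty (Fin m) := ⟨j₁⟩
  obtain ⟨j₀, hj₀⟩ := Finite.exists_max D
  have hcol : ∀ l, q (Pi.single l 1) j₀ = 0 := by
    intro l
    obtain ⟨j, hj⟩ := hle l
    have h1 := hhom l j₀
    have h2 := hj₀ j
    by_cases h : e l - D j₀ = 0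
    · rw [h] at h1
      rw [mem_polyPiece_zero h1, hmin, map_zero]
    · rwa [polyPiece_eq_bot (by omega), Submodule.mem_bot] at h1
  have hrow : LinearMap.proj j₀ ∘ₗ q = 0 := by
    ext1 l
    refine LinearMap.ext_ring ?_
    simpa using hcol l
  have hker := ker_eq_bot_of_row_eq_zero hr hθ hp (j₀ := j₀) (by
    intro w hw j
    obtain ⟨v, rfl⟩ : w ∈ LinearMap.range q := hq ▸ hw
    exact hmin v j) (by
    intro w hw
    obtain ⟨v, rfl⟩ : w ∈ LinearMap.range q := hq ▸ hw
    exact LinearMap.congr_fun hrow v)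
  rw [hker] at hq
  apply hq0
  have := LinearMap.mem_range_self q (Pi.single ⟨0, hn⟩ 1)
  rwa [hq, Submodule.mem_bot] at this

end Reflexive

/-! ### The Hilbert function of a quotient by an ideal of projective dimension at most two -/

section Hilbert

/-- A finite graded free resolution `0 → ⨁_l S(-e_l) → ⨁_j S(-D_j) → S(-a)^r → J → 0` of an ideal
`J` of `S = k[x, y, z]` generated by `r ≤ 3` forms of degree `a`. It has to be minimal at
`⨁_j S(-D_j)` only, so that the three partial derivatives of a form may be used as generators of its
Jacobian ideal even if they are linearly dependent. -/
structure IdealResolution {k : Type*} [Field k] (J : Ideal (MvPolynomial (Fin 3) k)) (a : ℤ) where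
  /-- the number of generators -/
  r : ℕ
  /-- the number of first syzygies -/
  m : ℕ
  /-- the number of second syzygies -/
  n : ℕ
  /-- the degrees of the first syzygies -/
  D : Fin m → ℤ
  /-- the degrees of the second syzygies -/
  e : Fin n → ℤ
  /-- the generators -/
  gen : (Fin r → MvPolynomial (Fin 3) k) →ₗ[MvPolynomial (Fin 3) k] MvPolynomial (Fin 3) k
  /-- the first syzygies -/
  syz : (Fin m → MvPolynomial (Fin 3) k) →ₗ[MvPolynomial (Fin 3) k] (Fin r → MvPolynomial (Fin 3) k)
  /-- the second syzygies -/
  rel : (Fin n → MvPolynomial (Fin 3) k) →ₗ[MvPolynomial (Fin 3) k] (Fin m → MvPolynomial (Fin 3) k)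
  r_le : r ≤ 3
  gen_homogeneous : ∀ l, gen (Pi.single l 1) ∈ polyPiece (Fin 3) k a
  syz_homogeneous : ∀ l j, syz (Pi.single l 1) j ∈ polyPiece (Fin 3) k (D l - a)
  rel_homogeneous : ∀ l j, rel (Pi.single l 1) j ∈ polyPiece (Fin 3) k (e l - D j)
  range_gen : LinearMap.range gen = J
  range_syz : LinearMap.range syz = LinearMap.ker gen
  range_rel : LinearMap.range rel = LinearMap.ker syz
  ker_rel : LinearMap.ker rel = ⊥
  rel_minimal : ∀ v j, constantCoeff (rel v j) = 0

/-- The image in `S / J` of the space of forms of degree `n`. -/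
def quotientPiece {σ k : Type*} [Field k] (J : Ideal (MvPolynomial σ k)) (n : ℤ) :
    Submodule k (MvPolynomial σ k ⧸ J) :=
  (polyPiece σ k n).map (Ideal.Quotient.mkₐ k J).toLinearMap

lemma finrank_map_add_finrank_inf_ker {k V W : Type*} [Field k] [AddCommGroup V] [Module k V]
    [AddCommGroup W] [Module k W] (φ : V →ₗ[k] W) (U : Submodule k V) [FiniteDimensional k U] :
    Module.finrank k (U.map φ) + Module.finrank k (U ⊓ LinearMap.ker φ : Submodule k V) =
      Module.finrank k U := by
  rw [← (φ.domRestrict U).finrank_range_add_finrank_ker, LinearMap.range_domRestrict,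
    LinearMap.ker_domRestrict]
  congr 1
  rw [← Submodule.finrank_map_subtype_eq U, Submodule.map_comap_subtype]

variable {k : Type*} [Field k] {J : Ideal (MvPolynomial (Fin 3) k)} {a : ℤ}

lemma IdealResolution.finrank_quotientPiece (F : IdealResolution J a) (i : ℤ) :
    (Module.finrank k (quotientPiece J i) : ℤ) = ternaryDim i - F.r * ternaryDim (i - a) +
      ∑ j, ternaryDim (i - F.D j) - ∑ l, ternaryDim (i - F.e l) := by
  have h0 := finrank_map_add_finrank_inf_ker (Ideal.Quotient.mkₐ k J).toLinearMap
    (polyPiece (Fin 3) k i)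
  have hker : LinearMap.ker (Ideal.Quotient.mkₐ k J).toLinearMap =
      (LinearMap.range F.gen).restrictScalars k := by
    ext p
    rw [F.range_gen]
    simp [Ideal.Quotient.eq_zero_iff_mem]
  have h1 := map_freePiece_functional (a := fun _ => a) (b := 0) (φ := F.gen)
    (by simpa using F.gen_homogeneous) i
  rw [sub_zero] at h1
  rw [hker, ← h1] at h0
  have h2 := finrank_map_add_finrank_inf_ker (F.gen.restrictScalars k)
    (freePiece (fun _ : Fin F.r => a) i)
  have h3 := map_freePiece F.syz_homogeneous i
  rw [F.range_syz] at h3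
  rw [LinearMap.ker_restrictScalars, ← h3] at h2
  have h4 := finrank_map_add_finrank_inf_ker (F.syz.restrictScalars k) (freePiece F.D i)
  have h5 := map_freePiece F.rel_homogeneous i
  rw [F.range_rel] at h5
  rw [LinearMap.ker_restrictScalars, ← h5] at h4
  have h6 := finrank_map_add_finrank_inf_ker (F.rel.restrictScalars k) (freePiece F.e i)
  rw [LinearMap.ker_restrictScalars, F.ker_rel, Submodule.restrictScalars_bot, inf_bot_eq,
    finrank_bot] at h6
  have d0 := finrank_polyPiece (k := k) i
  have d1 := finrank_freePiece (k := k) (fun _ : Fin F.r => a) i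
  have d2 := finrank_freePiece (k := k) F.D i
  have d3 := finrank_freePiece (k := k) F.e i
  rw [Finset.sum_const, Finset.card_univ, Fintype.card_fin, nsmul_eq_mul] at d1
  unfold quotientPiece
  zify at *
  linarith

end Hilbert

section Numerics

lemma quadratic_coeffs_of_eventually_eq {α β γ t K : ℤ}
    (h : ∀ i, K ≤ i → α * i ^ 2 + β * i + γ = t) : α = 0 ∧ β = 0 ∧ γ = t := by
  have h0 := h K le_rfl
  have h1 := h (K + 1) (by omega)
  have h2 := h (K + 2) (by omega)
  have hα : α = 0 := by linarith
  subst hα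
  have hβ : β = 0 := by linarith
  subst hβ
  exact ⟨rfl, rfl, by linarith⟩

lemma sum_quadratic {m : ℕ} (D : Fin m → ℤ) (i : ℤ) :
    ∑ j, (i - D j + 2) * (i - D j + 1) =
      m * i ^ 2 + (3 * m - 2 * ∑ j, D j) * i + ∑ j, (D j - 1) * (D j - 2) := by
  have h : ∀ j, (i - D j + 2) * (i - D j + 1) =
      i ^ 2 + 3 * i - 2 * i * D j + (D j - 1) * (D j - 2) := fun j => by ring
  simp only [h, Finset.sum_add_distrib, Finset.sum_sub_distrib, Finset.sum_const,
    Finset.card_univ, Fintype.card_fin, nsmul_eq_mul, ← Finset.mul_sum]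
  ring

/-- If the alternating sum of the functions `ternaryDim (i - s)` is eventually constant, then so is, for
all `i`, the polynomial that agrees with it for large `i`; the ranks and the degrees satisfy two
linear relations. -/
lemma relations_of_eventually_eq {r m n : ℕ} {D : Fin m → ℤ} {e : Fin n → ℤ} {a t K : ℤ}
    (h : ∀ i, K ≤ i → ternaryDim i - r * ternaryDim (i - a) +
      ∑ j, ternaryDim (i - D j) - ∑ l, ternaryDim (i - e l) = t) :
    (1 - r + m - n : ℤ) = 0 ∧ r * a = ∑ j, D j - ∑ l, e l ∧
    ∀ i, (i + 2) * (i + 1) - r * ((i - a + 2) * (i - a + 1)) +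
      ∑ j, (i - D j + 2) * (i - D j + 1) - ∑ l, (i - e l + 2) * (i - e l + 1) = 2 * t := by
  obtain ⟨B, hB⟩ : ∃ B : ℤ, (∀ j, D j ≤ B) ∧ ∀ l, e l ≤ B := by
    obtain ⟨B₁, h₁⟩ := (Set.finite_range D).bddAbove
    obtain ⟨B₂, h₂⟩ := (Set.finite_range e).bddAbove
    exact ⟨max B₁ B₂, fun j => (h₁ ⟨j, rfl⟩).trans (le_max_left _ _),
      fun l => (h₂ ⟨l, rfl⟩).trans (le_max_right _ _)⟩
  have hP : ∀ i, max (max K B) (max 0 a) ≤ i →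
      (i + 2) * (i + 1) - r * ((i - a + 2) * (i - a + 1)) +
      ∑ j, (i - D j + 2) * (i - D j + 1) - ∑ l, (i - e l + 2) * (i - e l + 1) = 2 * t := by
    intro i hi
    simp only [max_le_iff] at hi
    have h1 : ∑ j, (i - D j + 2) * (i - D j + 1) = 2 * ∑ j, ternaryDim (i - D j) := by
      rw [Finset.mul_sum]
      refine Finset.sum_congr rfl fun j _ => (two_mul_ternaryDim ?_).symm
      have := hB.1 j
      omega
    have h2 : ∑ j, (i - e j + 2) * (i - e j + 1) = 2 * ∑ j, ternaryDim (i - e j) := by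
      rw [Finset.mul_sum]
      refine Finset.sum_congr rfl fun j _ => (two_mul_ternaryDim ?_).symm
      have := hB.2 j
      omega
    rw [h1, h2, ← two_mul_ternaryDim (n := i) (by omega),
      ← two_mul_ternaryDim (n := i - a) (by omega), ← h i hi.1.1]
    ring
  have hQ : ∀ i, (i + 2) * (i + 1) - r * ((i - a + 2) * (i - a + 1)) +
      ∑ j, (i - D j + 2) * (i - D j + 1) - ∑ l, (i - e l + 2) * (i - e l + 1) =
      (1 - r + m - n) * i ^ 2 +
      (3 - r * (3 - 2 * a) + (3 * m - 2 * ∑ j, D j) - (3 * n - 2 * ∑ l, e l)) * i +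
      (2 - r * ((a - 1) * (a - 2)) + ∑ j, (D j - 1) * (D j - 2) - ∑ l, (e l - 1) * (e l - 2)) := by
    intro i
    rw [sum_quadratic, sum_quadratic]
    ring
  obtain ⟨h1, h2, h3⟩ := quadratic_coeffs_of_eventually_eq fun i hi => (hQ i).symm.trans (hP i hi)
  refine ⟨h1, by linarith, fun i => ?_⟩
  rw [hQ, h1, h2, h3]
  ring

lemma two_mul_sum_ternaryDim {m : ℕ} {D : Fin m → ℤ} {A : ℤ} (hD : ∀ j, D j ≤ A) {i : ℤ}
    (hi : A - 2 ≤ i) : 2 * ∑ j, ternaryDim (i - D j) = ∑ j, (i - D j + 2) * (i - D j + 1) := by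
  rw [Finset.mul_sum]
  refine Finset.sum_congr rfl fun j _ => two_mul_ternaryDim ?_
  have := hD j
  omega

/-- In degree `A - 3` the polynomial `(i + 2)(i + 1) / 2` at `i = -3` is too large by `1` for each shift
that is equal to the maximal value `A`. -/
lemma two_mul_sum_ternaryDim_sub_three {m : ℕ} {D : Fin m → ℤ} {A : ℤ} (hD : ∀ j, D j ≤ A) :
    2 * ∑ j, ternaryDim (A - 3 - D j) = ∑ j, (A - 3 - D j + 2) * (A - 3 - D j + 1) -
      2 * (Finset.univ.filter fun j => D j = A).card := by
  have : ∀ j, 2 * ternaryDim (A - 3 - D j) =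
      (A - 3 - D j + 2) * (A - 3 - D j + 1) - 2 * if D j = A then 1 else 0 := by
    intro j
    have := hD j
    split_ifs with h
    · rw [h, ternaryDim_of_neg (by omega)]
      ring
    · rw [two_mul_ternaryDim (by omega)]
      ring
  rw [Finset.mul_sum, Finset.sum_congr rfl fun j _ => this j, Finset.sum_sub_distrib,
    ← Finset.mul_sum, Finset.sum_boole]

variable {k : Type*} [Field k] {J : Ideal (MvPolynomial (Fin 3) k)} {a : ℤ}

/-- If the Hilbert function of `S / J` is eventually equal to `τ`, then it becomes so in degree `A - 2`,
where `A` is the largest degree of a syzygy. In degree `A - 3` it is below `τ` if there are no second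
syzygies and above `τ` if there are some, because `A` is the degree of first syzygies only in the
first case and of second syzygies only in the second case. -/
theorem IdealResolution.exists_stabilization (F : IdealResolution J a) (ha : 1 ≤ a) (hJ : J ≠ ⊥)
    {τ : ℕ} {K : ℤ} (hK : ∀ i, K ≤ i → Module.finrank k (quotientPiece J i) = τ) :
    ∃ A : ℤ, a < A ∧ (∀ j, F.D j ≤ A) ∧ (∀ l, F.e l ≤ A) ∧
      (∀ i, A - 2 ≤ i → Module.finrank k (quotientPiece J i) = τ) ∧
      ((F.n = 0 ∧ F.r = F.m + 1 ∧ (∃ j, F.D j = A) ∧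
          Module.finrank k (quotientPiece J (A - 3)) < τ) ∨
        (0 < F.n ∧ 0 < F.m ∧ (∀ j, F.D j < A) ∧ (∃ l, F.e l = A) ∧
          τ < Module.finrank k (quotientPiece J (A - 3)))) := by
  obtain ⟨hrank, hdeg, hpoly⟩ := relations_of_eventually_eq (t := τ) (K := K)
    (fun i hi => by rw [← F.finrank_quotientPiece, hK i hi])
  have stable : ∀ A, a < A → (∀ j, F.D j ≤ A) → (∀ l, F.e l ≤ A) → ∀ i, A - 2 ≤ i →
      Module.finrank k (quotientPiece J i) = τ := by
    intro A haA hD he i hi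
    have h1 := F.finrank_quotientPiece i
    have h2 := two_mul_sum_ternaryDim hD hi
    have h3 := two_mul_sum_ternaryDim he hi
    have h4 := two_mul_ternaryDim (n := i) (by omega)
    have h5 := two_mul_ternaryDim (n := i - a) (by omega)
    have h6 := hpoly i
    rw [← h2, ← h3, ← h4, ← h5] at h6
    zify
    rw [h1]
    linarith
  have before : ∀ A, a < A → (∀ j, F.D j ≤ A) → (∀ l, F.e l ≤ A) →
      (Module.finrank k (quotientPiece J (A - 3)) : ℤ) = τ -
        (Finset.univ.filter fun j => F.D j = A).card +
        (Finset.univ.filter fun l => F.e l = A).card := by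
    intro A haA hD he
    have h1 := F.finrank_quotientPiece (A - 3)
    have h2 := two_mul_sum_ternaryDim_sub_three hD
    have h3 := two_mul_sum_ternaryDim_sub_three he
    have h4 := two_mul_ternaryDim (n := A - 3) (by omega)
    have h5 := two_mul_ternaryDim (n := A - 3 - a) (by omega)
    have h6 := hpoly (A - 3)
    rw [← h4, ← h5] at h6
    linarith
  rcases Nat.eq_zero_or_pos F.n with hn | hn
  · have hno : ∀ l : Fin F.n, False := fun l => by
      have := l.2
      omega
    have he0 : ∑ l, F.e l = 0 := Finset.sum_eq_zero fun l _ => (hno l).elim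
    rw [he0, sub_zero] at hdeg
    have hrm : F.r = F.m + 1 := by omega
    have hlt : ∑ _j : Fin F.m, a < ∑ j, F.D j := by
      rw [← hdeg, Finset.sum_const, Finset.card_univ, Fintype.card_fin, nsmul_eq_mul, hrm]
      push_cast
      linarith
    obtain ⟨j₁, -, hj₁⟩ := Finset.exists_lt_of_sum_lt hlt
    have : Nonempty (Fin F.m) := ⟨j₁⟩
    obtain ⟨j₀, hj₀⟩ := Finite.exists_max F.D
    have haA : a < F.D j₀ := hj₁.trans_le (hj₀ j₁)
    have heA : ∀ l, F.e l ≤ F.D j₀ := fun l => (hno l).elim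
    refine ⟨F.D j₀, haA, hj₀, heA, stable _ haA hj₀ heA, Or.inl ⟨hn, hrm, ⟨j₀, rfl⟩, ?_⟩⟩
    have h := before _ haA hj₀ heA
    have h1 : (Finset.univ.filter fun l => F.e l = F.D j₀).card = 0 :=
      Finset.card_eq_zero.mpr (Finset.eq_empty_of_forall_notMem fun l _ => hno l)
    have h2 : 0 < (Finset.univ.filter fun j => F.D j = F.D j₀).card :=
      Finset.card_pos.mpr ⟨j₀, by simp⟩
    omega
  · have hgen : F.gen ≠ 0 := by
      intro h
      apply hJ
      rw [← F.range_gen, h, LinearMap.range_zero]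
    obtain ⟨l₁, hl₁⟩ := exists_shift_gt F.r_le hgen F.range_syz F.range_rel F.rel_minimal
      F.rel_homogeneous F.ker_rel hn
    have : Nonempty (Fin F.n) := ⟨l₁⟩
    obtain ⟨l₀, hl₀⟩ := Finite.exists_max F.e
    have hD : ∀ j, F.D j < F.e l₀ := fun j => (hl₁ j).trans_le (hl₀ l₁)
    have haD : ∀ j, a ≤ F.D j := by
      intro j
      by_contra! hj
      have h0 : F.syz (Pi.single j 1) = 0 := by
        funext i
        have := F.syz_homogeneous j i
        rwa [polyPiece_eq_bot (by omega), Submodule.mem_bot] at this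
      obtain ⟨v, hv⟩ : Pi.single j 1 ∈ LinearMap.range F.rel := F.range_rel ▸ h0
      have := F.rel_minimal v j
      rw [hv] at this
      simp at this
    have hm : Nonempty (Fin F.m) := by
      have hne : F.rel (Pi.single l₀ 1) ≠ 0 := by
        intro h
        have h1 : (Pi.single l₀ 1 : Fin F.n → MvPolynomial (Fin 3) k) = 0 := by
          rw [← Submodule.mem_bot (R := MvPolynomial (Fin 3) k), ← F.ker_rel]
          exact h
        simpa using congrFun h1 l₀
      obtain ⟨j, -⟩ := Function.ne_iff.mp hne
      exact ⟨j⟩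
    obtain ⟨j₁⟩ := hm
    have haA : a < F.e l₀ := (haD j₁).trans_lt (hD j₁)
    have hDA : ∀ j, F.D j ≤ F.e l₀ := fun j => (hD j).le
    refine ⟨F.e l₀, haA, hDA, hl₀, stable _ haA hDA hl₀, Or.inr ⟨hn, j₁.pos, hD, ⟨l₀, rfl⟩, ?_⟩⟩
    have h := before _ haA hDA hl₀
    have h1 : (Finset.univ.filter fun j => F.D j = F.e l₀).card = 0 :=
      Finset.card_eq_zero.mpr (Finset.filter_eq_empty_iff.mpr fun j _ => (hD j).ne)
    have h2 : 0 < (Finset.univ.filter fun l => F.e l = F.e l₀).card :=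
      Finset.card_pos.mpr ⟨l₀, by simp⟩
    omega

end Numerics

/-! ### Minimal generators and minimal resolutions -/

section Existence

variable {σ k : Type*} [Field k]

/-- A submodule of a graded free module is homogeneous if it contains the components of its elements. -/
def IsGradedSubmodule {ι : Type*} (a : ι → ℤ)
    (N : Submodule (MvPolynomial σ k) (ι → MvPolynomial σ k)) : Prop :=
  ∀ v ∈ N, ∀ n, freeComp a n v ∈ N

lemma isGradedSubmodule_ker {ι κ : Type*} [Finite ι] [DecidableEq ι] {a : ι → ℤ} {b : κ → ℤ}
    {φ : (ι → MvPolynomial σ k) →ₗ[MvPolynomial σ k] (κ → MvPolynomial σ k)}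
    (hφ : ∀ l j, φ (Pi.single l 1) j ∈ polyPiece σ k (a l - b j)) :
    IsGradedSubmodule a (LinearMap.ker φ) := by
  intro v hv n
  rw [LinearMap.mem_ker, ← freeComp_apply_of_homogeneous hφ, LinearMap.mem_ker.mp hv, map_zero]

lemma isGradedSubmodule_ker_functional {ι : Type*} [Finite ι] [DecidableEq ι] {a : ι → ℤ} {b : ℤ}
    {φ : (ι → MvPolynomial σ k) →ₗ[MvPolynomial σ k] MvPolynomial σ k}
    (hφ : ∀ l, φ (Pi.single l 1) ∈ polyPiece σ k (a l - b)) :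
    IsGradedSubmodule a (LinearMap.ker φ) := by
  intro v hv n
  rw [LinearMap.mem_ker, ← polyComp_apply_of_homogeneous hφ, LinearMap.mem_ker.mp hv, map_zero]

lemma linearCombination_homogeneous {ι : Type*} {m : ℕ} {a : ι → ℤ}
    {v : Fin m → ι → MvPolynomial σ k} {D : Fin m → ℤ} (hv : ∀ l, v l ∈ freePiece a (D l))
    (l : Fin m) (j : ι) : Fintype.linearCombination (MvPolynomial σ k) v (Pi.single l 1) j ∈
      polyPiece σ k (D l - a j) := by
  rw [Fintype.linearCombination_apply_single, one_smul]
  exact mem_freePiece.mp (hv l) j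

lemma exists_homogeneous_generators [Finite σ] {ι : Type*} [Finite ι] {a : ι → ℤ}
    {N : Submodule (MvPolynomial σ k) (ι → MvPolynomial σ k)} (hN : IsGradedSubmodule a N) :
    ∃ (m : ℕ) (D : Fin m → ℤ) (v : Fin m → ι → MvPolynomial σ k), (∀ l, v l ∈ freePiece a (D l)) ∧
      Submodule.span (MvPolynomial σ k) (Set.range v) = N := by
  obtain ⟨s, hs⟩ := IsNoetherian.noetherian N
  choose T hT using fun v : ι → MvPolynomial σ k => exists_sum_freeComp a v
  let G : Set (ι → MvPolynomial σ k) := ⋃ v ∈ s, (fun n => freeComp a n v) '' (T v : Set ℤ)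
  have hG : G.Finite := s.finite_toSet.biUnion fun v _ => (T v).finite_toSet.image _
  have : Finite G := hG
  obtain ⟨m, ⟨E⟩⟩ := Finite.exists_equiv_fin G
  have hhom : ∀ g : G, ∃ n, (g : ι → MvPolynomial σ k) ∈ freePiece a n := by
    rintro ⟨g, hg⟩
    simp only [G, Set.mem_iUnion] at hg
    obtain ⟨v, -, n, -, rfl⟩ := hg
    exact ⟨n, freeComp_mem _ _ _⟩
  choose D hD using hhom
  refine ⟨m, fun l => D (E.symm l), fun l => E.symm l, fun l => hD _, ?_⟩
  have hrange : Set.range (fun l => (E.symm l : ι → MvPolynomial σ k)) = G := by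
    rw [show (fun l => (E.symm l : ι → MvPolynomial σ k)) = Subtype.val ∘ E.symm from rfl,
      Set.range_comp, E.symm.range_eq_univ, Set.image_univ, Subtype.range_coe]
  rw [hrange]
  apply le_antisymm
  · rw [Submodule.span_le]
    intro g hg
    simp only [G, Set.mem_iUnion] at hg
    obtain ⟨v, hv, n, -, rfl⟩ := hg
    exact hN v (hs ▸ Submodule.subset_span hv) n
  · rw [← hs, Submodule.span_le]
    intro v hv
    rw [SetLike.mem_coe, hT v]
    refine Submodule.sum_mem _ fun n hn => Submodule.subset_span ?_
    simp only [G, Set.mem_iUnion]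
    exact ⟨v, hv, n, hn, rfl⟩

/-- A homogeneous submodule of a graded free module has a minimal system of homogeneous generators: a
relation with a nonzero constant coefficient would make one generator of a system of least cardinality
superfluous. -/
lemma exists_minimal_generators [Finite σ] {ι : Type*} [Finite ι] {a : ι → ℤ}
    {N : Submodule (MvPolynomial σ k) (ι → MvPolynomial σ k)} (hN : IsGradedSubmodule a N) :
    ∃ (m : ℕ) (D : Fin m → ℤ)
      (p : (Fin m → MvPolynomial σ k) →ₗ[MvPolynomial σ k] (ι → MvPolynomial σ k)),
      (∀ l j, p (Pi.single l 1) j ∈ polyPiece σ k (D l - a j)) ∧ LinearMap.range p = N ∧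
      ∀ w, p w = 0 → ∀ j, constantCoeff (w j) = 0 := by
  classical
  have hex := exists_homogeneous_generators hN
  obtain ⟨D, v, hv, hspan⟩ := Nat.find_spec hex
  have hmin := fun {t : ℕ} => Nat.find_min hex (m := t)
  generalize Nat.find hex = m at D v hmin
  refine ⟨m, D, Fintype.linearCombination _ v, linearCombination_homogeneous hv, ?_, ?_⟩
  · rw [Fintype.range_linearCombination, hspan]
  · intro w hw j₀
    by_contra hne
    obtain ⟨t, rfl⟩ : ∃ t, m = t + 1 := ⟨m - 1, by have := j₀.2; omega⟩
    refine hmin t.lt_succ_self ⟨fun l => D (j₀.succAbove l), fun l => v (j₀.succAbove l),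
      fun l => hv _, ?_⟩
    rw [← hspan]
    apply le_antisymm
    · refine Submodule.span_mono ?_
      rintro _ ⟨l, rfl⟩
      exact ⟨_, rfl⟩
    · rw [Submodule.span_le]
      rintro _ ⟨l, rfl⟩
      rcases Fin.eq_self_or_eq_succAbove j₀ l with rfl | ⟨i, rfl⟩
      · have h1 := congrArg (freeComp a (D l)) hw
        rw [Fintype.linearCombination_apply, map_sum, map_zero, Fin.sum_univ_succAbove _ l] at h1
        simp only [freeComp_smul (hv _)] at h1
        have h2 : polyComp (D l - D l) (w l) = C (constantCoeff (w l)) := by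
          rw [sub_self, mem_polyPiece_zero (polyComp_mem 0 (w l)), constantCoeff_eq,
            coeff_polyComp]
          simp
        rw [h2] at h1
        have h3 : v l = C (σ := σ) (constantCoeff (w l))⁻¹ • C (σ := σ) (constantCoeff (w l)) • v l := by
          rw [smul_smul, ← C_mul, inv_mul_cancel₀ hne, C_1, one_smul]
        rw [SetLike.mem_coe, h3]
        refine Submodule.smul_mem _ _ ?_
        rw [eq_neg_of_add_eq_zero_left h1]
        refine Submodule.neg_mem _ (Submodule.sum_mem _ fun i _ => Submodule.smul_mem _ _ ?_)
        exact Submodule.subset_span ⟨i, rfl⟩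
      · exact Submodule.subset_span ⟨i, rfl⟩

/-- A homogeneous submodule of a graded free module of finite rank which is contained in `𝔪` times that
module: the module of syzygies at one stage of a minimal resolution. -/
structure SyzygyModule (σ k : Type*) [Field k] where
  /-- the rank of the free module -/
  rank : ℕ
  /-- the degrees of the basis of the free module -/
  shift : Fin rank → ℤ
  /-- the submodule -/
  carrier : Submodule (MvPolynomial σ k) (Fin rank → MvPolynomial σ k)
  graded : IsGradedSubmodule shift carrier
  minimal : ∀ w ∈ carrier, ∀ j, constantCoeff (w j) = 0

/-- The number of minimal generators of a module of syzygies. -/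
def SyzygyModule.nextRank [Finite σ] (N : SyzygyModule σ k) : ℕ :=
  (exists_minimal_generators N.graded).choose

/-- The degrees of the minimal generators of a module of syzygies. -/
def SyzygyModule.nextShift [Finite σ] (N : SyzygyModule σ k) : Fin N.nextRank → ℤ :=
  (exists_minimal_generators N.graded).choose_spec.choose

/-- The map given by minimal generators of a module of syzygies. -/
def SyzygyModule.map [Finite σ] (N : SyzygyModule σ k) :
    (Fin N.nextRank → MvPolynomial σ k) →ₗ[MvPolynomial σ k] (Fin N.rank → MvPolynomial σ k) :=
  (exists_minimal_generators N.graded).choose_spec.choose_spec.choose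

lemma SyzygyModule.map_spec [Finite σ] (N : SyzygyModule σ k) :
    (∀ l j, N.map (Pi.single l 1) j ∈ polyPiece σ k (N.nextShift l - N.shift j)) ∧
      LinearMap.range N.map = N.carrier ∧ ∀ w, N.map w = 0 → ∀ j, constantCoeff (w j) = 0 :=
  (exists_minimal_generators N.graded).choose_spec.choose_spec.choose_spec

/-- The relations between the minimal generators of a module of syzygies. -/
def SyzygyModule.next [Finite σ] (N : SyzygyModule σ k) : SyzygyModule σ k where
  rank := N.nextRank
  shift := N.nextShift
  carrier := LinearMap.ker N.map
  graded := isGradedSubmodule_ker N.map_spec.1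
  minimal := fun w hw => N.map_spec.2.2 w hw

/-- The successive modules of syzygies. -/
def SyzygyModule.iterate [Finite σ] (N : SyzygyModule σ k) : ℕ → SyzygyModule σ k
  | 0 => N
  | i + 1 => (N.iterate i).next

/-- The minimal graded free resolution of a graded module `M` given by a surjection `F₀ → M` from a
graded free module whose kernel is contained in `𝔪 F₀`. -/
def SyzygyModule.resolution [Finite σ] (N : SyzygyModule σ k) {M : Type*} [AddCommGroup M]
    [Module (MvPolynomial σ k) M] [Module k M] (ℳ : ℤ → Submodule k M)
    (aug : (Fin N.rank → MvPolynomial σ k) →ₗ[MvPolynomial σ k] M)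
    (haug : ∀ j, aug (Pi.single j 1) ∈ ℳ (N.shift j)) (hsurj : Function.Surjective aug)
    (hker : LinearMap.ker aug = N.carrier) : MinimalGradedFreeResolution σ ℳ where
  rank i := (N.iterate i).rank
  shift i := (N.iterate i).shift
  diff i := (N.iterate i).map
  aug := aug
  diff_homogeneous i := (N.iterate i).map_spec.1
  aug_homogeneous := haug
  aug_surjective := hsurj
  exact_zero := show Function.Exact N.map aug from
    LinearMap.exact_iff.mpr (hker.trans N.map_spec.2.1.symm)
  exact_succ i := show Function.Exact (N.iterate i).next.map (N.iterate i).map from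
    LinearMap.exact_iff.mpr (N.iterate i).next.map_spec.2.1.symm
  minimal i v j := (N.iterate i).minimal _
    ((N.iterate i).map_spec.2.1 ▸ LinearMap.mem_range_self _ v) j

/-- A proper homogeneous ideal `J` has a minimal resolution of `S / J`. -/
lemma nonempty_minimalGradedFreeResolution [Finite σ] (J : Ideal (MvPolynomial σ k))
    (hJ : ∀ p ∈ J, ∀ n, polyComp n p ∈ J) (hm : ∀ p ∈ J, constantCoeff p = 0) :
    Nonempty (MinimalGradedFreeResolution σ (quotientPiece J)) := by
  let aug : (Fin 1 → MvPolynomial σ k) →ₗ[MvPolynomial σ k] (MvPolynomial σ k ⧸ J) :=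
    Submodule.mkQ J ∘ₗ LinearMap.proj 0
  have hmem : ∀ v, v ∈ LinearMap.ker aug ↔ v 0 ∈ J := fun v => by
    simp only [aug, LinearMap.mem_ker, LinearMap.comp_apply, LinearMap.proj_apply]
    exact Submodule.Quotient.mk_eq_zero J
  let N : SyzygyModule σ k :=
    { rank := 1
      shift := fun _ => 0
      carrier := LinearMap.ker aug
      graded := fun v hv n => (hmem _).mpr (hJ _ ((hmem v).mp hv) _)
      minimal := fun w hw j => by
        rw [Subsingleton.elim j 0]
        exact hm _ ((hmem w).mp hw) }
  refine ⟨N.resolution (quotientPiece J) aug ?_ ?_ rfl⟩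
  · intro j
    refine ⟨1, ?_, ?_⟩
    · change (1 : MvPolynomial σ k) ∈ polyPiece σ k ((0 : ℕ) : ℤ)
      rw [polyPiece_natCast]
      exact isHomogeneous_one σ k
    · rw [Subsingleton.elim j 0]
      simp only [aug, LinearMap.comp_apply, LinearMap.proj_apply]
      erw [Pi.single_eq_same]
      rfl
  · intro q
    obtain ⟨p, rfl⟩ := Submodule.mkQ_surjective J q
    exact ⟨fun _ => p, rfl⟩

/-- The resolution of an ideal generated by ternary forms of the same degree that arises
from minimal generators of the syzygies of these forms. -/
lemma exists_idealResolution {r : ℕ} {a : ℤ}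
    (gen : (Fin r → MvPolynomial (Fin 3) k) →ₗ[MvPolynomial (Fin 3) k] MvPolynomial (Fin 3) k)
    (hgen : ∀ l, gen (Pi.single l 1) ∈ polyPiece (Fin 3) k a) :
    ∃ (m n : ℕ) (D : Fin m → ℤ) (e : Fin n → ℤ)
      (syz : (Fin m → MvPolynomial (Fin 3) k) →ₗ[MvPolynomial (Fin 3) k]
        (Fin r → MvPolynomial (Fin 3) k))
      (rel : (Fin n → MvPolynomial (Fin 3) k) →ₗ[MvPolynomial (Fin 3) k]
        (Fin m → MvPolynomial (Fin 3) k)),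
      (∀ l j, syz (Pi.single l 1) j ∈ polyPiece (Fin 3) k (D l - a)) ∧
      (∀ l j, rel (Pi.single l 1) j ∈ polyPiece (Fin 3) k (e l - D j)) ∧
      LinearMap.range syz = LinearMap.ker gen ∧ LinearMap.range rel = LinearMap.ker syz ∧
      LinearMap.ker rel = ⊥ ∧ ∀ v j, constantCoeff (rel v j) = 0 := by
  obtain ⟨m, D, syz, hsyz, hrange, hmin⟩ := exists_minimal_generators
    (isGradedSubmodule_ker_functional (a := fun _ => a) (b := 0) (φ := gen) (by simpa using hgen))
  obtain ⟨n, e, rel, hrel, hrange', hmin'⟩ := exists_minimal_generators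
    (isGradedSubmodule_ker (b := fun _ => a) hsyz)
  refine ⟨m, n, D, e, syz, rel, hsyz, hrel, hrange, hrange', ?_, fun v j => ?_⟩
  · refine ker_eq_bot_of_third_syzygy (θ := LinearMap.pi fun _ : Fin 1 => gen) ?_ hrange' hmin'
    rw [hrange, LinearMap.ker_pi]
    simp
  · exact hmin _ (by rw [← LinearMap.mem_ker, ← hrange']; exact LinearMap.mem_range_self _ v) j

end Existence

/-! ### The regularity of a quotient by an ideal generated by ternary forms of one degree -/

section MinimalGenerators

variable {σ k : Type*} [Field k] {M : Type*} [AddCommGroup M] [Module (MvPolynomial σ k) M]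

/-- If a graded module is generated by `t` elements of degree `b`, then a minimal system of homogeneous
generators consists of at most `t` elements, all of degree `b`. -/
lemma minimal_generators_of_equigenerated {r t : ℕ} {b : ℤ} {s : Fin r → ℤ}
    {φ : (Fin r → MvPolynomial σ k) →ₗ[MvPolynomial σ k] M} {g : Fin t → M}
    (hg : ∀ i, g i ∈ LinearMap.range φ)
    (hφ : ∀ j, ∃ c : Fin t → MvPolynomial σ k, (∀ i, c i ∈ polyPiece σ k (s j - b)) ∧
      φ (Pi.single j 1) = ∑ i, c i • g i)
    (hmin : ∀ w, φ w = 0 → ∀ j, constantCoeff (w j) = 0) : (∀ j, s j = b) ∧ r ≤ t := by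
  choose c hc hφc using hφ
  choose w hw using hg
  have hs : ∀ j, s j = b := by
    intro j
    by_contra hne
    have h0 : φ (Pi.single j 1 - ∑ i, c j i • w i) = 0 := by
      rw [map_sub, map_sum, hφc]
      simp [hw]
    have h1 := hmin _ h0 j
    have h2 : ∀ i, constantCoeff (c j i) = 0 := fun i =>
      constantCoeff_of_mem_polyPiece (sub_ne_zero.mpr hne) (hc j i)
    simp [h2] at h1
  refine ⟨hs, ?_⟩
  let L : (Fin r → k) →ₗ[k] (Fin t → k) :=
    Fintype.linearCombination k fun j i => constantCoeff (c j i)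
  have hL : Function.Injective L := by
    rw [← LinearMap.ker_eq_bot, eq_bot_iff]
    intro l hl
    have h0 : φ (∑ j, C (σ := σ) (l j) • (Pi.single j 1 : Fin r → MvPolynomial σ k)) = 0 := by
      have h1 : ∀ i, ∑ j, C (l j) * c j i = 0 := by
        intro i
        have h2 : ∀ j, c j i = C (constantCoeff (c j i)) := fun j =>
          mem_polyPiece_zero (by simpa [hs j] using hc j i)
        have h3 := congrFun (LinearMap.mem_ker.mp hl) i
        rw [Fintype.linearCombination_apply, Finset.sum_apply] at h3
        calc ∑ j, C (l j) * c j i = ∑ j, C (l j * constantCoeff (c j i)) :=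
              Finset.sum_congr rfl fun j _ => by rw [C_mul, ← h2]
          _ = C (∑ j, l j * constantCoeff (c j i)) := (map_sum C _ _).symm
          _ = 0 := by
            rw [show ∑ j, l j * constantCoeff (c j i) = 0 from h3, C_0]
      simp only [map_sum, map_smul, hφc, Finset.smul_sum, smul_smul]
      rw [Finset.sum_comm]
      simp [← Finset.sum_smul, h1]
    rw [Submodule.mem_bot]
    funext j
    have := hmin _ h0 j
    simpa [Finset.sum_apply, Pi.single_apply] using this
  simpa using LinearMap.finrank_le_finrank_of_injective hL

end MinimalGenerators

section Regularity

lemma MinimalGradedFreeResolution.constantCoeff_of_diff_eq_zero {σ k M : Type*} [Field k]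
    [AddCommGroup M] [Module (MvPolynomial σ k) M] [Module k M] {ℳ : ℤ → Submodule k M}
    (F : MinimalGradedFreeResolution σ ℳ) {i : ℕ} {w : Fin (F.rank (i + 1)) → MvPolynomial σ k}
    (hw : F.diff i w = 0) (j : Fin (F.rank (i + 1))) : constantCoeff (w j) = 0 := by
  obtain ⟨v, rfl⟩ := (F.exact_succ i w).mp hw
  exact F.minimal _ _ _

lemma MinimalGradedFreeResolution.constantCoeff_of_aug_eq_zero {σ k M : Type*} [Field k]
    [AddCommGroup M] [Module (MvPolynomial σ k) M] [Module k M] {ℳ : ℤ → Submodule k M}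
    (F : MinimalGradedFreeResolution σ ℳ) {w : Fin (F.rank 0) → MvPolynomial σ k}
    (hw : F.aug w = 0) (j : Fin (F.rank 0)) : constantCoeff (w j) = 0 := by
  obtain ⟨v, rfl⟩ := (F.exact_zero w).mp hw
  exact F.minimal _ _ _

variable {k : Type*} [Field k]

/-- Hilbert's syzygy theorem in three variables: the third differential of a minimal resolution is
injective. -/
lemma MinimalGradedFreeResolution.ker_diff_two {M : Type*}
    [AddCommGroup M] [Module (MvPolynomial (Fin 3) k) M] [Module k M] {ℳ : ℤ → Submodule k M}
    (F : MinimalGradedFreeResolution (Fin 3) ℳ) : LinearMap.ker (F.diff 2) = ⊥ :=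
  ker_eq_bot_of_third_syzygy (LinearMap.exact_iff.mp (F.exact_succ 0)).symm
    (LinearMap.exact_iff.mp (F.exact_succ 1)).symm
    fun _ hv => F.constantCoeff_of_diff_eq_zero hv

lemma MinimalGradedFreeResolution.rank_add_four {M : Type*}
    [AddCommGroup M] [Module (MvPolynomial (Fin 3) k) M] [Module k M] {ℳ : ℤ → Submodule k M}
    (F : MinimalGradedFreeResolution (Fin 3) ℳ) (i : ℕ) : F.rank (i + 4) = 0 := by
  have key : ∀ i, F.diff (i + 3) = 0 → F.rank (i + 4) = 0 := by
    intro i h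
    by_contra hne
    have := F.constantCoeff_of_diff_eq_zero (i := i + 3) (w := fun _ => 1) (by rw [h]; rfl)
      ⟨0, Nat.pos_of_ne_zero hne⟩
    simp at this
  induction i with
  | zero =>
    apply key
    refine LinearMap.ext fun v => ?_
    have h : F.diff 3 v ∈ LinearMap.ker (F.diff 2) := (F.exact_succ 2 _).mpr ⟨v, rfl⟩
    rwa [F.ker_diff_two, Submodule.mem_bot] at h
  | succ i ih =>
    apply key
    refine LinearMap.ext fun v => ?_
    funext j
    exact (Fin.cast ih j).elim0

variable {J : Ideal (MvPolynomial (Fin 3) k)} {a : ℤ} {t : ℕ} {g : Fin t → MvPolynomial (Fin 3) k}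

/-- The part of a minimal resolution of `S / J` that resolves `J`, for an ideal `J` generated by at most
three forms of the same positive degree `a`: the free module covering `S / J` is `S`, and the next one is
`S(-a)^r` with `r ≤ 3`. -/
lemma MinimalGradedFreeResolution.exists_idealResolution
    (F : MinimalGradedFreeResolution (Fin 3) (quotientPiece J)) (ha : 1 ≤ a) (ht : t ≤ 3)
    (hg : ∀ i, g i ∈ polyPiece (Fin 3) k a) (hJ : Ideal.span (Set.range g) = J) :
    ∃ G : IdealResolution J a, (∀ j, F.shift 0 j = 0) ∧ (∀ j, F.shift 1 j = a) ∧
      G.m = F.rank 2 ∧ G.n = F.rank 3 ∧ (∀ c, (∃ j, G.D j = c) ↔ ∃ j, F.shift 2 j = c) ∧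
      (∀ c, (∃ j, G.e j = c) ↔ ∃ j, F.shift 3 j = c) ∧ ∀ j, a < G.D j := by
  have hJm : ∀ p ∈ J, constantCoeff p = 0 := by
    intro p hp
    rw [← hJ] at hp
    have : Ideal.span (Set.range g) ≤ RingHom.ker (constantCoeff (σ := Fin 3) (R := k)) := by
      rw [Ideal.span_le]
      rintro _ ⟨i, rfl⟩
      exact constantCoeff_of_mem_polyPiece (by omega) (hg i)
    exact this hp
  obtain ⟨hs0, hr0⟩ := minimal_generators_of_equigenerated (t := 1) (b := 0)
    (φ := F.aug) (s := F.shift 0) (g := fun _ => Submodule.Quotient.mk 1)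
    (fun i => F.aug_surjective _) (fun j => by
      obtain ⟨p, hp, hpj⟩ := F.aug_homogeneous j
      refine ⟨fun _ => p, fun _ => by simpa using hp, ?_⟩
      rw [Finset.univ_unique, Finset.sum_singleton, ← Submodule.Quotient.mk_smul, smul_eq_mul,
        mul_one, ← hpj]
      rfl) (fun w hw => F.constantCoeff_of_aug_eq_zero hw)
  have hr0' : F.rank 0 ≠ 0 := by
    intro h
    obtain ⟨w, hw⟩ := F.aug_surjective (Submodule.Quotient.mk 1)
    have hw0 : w = 0 := by
      funext j
      exact (Fin.cast h j).elim0
    rw [hw0, map_zero] at hw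
    have := hJm 1 ((Submodule.Quotient.mk_eq_zero J).mp hw.symm)
    simp at this
  let j₀ : Fin (F.rank 0) := ⟨0, Nat.pos_of_ne_zero hr0'⟩
  have hj₀ : ∀ j, j = j₀ := fun j => Fin.ext (by have := j.2; simp only [j₀]; omega)
  let θ := LinearMap.proj (R := MvPolynomial (Fin 3) k) (φ := fun _ => MvPolynomial (Fin 3) k) j₀ ∘ₗ
    F.diff 0
  have hθ : ∀ v, θ v = F.diff 0 v j₀ := fun v => rfl
  have hsingle : ∀ w : Fin (F.rank 0) → MvPolynomial (Fin 3) k, w = w j₀ • Pi.single j₀ 1 := by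
    intro w
    funext j
    rw [hj₀ j]
    simp
  have hkerθ : LinearMap.ker θ = LinearMap.ker (F.diff 0) := by
    ext v
    rw [LinearMap.mem_ker, LinearMap.mem_ker, hθ]
    refine ⟨fun h => ?_, fun h => by rw [h]; rfl⟩
    rw [hsingle (F.diff 0 v), h, zero_smul]
  have hrangeθ : LinearMap.range θ = J := by
    obtain ⟨u, hu, huj⟩ := F.aug_homogeneous j₀
    rw [hs0, SetLike.mem_coe] at hu
    have huC := mem_polyPiece_zero hu
    have hu0 : constantCoeff u ≠ 0 := by
      intro h
      rw [huC, h, C_0, map_zero] at huj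
      have := F.constantCoeff_of_aug_eq_zero huj.symm j₀
      simp at this
    have haug : ∀ p : MvPolynomial (Fin 3) k, F.aug (p • Pi.single j₀ 1) = 0 ↔ p ∈ J := by
      intro p
      rw [map_smul, ← huj]
      change p • Submodule.Quotient.mk (p := J) u = 0 ↔ _
      rw [← Submodule.Quotient.mk_smul, Submodule.Quotient.mk_eq_zero, smul_eq_mul, huC]
      constructor
      · intro h
        have := J.mul_mem_right (C (constantCoeff u)⁻¹) h
        rwa [mul_assoc, ← C_mul, mul_inv_cancel₀ hu0, C_1, mul_one] at this
      · intro h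
        exact J.mul_mem_right _ h
    ext p
    rw [← haug, LinearMap.mem_range]
    constructor
    · rintro ⟨v, rfl⟩
      rw [hθ, ← hsingle]
      exact (F.exact_zero _).mpr ⟨v, rfl⟩
    · intro h
      obtain ⟨v, hv⟩ := (F.exact_zero _).mp h
      refine ⟨v, ?_⟩
      rw [hθ, hv]
      simp
  have hθhom : ∀ l, θ (Pi.single l 1) ∈ polyPiece (Fin 3) k (F.shift 1 l) := by
    intro l
    have := F.diff_homogeneous 0 l j₀
    rwa [hs0, sub_zero] at this
  obtain ⟨hs1, hr1⟩ := minimal_generators_of_equigenerated (b := a) (φ := θ) (s := F.shift 1)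
    (g := g) (fun i => by
      rw [hrangeθ, ← hJ]
      exact Ideal.subset_span ⟨i, rfl⟩) (fun l => by
      have h : θ (Pi.single l 1) ∈ Ideal.span (Set.range g) := by
        rw [hJ]
        exact hrangeθ.le (LinearMap.mem_range_self _ _)
      obtain ⟨c, hc⟩ := Ideal.mem_span_range_iff_exists_fun.mp h
      refine ⟨fun i => polyComp (F.shift 1 l - a) (c i), fun i => polyComp_mem _ _, ?_⟩
      rw [← polyComp_of_mem (hθhom l), ← hc, map_sum]
      exact Finset.sum_congr rfl fun i _ => polyComp_mul (hg i) _ _)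
    (fun w hw => F.constantCoeff_of_diff_eq_zero (by
      rw [← LinearMap.mem_ker, ← hkerθ]
      exact hw))
  let G : IdealResolution J a :=
    { r := F.rank 1
      m := F.rank 2
      n := F.rank 3
      D := F.shift 2
      e := F.shift 3
      gen := θ
      syz := F.diff 1
      rel := F.diff 2
      r_le := hr1.trans ht
      gen_homogeneous := fun l => hs1 l ▸ hθhom l
      syz_homogeneous := fun l j => hs1 j ▸ F.diff_homogeneous 1 l j
      rel_homogeneous := F.diff_homogeneous 2
      range_gen := hrangeθ
      range_syz := (LinearMap.exact_iff.mp (F.exact_succ 0)).symm.trans hkerθ.symm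
      range_rel := (LinearMap.exact_iff.mp (F.exact_succ 1)).symm
      ker_rel := F.ker_diff_two
      rel_minimal := F.minimal 2 }
  refine ⟨G, hs0, hs1, rfl, rfl, fun _ => Iff.rfl, fun _ => Iff.rfl, fun j => ?_⟩
  by_contra! hle
  have h0 : F.diff 1 (Pi.single j 1) = 0 := by
    funext i
    have h1 := F.diff_homogeneous 1 j i
    rw [hs1 i] at h1
    rcases (show F.shift 2 j ≤ a from hle).eq_or_lt with h | h
    · rw [h, sub_self] at h1
      rw [mem_polyPiece_zero h1, F.minimal]
      simp
    · rwa [polyPiece_eq_bot (sub_neg.mpr h), Submodule.mem_bot] at h1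
  have := F.constantCoeff_of_diff_eq_zero h0 j
  simp at this

/-- The regularity of `S / J` in terms of the last degree `A - 3` in which the Hilbert function differs
from its eventual value: it is `A - 2` if the Hilbert function is too small there, and `A - 3` if it is
too large. -/
lemma MinimalGradedFreeResolution.exists_regularity_eq
    (F : MinimalGradedFreeResolution (Fin 3) (quotientPiece J)) (ha : 1 ≤ a) (ht : t ≤ 3)
    (hg : ∀ i, g i ∈ polyPiece (Fin 3) k a) (hJ : Ideal.span (Set.range g) = J) (hJ0 : J ≠ ⊥)
    {τ : ℕ} {K : ℤ} (hK : ∀ i, K ≤ i → Module.finrank k (quotientPiece J i) = τ) :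
    ∃ A : ℤ, (∀ i, A - 2 ≤ i → Module.finrank k (quotientPiece J i) = τ) ∧
      ((Module.finrank k (quotientPiece J (A - 3)) < τ ∧
          F.regularity = (((A - 2 : ℤ) : ℝ) : EReal)) ∨
        (τ < Module.finrank k (quotientPiece J (A - 3)) ∧
          F.regularity = (((A - 3 : ℤ) : ℝ) : EReal))) := by
  obtain ⟨G, hs0, hs1, hm, hn, hD, he, hDa⟩ := F.exists_idealResolution ha ht hg hJ
  obtain ⟨A, haA, hDA, heA, hst, h⟩ := G.exists_stabilization ha hJ0 hK
  refine ⟨A, hst, ?_⟩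
  have hle : ∀ B : ℤ, 0 ≤ B → a - 1 ≤ B → (∀ j, F.shift 2 j - 2 ≤ B) → (∀ j, F.shift 3 j - 3 ≤ B) →
      F.regularity ≤ ((B : ℝ) : EReal) := by
    intro B h0 h1 h2 h3
    refine iSup₂_le fun i j => ?_
    rw [EReal.coe_le_coe_iff, Int.cast_le]
    match i, j with
    | 0, j => simpa [hs0 j] using h0
    | 1, j => simpa [hs1 j] using h1
    | 2, j => simpa using h2 j
    | 3, j => simpa using h3 j
    | i + 4, j =>
      exact (Fin.cast (F.rank_add_four i) j).elim0
  have hge : ∀ (i : ℕ) (j : Fin (F.rank i)) (B : ℤ), B = F.shift i j - i →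
      ((B : ℝ) : EReal) ≤ F.regularity := by
    rintro i j B rfl
    exact le_iSup₂ (f := fun (i : ℕ) (j : Fin (F.rank i)) =>
      (((F.shift i j - i : ℤ) : ℝ) : EReal)) i j
  have hD2 : ∀ j, ∃ j', G.D j' = F.shift 2 j := fun j => (hD _).mpr ⟨j, rfl⟩
  have he3 : ∀ j, ∃ j', G.e j' = F.shift 3 j := fun j => (he _).mpr ⟨j, rfl⟩
  rcases h with ⟨hn0, -, hex, hlt⟩ | ⟨-, hm0, hDlt, hex, hlt⟩
  · refine Or.inl ⟨hlt, le_antisymm (hle _ (by omega) (by omega) ?_ ?_) ?_⟩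
    · intro j
      obtain ⟨j', hj'⟩ := hD2 j
      have := hDA j'
      omega
    · intro j
      exact (Fin.cast (hn.symm.trans hn0) j).elim0
    · obtain ⟨j, hj⟩ := (hD A).mp hex
      exact hge 2 j _ (by rw [hj]; rfl)
  · have h1 := hDa ⟨0, hm0⟩
    have h2 := hDlt ⟨0, hm0⟩
    refine Or.inr ⟨hlt, le_antisymm (hle _ (by omega) (by omega) ?_ ?_) ?_⟩
    · intro j
      obtain ⟨j', hj'⟩ := hD2 j
      have := hDlt j'
      omega
    · intro j
      obtain ⟨j', hj'⟩ := he3 j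
      have := heA j'
      omega
    · obtain ⟨j, hj⟩ := (he A).mp hex
      exact hge 3 j _ (by rw [hj]; rfl)

/-- The degree `A - 2` from which a function is constant is determined by the function. -/
lemma threshold_unique {H : ℤ → ℕ} {τ : ℕ} {A B : ℤ} (hA : ∀ i, A - 2 ≤ i → H i = τ)
    (hA' : H (A - 3) ≠ τ) (hB : ∀ i, B - 2 ≤ i → H i = τ) (hB' : H (B - 3) ≠ τ) : A = B := by
  by_contra hne
  rcases lt_or_gt_of_ne hne with h | h
  · exact hB' (hA _ (by omega))
  · exact hA' (hB _ (by omega))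

end Regularity

/-! ### Freeness and the sign of the Hilbert function defect -/

section Jacobian

variable {f : MvPolynomial (Fin 3) ℂ} {d : ℕ}

lemma pderiv_mem_polyPiece (hd : 1 ≤ d) (hf : f.IsHomogeneous d) (i : Fin 3) :
    pderiv i f ∈ polyPiece (Fin 3) ℂ ((d : ℤ) - 1) := by
  rw [← Nat.cast_one, ← Nat.cast_sub hd, polyPiece_natCast]
  exact hf.pderiv

/-- Euler's identity places `f` in its Jacobian ideal. -/
lemma mem_jacobianIdeal (hd : 1 ≤ d) (hf : f.IsHomogeneous d) : f ∈ jacobianIdeal f := by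
  have h := hf.sum_X_mul_pderiv
  have h1 : C ((d : ℂ)⁻¹) * (d • f) = f := by
    rw [nsmul_eq_mul, ← mul_assoc, ← map_natCast (C (σ := Fin 3) (R := ℂ)), ← C_mul,
      inv_mul_cancel₀ (Nat.cast_ne_zero.mpr (by omega)), C_1, one_mul]
  have h2 : d • f ∈ jacobianIdeal f := by
    rw [← h]
    exact Ideal.sum_mem _ fun i _ => Ideal.mul_mem_left _ _ (Ideal.subset_span ⟨i, rfl⟩)
  have h3 := (jacobianIdeal f).mul_mem_left (C ((d : ℂ)⁻¹)) h2
  rwa [h1] at h3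

lemma jacobianIdeal_ne_bot (hd : 1 ≤ d) (hf : f.IsHomogeneous d) (hf0 : f ≠ 0) :
    jacobianIdeal f ≠ ⊥ := by
  intro h
  have := mem_jacobianIdeal hd hf
  rw [h] at this
  exact hf0 this

lemma polyComp_mem_jacobianIdeal (hd : 1 ≤ d) (hf : f.IsHomogeneous d) {p : MvPolynomial (Fin 3) ℂ}
    (hp : p ∈ jacobianIdeal f) (n : ℤ) : polyComp n p ∈ jacobianIdeal f := by
  obtain ⟨c, rfl⟩ := Ideal.mem_span_range_iff_exists_fun.mp hp
  rw [map_sum]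
  refine Ideal.sum_mem _ fun i _ => ?_
  rw [polyComp_mul (pderiv_mem_polyPiece hd hf i)]
  exact Ideal.mul_mem_left _ _ (Ideal.subset_span ⟨i, rfl⟩)

lemma constantCoeff_of_mem_jacobianIdeal (hd : 2 ≤ d) (hf : f.IsHomogeneous d)
    {p : MvPolynomial (Fin 3) ℂ} (hp : p ∈ jacobianIdeal f) : constantCoeff p = 0 := by
  obtain ⟨c, rfl⟩ := Ideal.mem_span_range_iff_exists_fun.mp hp
  rw [map_sum]
  refine Finset.sum_eq_zero fun i _ => ?_
  rw [map_mul, constantCoeff_of_mem_polyPiece (by omega) (pderiv_mem_polyPiece (by omega) hf i),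
    mul_zero]

lemma range_linearCombination_pderiv :
    LinearMap.range (Fintype.linearCombination (MvPolynomial (Fin 3) ℂ) fun i => pderiv i f) =
      jacobianIdeal f :=
  Fintype.range_linearCombination _ _

lemma linearCombination_pderiv_mem (hd : 1 ≤ d) (hf : f.IsHomogeneous d) (l : Fin 3) :
    Fintype.linearCombination (MvPolynomial (Fin 3) ℂ) (fun i => pderiv i f) (Pi.single l 1) ∈
      polyPiece (Fin 3) ℂ ((d : ℤ) - 1) := by
  rw [Fintype.linearCombination_apply_single, one_smul]
  exact pderiv_mem_polyPiece hd hf l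

/-- A homogeneous basis of the syzygy module of a free curve gives a resolution of the Jacobian ideal
without second syzygies. -/
lemma IsFreeCurve.exists_idealResolution (hd : 1 ≤ d) (hf : f.IsHomogeneous d)
    (h : IsFreeCurve f) : ∃ F : IdealResolution (jacobianIdeal f) ((d : ℤ) - 1), F.n = 0 := by
  obtain ⟨D, b, hb⟩ := h
  let syz : (Fin 2 → MvPolynomial (Fin 3) ℂ) →ₗ[MvPolynomial (Fin 3) ℂ]
      (Fin 3 → MvPolynomial (Fin 3) ℂ) := (AR f).subtype ∘ₗ b.equivFun.symm.toLinearMap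
  have hinj : LinearMap.ker syz = ⊥ := by
    rw [LinearMap.ker_eq_bot]
    exact (Submodule.injective_subtype _).comp b.equivFun.symm.injective
  refine ⟨
    { r := 3
      m := 2
      n := 0
      D := fun l => D l + ((d : ℤ) - 1)
      e := fun l => l.elim0
      gen := Fintype.linearCombination (MvPolynomial (Fin 3) ℂ) fun i => pderiv i f
      syz := syz
      rel := 0
      r_le := le_rfl
      gen_homogeneous := linearCombination_pderiv_mem hd hf
      syz_homogeneous := ?_
      rel_homogeneous := fun l => l.elim0
      range_gen := range_linearCombination_pderiv
      range_syz := ?_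
      range_rel := ?_
      ker_rel := ?_
      rel_minimal := fun v j => by simp }, rfl⟩
  · intro l j
    have h1 : syz (Pi.single l 1) = b l := by
      simp only [syz, LinearMap.comp_apply, LinearEquiv.coe_coe, Submodule.subtype_apply]
      congr 1
      rw [LinearEquiv.symm_apply_eq]
      funext i
      rw [b.equivFun_self]
      simp [Pi.single_apply, eq_comm]
    rw [h1, add_sub_cancel_right, polyPiece_natCast]
    exact hb l j
  · rw [LinearMap.range_comp, LinearEquiv.range, Submodule.map_top, Submodule.range_subtype]
    rfl
  · rw [LinearMap.range_zero, hinj]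
  · exact (Submodule.eq_bot_of_subsingleton)

/-- Minimal generators of the syzygy module give a resolution of the Jacobian ideal. If there are two of
them and they satisfy no relations, then they form a homogeneous basis and the curve is free. -/
lemma exists_idealResolution_isFreeCurve (hd : 1 ≤ d) (hf : f.IsHomogeneous d) :
    ∃ F : IdealResolution (jacobianIdeal f) ((d : ℤ) - 1),
      (F.n = 0 → F.r = F.m + 1 → IsFreeCurve f) := by
  obtain ⟨m, n, D, e, syz, rel, h1, h2, h3, h4, h5, h6⟩ := PlaneCurve.exists_idealResolution
    (Fintype.linearCombination (MvPolynomial (Fin 3) ℂ) fun i => pderiv i f)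
    (linearCombination_pderiv_mem hd hf)
  refine ⟨
    { r := 3
      m := m
      n := n
      D := D
      e := e
      gen := Fintype.linearCombination (MvPolynomial (Fin 3) ℂ) fun i => pderiv i f
      syz := syz
      rel := rel
      r_le := le_rfl
      gen_homogeneous := linearCombination_pderiv_mem hd hf
      syz_homogeneous := h1
      rel_homogeneous := h2
      range_gen := range_linearCombination_pderiv
      range_syz := h3
      range_rel := h4
      ker_rel := h5
      rel_minimal := h6 }, ?_⟩
  intro hn hm
  simp only at hn hm
  subst hn
  obtain rfl : m = 2 := by omega
  have hinj : Function.Injective syz := by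
    rw [← LinearMap.ker_eq_bot, ← h4]
    rw [eq_bot_iff]
    rintro _ ⟨v, rfl⟩
    rw [Subsingleton.elim v 0, map_zero]
    exact zero_mem _
  let E : (Fin 2 → MvPolynomial (Fin 3) ℂ) ≃ₗ[MvPolynomial (Fin 3) ℂ] AR f :=
    (LinearEquiv.ofInjective syz hinj).trans (LinearEquiv.ofEq _ _ h3)
  refine ⟨fun l => (D l - ((d : ℤ) - 1)).toNat, Module.Basis.ofEquivFun E.symm, fun l i => ?_⟩
  have hE : (((Module.Basis.ofEquivFun E.symm) l : AR f) : Fin 3 → MvPolynomial (Fin 3) ℂ) =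
      syz (Pi.single l 1) := by
    rw [Module.Basis.coe_ofEquivFun]
    simp only [E, LinearEquiv.symm_symm]
    rfl
  rw [hE]
  have h := h1 l i
  by_cases h0 : 0 ≤ D l - ((d : ℤ) - 1)
  · rwa [polyPiece, if_pos h0] at h
  · rw [polyPiece, if_neg h0, Submodule.mem_bot] at h
    rw [h]
    exact zero_mem _

end Jacobian

section Threshold

variable {f : MvPolynomial (Fin 3) ℂ} {d : ℕ}

lemma st_eq {A : ℤ}
    (hA : ∀ i, A - 2 ≤ i → Module.finrank ℂ (milnorPiece f i) = totalTjurina f)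
    (hA' : Module.finrank ℂ (milnorPiece f (A - 3)) ≠ totalTjurina f) :
    st f = (((A - 2 : ℤ) : ℝ) : EReal) := by
  refine IsLeast.csInf_eq ⟨⟨A - 2, hA, rfl⟩, ?_⟩
  rintro _ ⟨q, hq, rfl⟩
  rw [EReal.coe_le_coe_iff, Int.cast_le]
  by_contra! h
  exact hA' (hq _ (by omega))

/-- The comparison of regularity and stability threshold for a form of degree at least two whose
Milnor algebra has Hilbert function eventually equal to the total Tjurina number. -/
theorem st_reg_of_eventually_eq (hd : 2 ≤ d) (hf : f.IsHomogeneous d) (hf0 : f ≠ 0) {K : ℤ}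
    (hK : ∀ i, K ≤ i → Module.finrank ℂ (milnorPiece f i) = totalTjurina f) :
    ∃ s r : ℤ, st f = ((s : ℝ) : EReal) ∧ reg f = ((r : ℝ) : EReal) ∧ s - 1 ≤ r ∧ r ≤ s ∧
      (r = s ↔ IsFreeCurve f) := by
  have hJ0 := jacobianIdeal_ne_bot (by omega) hf hf0
  have ha : (1 : ℤ) ≤ (d : ℤ) - 1 := by omega
  have key := fun F : MinimalGradedFreeResolution (Fin 3) (quotientPiece (jacobianIdeal f)) =>
    F.exists_regularity_eq ha le_rfl (pderiv_mem_polyPiece (by omega) hf) rfl hJ0 hK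
  obtain ⟨F₀⟩ := nonempty_minimalGradedFreeResolution (jacobianIdeal f)
    (fun p hp n => polyComp_mem_jacobianIdeal (by omega) hf hp n)
    (fun p hp => constantCoeff_of_mem_jacobianIdeal hd hf hp)
  obtain ⟨A, hA, h⟩ := key F₀
  have hne : Module.finrank ℂ (quotientPiece (jacobianIdeal f) (A - 3)) ≠ totalTjurina f := by
    rcases h with h | h
    · exact h.1.ne
    · exact h.1.ne'
  -- all minimal resolutions have the same regularity
  have hreg : reg f = F₀.regularity := by
    refine le_antisymm (iInf_le _ F₀) (le_iInf fun F => ?_)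
    obtain ⟨B, hB, h'⟩ := key F
    have hne' : Module.finrank ℂ (quotientPiece (jacobianIdeal f) (B - 3)) ≠ totalTjurina f := by
      rcases h' with h' | h'
      · exact h'.1.ne
      · exact h'.1.ne'
    obtain rfl := threshold_unique hA hne hB hne'
    rcases h with h | h <;> rcases h' with h' | h'
    · exact (h.2.trans h'.2.symm).le
    · exact absurd h.1 h'.1.not_gt
    · exact absurd h.1 h'.1.not_gt
    · exact (h.2.trans h'.2.symm).le
  have hfree : IsFreeCurve f ↔
      Module.finrank ℂ (quotientPiece (jacobianIdeal f) (A - 3)) < totalTjurina f := by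
    constructor
    · intro hfr
      obtain ⟨G, hG⟩ := hfr.exists_idealResolution (by omega) hf
      obtain ⟨B, -, -, -, hB, h'⟩ := G.exists_stabilization ha hJ0 hK
      rcases h' with ⟨-, -, -, hlt⟩ | ⟨h0, -⟩
      · rwa [threshold_unique hA hne hB hlt.ne]
      · omega
    · intro hlt
      obtain ⟨G, hG⟩ := exists_idealResolution_isFreeCurve (f := f) (by omega) hf
      obtain ⟨B, -, -, -, hB, h'⟩ := G.exists_stabilization ha hJ0 hK
      rcases h' with ⟨h0, hr, -⟩ | ⟨-, -, -, -, hgt⟩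
      · exact hG h0 hr
      · rw [← threshold_unique hA hne hB hgt.ne'] at hgt
        exact absurd hlt hgt.not_gt
  rcases h with ⟨hlt, hr⟩ | ⟨hgt, hr⟩
  · exact ⟨A - 2, A - 2, st_eq hA hne, hreg.trans hr, by omega, le_rfl,
      ⟨fun _ => hfree.mpr hlt, fun _ => rfl⟩⟩
  · exact ⟨A - 2, A - 3, st_eq hA hne, hreg.trans hr, by omega, by omega,
      ⟨fun h => by omega, fun h => absurd (hfree.mp h) hgt.not_gt⟩⟩

end Threshold

/-! ### Lines -/

section Line

variable {f : MvPolynomial (Fin 3) ℂ}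

/-- The Milnor algebra of a line is zero, and so is its minimal resolution. -/
lemma reg_eq_bot_of_jacobianIdeal_eq_top (h : jacobianIdeal f = ⊤) : reg f = ⊥ := by
  have : Subsingleton (MilnorAlgebra f) := Ideal.Quotient.subsingleton_iff.mpr h
  let F : MinimalGradedFreeResolution (Fin 3) (milnorPiece f) :=
    { rank := fun _ => 0
      shift := fun _ j => j.elim0
      diff := fun _ => 0
      aug := 0
      diff_homogeneous := fun _ _ j => j.elim0
      aug_homogeneous := fun j => j.elim0
      aug_surjective := fun x => ⟨0, Subsingleton.elim _ _⟩
      exact_zero := fun x => ⟨fun _ => ⟨0, Subsingleton.elim _ _⟩, fun _ => Subsingleton.elim _ _⟩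
      exact_succ := fun i x =>
        ⟨fun _ => ⟨0, Subsingleton.elim _ _⟩, fun _ => Subsingleton.elim _ _⟩
      minimal := fun _ _ j => j.elim0 }
  refine le_bot_iff.mp ((iInf_le _ F).trans ?_)
  exact iSup₂_le fun i j => j.elim0

lemma st_eq_bot_of_jacobianIdeal_eq_top (h : jacobianIdeal f = ⊤) (hτ : totalTjurina f = 0) :
    st f = ⊥ := by
  have : Subsingleton (MilnorAlgebra f) := Ideal.Quotient.subsingleton_iff.mpr h
  rw [st, sInf_eq_bot]
  intro b hb
  obtain ⟨x, hx⟩ := EReal.lt_iff_exists_real_btwn.mp hb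
  obtain ⟨q, hq⟩ := exists_int_lt x
  refine ⟨_, ⟨q, fun n _ => ?_, rfl⟩, (EReal.coe_lt_coe_iff.mpr hq).trans hx.2⟩
  rw [hτ]
  exact Module.finrank_zero_of_subsingleton

lemma exists_pderiv_eq_C (hf : f.IsHomogeneous 1) : ∃ c : Fin 3 → ℂ, ∀ i, pderiv i f = C (c i) :=
  ⟨fun i => constantCoeff (pderiv i f), fun i =>
    mem_polyPiece_zero (by simpa using pderiv_mem_polyPiece le_rfl hf i)⟩

lemma exists_pderiv_eq_C_ne_zero (hf : f.IsHomogeneous 1) (hf0 : f ≠ 0) :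
    ∃ (c : Fin 3 → ℂ) (i : Fin 3), (∀ i, pderiv i f = C (c i)) ∧ c i ≠ 0 := by
  obtain ⟨c, hc⟩ := exists_pderiv_eq_C hf
  by_contra! h
  have := hf.sum_X_mul_pderiv
  simp only [hc, h c _ hc, C_0, mul_zero, Finset.sum_const_zero, one_smul] at this
  exact hf0 this.symm

lemma jacobianIdeal_eq_top_of_isHomogeneous_one (hf : f.IsHomogeneous 1) (hf0 : f ≠ 0) :
    jacobianIdeal f = ⊤ := by
  obtain ⟨c, i, hc, hi⟩ := exists_pderiv_eq_C_ne_zero hf hf0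
  have h : C (c i) ∈ jacobianIdeal f := hc i ▸ Ideal.subset_span ⟨i, rfl⟩
  exact Ideal.eq_top_of_isUnit_mem _ h ((isUnit_iff_ne_zero.mpr hi).map C)

/-- A line is free: two constant syzygies are obtained by solving for one variable. -/
lemma isFreeCurve_of_isHomogeneous_one (hf : f.IsHomogeneous 1) (hf0 : f ≠ 0) :
    IsFreeCurve f := by
  obtain ⟨c, i, hc, hi⟩ := exists_pderiv_eq_C_ne_zero hf hf0
  let b : Fin 2 → Fin 3 → MvPolynomial (Fin 3) ℂ := fun l =>
    Fin.insertNth i (C (-(c (i.succAbove l) / c i))) (Pi.single l 1)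
  have hmem : ∀ v, v ∈ AR f ↔ v i * C (c i) + ∑ l, v (i.succAbove l) * C (c (i.succAbove l)) = 0 := by
    intro v
    rw [AR, LinearMap.mem_ker, Fintype.linearCombination_apply, Fin.sum_univ_succAbove _ i]
    simp only [hc, smul_eq_mul]
  have hb : ∀ l, b l ∈ AR f := by
    intro l
    rw [hmem]
    simp only [b, Fin.insertNth_apply_same, Fin.insertNth_apply_succAbove]
    rw [Finset.sum_eq_single l (fun j _ hj => by simp [hj]) (by simp), ← C_mul]
    rw [neg_mul, div_mul_cancel₀ _ hi]
    simp
  let E : AR f ≃ₗ[MvPolynomial (Fin 3) ℂ] (Fin 2 → MvPolynomial (Fin 3) ℂ) :=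
    { toFun := fun v l => v.1 (i.succAbove l)
      map_add' := fun _ _ => rfl
      map_smul' := fun _ _ => rfl
      invFun := fun w => ⟨∑ l, w l • b l, Submodule.sum_mem _ fun l _ =>
        Submodule.smul_mem _ _ (hb l)⟩
      left_inv := by
        intro v
        apply Subtype.ext
        have hv := (hmem v).mp v.2
        funext j
        simp only [Finset.sum_apply, Pi.smul_apply, smul_eq_mul]
        rcases Fin.eq_self_or_eq_succAbove i j with rfl | ⟨l, rfl⟩
        · simp only [b, Fin.insertNth_apply_same]
          have h2 : (C (c j)⁻¹ : MvPolynomial (Fin 3) ℂ) * C (c j) = 1 := by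
            rw [← C_mul, inv_mul_cancel₀ hi, C_1]
          have h3 : v.1 j = C (c j)⁻¹ * -∑ l, v.1 (j.succAbove l) * C (c (j.succAbove l)) := by
            rw [← eq_neg_of_add_eq_zero_left hv, mul_left_comm, h2, mul_one]
          rw [h3, mul_neg, Finset.mul_sum, ← Finset.sum_neg_distrib]
          refine Finset.sum_congr rfl fun l _ => ?_
          rw [C_neg, div_eq_mul_inv, C_mul]
          ring
        · simp only [b, Fin.insertNth_apply_succAbove]
          rw [Finset.sum_eq_single l (fun j _ hj => by simp [hj.symm]) (by simp)]
          simp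
      right_inv := by
        intro w
        funext l
        simp only [b, Finset.sum_apply, Pi.smul_apply, smul_eq_mul, Fin.insertNth_apply_succAbove]
        rw [Finset.sum_eq_single l (fun j _ hj => by simp [hj.symm]) (by simp)]
        simp }
  refine ⟨fun _ => 0, Module.Basis.ofEquivFun E, fun l j => ?_⟩
  rw [Module.Basis.coe_ofEquivFun]
  have h : ((E.symm (Pi.single l 1) : AR f) : Fin 3 → MvPolynomial (Fin 3) ℂ) = b l := by
    change ∑ j, (Pi.single l 1 : Fin 2 → MvPolynomial (Fin 3) ℂ) j • b j = b l
    rw [Finset.sum_eq_single l (fun j _ hj => by simp [hj]) (by simp)]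
    simp
  rw [h, mem_homogeneousSubmodule]
  rcases Fin.eq_self_or_eq_succAbove i j with rfl | ⟨l', rfl⟩
  · simp only [b, Fin.insertNth_apply_same]
    exact isHomogeneous_C _ _
  · simp only [b, Fin.insertNth_apply_succAbove]
    by_cases hl : l' = l
    · rw [hl, Pi.single_eq_same]
      exact isHomogeneous_one _ _
    · rw [Pi.single_eq_of_ne hl]
      exact isHomogeneous_zero _ _ _

end Line

/-! ### Dehomogenization and the eventual value of the Hilbert function -/

section Dehomogenization

variable {σ k : Type*} [Field k]

attribute [local instance] MvPolynomial.gradedAlgebra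

lemma polyComp_mem_of_isHomogeneous {I : Ideal (MvPolynomial σ k)}
    (hI : I.IsHomogeneous (homogeneousSubmodule σ k)) {p : MvPolynomial σ k} (hp : p ∈ I) (n : ℤ) :
    polyComp n p ∈ I := by
  unfold polyComp
  split_ifs
  · exact homogeneousComponent_mem_of_mem hI hp _
  · exact I.zero_mem

lemma polyPiece_le_pow {N : ℕ} {i : ℤ} (hi : N ≤ i) {p : MvPolynomial σ k}
    (hp : p ∈ polyPiece σ k i) : p ∈ Ideal.span (Set.range (X : σ → MvPolynomial σ k)) ^ N := by
  rw [← idealOfVars, mem_pow_idealOfVars_iff]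
  intro d hd
  have := mem_polyPiece_iff.mp hp d (mem_support_iff.mp hd)
  omega

variable {I : Ideal (MvPolynomial σ k)} {ℓ : MvPolynomial σ k}

lemma exists_polyPiece_decomposition (hI : I.IsHomogeneous (homogeneousSubmodule σ k))
    (hℓ : ℓ ∈ polyPiece σ k 1) {N : ℕ}
    (hN : Ideal.span (Set.range (X : σ → MvPolynomial σ k)) ^ N ≤ I ⊔ Ideal.span {ℓ}) {i : ℤ}
    (hi : N ≤ i) {s : MvPolynomial σ k} (hs : s ∈ polyPiece σ k i) :
    ∃ p ∈ I, ∃ t ∈ polyPiece σ k (i - 1), s = p + t * ℓ := by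
  obtain ⟨p, hp, q, hq, hpq⟩ := Submodule.mem_sup.mp (hN (polyPiece_le_pow hi hs))
  obtain ⟨t, rfl⟩ := Ideal.mem_span_singleton'.mp hq
  refine ⟨polyComp i p, polyComp_mem_of_isHomogeneous hI hp i, polyComp (i - 1) t,
    polyComp_mem _ _, ?_⟩
  rw [← polyComp_mul hℓ, ← map_add, hpq, polyComp_of_mem hs]

/-- A form which vanishes modulo `I` after setting `ℓ = 1` is annihilated modulo `I` by a power of
`ℓ`. -/
lemma exists_pow_mul_mem_of_mem_sup (hI : I.IsHomogeneous (homogeneousSubmodule σ k))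
    (hℓ : ℓ ∈ polyPiece σ k 1) {i : ℤ} {s : MvPolynomial σ k} (hs : s ∈ polyPiece σ k i)
    (h : s ∈ I ⊔ Ideal.span {ℓ - 1}) : ∃ a : ℕ, ℓ ^ a * s ∈ I := by
  obtain ⟨p, hp, q, hq, hpq⟩ := Submodule.mem_sup.mp h
  obtain ⟨t, rfl⟩ := Ideal.mem_span_singleton'.mp hq
  -- the components of `s = p + t (ℓ - 1)`
  have hcomp : ∀ j, polyComp j t = polyComp j p + polyComp (j - 1) t * ℓ - polyComp j s := by
    intro j
    rw [← polyComp_mul hℓ, ← map_add, ← map_sub, ← hpq]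
    congr 1
    ring
  have hlow : ∀ n : ℕ, (n : ℤ) < i → polyComp (n : ℤ) t ∈ I := by
    intro n
    induction n with
    | zero =>
      intro hn
      rw [hcomp, polyComp_of_mem_of_ne hs (by omega), sub_zero]
      refine I.add_mem (polyComp_mem_of_isHomogeneous hI hp _) (I.mul_mem_right _ ?_)
      have := polyComp_mem (((0 : ℕ) : ℤ) - 1) t
      rw [polyPiece_eq_bot (by simp), Submodule.mem_bot] at this
      rw [this]
      exact I.zero_mem
    | succ n ih =>
      intro hn
      rw [hcomp, polyComp_of_mem_of_ne hs (by omega), sub_zero]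
      refine I.add_mem (polyComp_mem_of_isHomogeneous hI hp _) (I.mul_mem_right _ ?_)
      rw [Nat.cast_succ, add_sub_cancel_right]
      exact ih (by omega)
  have hprev : polyComp (i - 1) t ∈ I := by
    by_cases h0 : 0 ≤ i - 1
    · have := hlow (i - 1).toNat (by omega)
      rwa [Int.toNat_of_nonneg h0] at this
    · have := polyComp_mem (i - 1) t
      rw [polyPiece_eq_bot (by omega), Submodule.mem_bot] at this
      rw [this]
      exact I.zero_mem
  have hhigh : ∀ n : ℕ, polyComp (i + n) t + ℓ ^ n * s ∈ I := by
    intro n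
    induction n with
    | zero =>
      rw [Nat.cast_zero, add_zero, pow_zero, one_mul, hcomp, polyComp_of_mem hs, sub_add_cancel]
      exact I.add_mem (polyComp_mem_of_isHomogeneous hI hp _) (I.mul_mem_right _ hprev)
    | succ n ih =>
      rw [hcomp, polyComp_of_mem_of_ne hs (by omega), sub_zero, pow_succ,
        show i + ((n + 1 : ℕ) : ℤ) - 1 = i + n by push_cast; ring, add_assoc,
        show polyComp (i + n) t * ℓ + ℓ ^ n * ℓ * s = (polyComp (i + n) t + ℓ ^ n * s) * ℓ by ring]
      exact I.add_mem (polyComp_mem_of_isHomogeneous hI hp _) (I.mul_mem_right _ ih)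
  obtain ⟨n, hn⟩ : ∃ n : ℕ, (t.totalDegree : ℤ) < i + n := ⟨(t.totalDegree + 1 - i).toNat, by omega⟩
  refine ⟨n, ?_⟩
  have h0 : polyComp (i + n) t = 0 := by
    ext d
    rw [coeff_polyComp, coeff_zero]
    split_ifs with hd
    · refine coeff_eq_zero_of_totalDegree_lt ?_
      rw [← Finsupp.degree_apply]
      omega
    · rfl
  have := hhigh n
  rwa [h0, zero_add] at this

/-- Let `I` be a homogeneous ideal and `ℓ` a linear form such that `I + (ℓ)` contains a power of `𝔪`. For
`i ≫ 0` the dimension of the degree `i` piece of `S / I` is the dimension of `S / (I + (ℓ - 1))`: the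
pieces map onto the latter ring, and multiplication by `ℓ` is bijective on the pieces. -/
theorem exists_forall_finrank_quotientPiece_eq [Finite σ]
    (hI : I.IsHomogeneous (homogeneousSubmodule σ k)) (hℓ : ℓ ∈ polyPiece σ k 1) {N : ℕ}
    (hN : Ideal.span (Set.range (X : σ → MvPolynomial σ k)) ^ N ≤ I ⊔ Ideal.span {ℓ})
    {B : Type*} [CommRing B] [Algebra k B] {ψ : MvPolynomial σ k →ₐ[k] B}
    (hψ : Function.Surjective ψ) (hker : RingHom.ker ψ = I ⊔ Ideal.span {ℓ - 1}) :
    Module.Finite k B ∧ ∃ K : ℤ, ∀ i, K ≤ i →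
      Module.finrank k (quotientPiece I i) = Module.finrank k B := by
  let W : ℤ → Submodule k B := fun i => (polyPiece σ k i).map ψ.toLinearMap
  have hψI : ∀ p ∈ I, ψ p = 0 := fun p hp => by
    have : p ∈ RingHom.ker ψ := hker ▸ Submodule.mem_sup_left hp
    exact this
  have hψℓ : ψ ℓ = 1 := by
    have : ℓ - 1 ∈ RingHom.ker ψ := hker ▸ Submodule.mem_sup_right (Ideal.mem_span_singleton_self _)
    rw [RingHom.mem_ker, map_sub, map_one] at this
    exact sub_eq_zero.mp this
  have hup : ∀ i, W i ≤ W (i + 1) := by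
    rintro i _ ⟨s, hs, rfl⟩
    refine ⟨s * ℓ, polyPiece_mul_mem hs hℓ, ?_⟩
    simp [hψℓ]
  have hup' : ∀ (n : ℕ) i, W i ≤ W (i + n) := by
    intro n i
    induction n with
    | zero => simp
    | succ n ih =>
      refine ih.trans ((hup _).trans_eq ?_)
      push_cast
      rw [add_assoc]
  have hdown : ∀ i : ℤ, N ≤ i → W i ≤ W (i - 1) := by
    rintro i hi _ ⟨s, hs, rfl⟩
    obtain ⟨p, hp, t, ht, rfl⟩ := exists_polyPiece_decomposition hI hℓ hN hi hs
    refine ⟨t, ht, ?_⟩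
    simp [hψℓ, hψI p hp]
  have hdown' : ∀ (n : ℕ) (i : ℤ), N ≤ i → W (i + n) ≤ W i := by
    intro n i hi
    induction n with
    | zero => simp
    | succ n ih =>
      refine (hdown _ (by omega)).trans (le_of_eq_of_le ?_ ih)
      push_cast
      congr 1
      ring
  have hall : ∀ i j : ℤ, N ≤ i → W j ≤ W i := by
    intro i j hi
    rcases le_total i j with h | h
    · obtain ⟨n, rfl⟩ := Int.le.dest h
      exact hdown' n i hi
    · obtain ⟨n, rfl⟩ := Int.le.dest h
      exact hup' n j
  have htop : ∀ i : ℤ, N ≤ i → W i = ⊤ := by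
    intro i hi
    rw [eq_top_iff]
    intro b _
    obtain ⟨s, rfl⟩ := hψ b
    rw [← sum_polyComp s, map_sum]
    exact Submodule.sum_mem _ fun j _ => hall i j hi ⟨_, polyComp_mem _ _, rfl⟩
  have hfin : Module.Finite k B := by
    rw [Module.finite_def, ← htop N le_rfl]
    exact (Module.Finite.iff_fg.mp (inferInstance : FiniteDimensional k (polyPiece σ k N))).map _
  refine ⟨hfin, ?_⟩
  -- multiplication by `ℓ` on the quotient
  let μ : (MvPolynomial σ k ⧸ I) →ₗ[k] (MvPolynomial σ k ⧸ I) :=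
    LinearMap.mulRight k (Ideal.Quotient.mk I ℓ)
  have hμ : ∀ i : ℤ, N ≤ i → quotientPiece I i ≤ (quotientPiece I (i - 1)).map μ := by
    rintro i hi _ ⟨s, hs, rfl⟩
    obtain ⟨p, hp, t, ht, rfl⟩ := exists_polyPiece_decomposition hI hℓ hN hi hs
    refine ⟨_, ⟨t, ht, rfl⟩, ?_⟩
    simp [μ, Ideal.Quotient.eq_zero_iff_mem.mpr hp]
  have hμ' : ∀ i : ℤ, (quotientPiece I (i - 1)).map μ ≤ quotientPiece I i := by
    rintro i _ ⟨_, ⟨t, ht, rfl⟩, rfl⟩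
    refine ⟨t * ℓ, ?_, by simp [μ]⟩
    have := polyPiece_mul_mem ht hℓ
    rwa [sub_add_cancel] at this
  have hfinq : ∀ i, FiniteDimensional k (quotientPiece I i) := fun i => by
    unfold quotientPiece
    infer_instance
  -- the dimensions of the pieces decrease, hence stabilize
  obtain ⟨n₀, hn₀⟩ : ∃ n₀ : ℕ, ∀ n, n₀ ≤ n →
      Module.finrank k (quotientPiece I (N + n)) = Module.finrank k (quotientPiece I (N + n₀)) := by
    have hanti : Antitone fun n : ℕ => Module.finrank k (quotientPiece I (N + n)) := by
      refine antitone_nat_of_succ_le fun n => ?_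
      refine (Submodule.finrank_mono (hμ _ (by omega))).trans ?_
      refine (Submodule.finrank_map_le _ _).trans_eq ?_
      rw [show (N : ℤ) + ((n + 1 : ℕ) : ℤ) - 1 = N + n by push_cast; ring]
    obtain ⟨n₀, hn₀⟩ := WellFoundedLT.antitone_chain_condition hanti
    exact ⟨n₀, fun n hn => (hn₀ n hn).symm⟩
  have hinj : ∀ i : ℤ, (N + n₀ : ℤ) ≤ i → ∀ s ∈ polyPiece σ k i, ℓ * s ∈ I → s ∈ I := by
    intro i hi s hs hsI
    have h1 := finrank_map_add_finrank_inf_ker μ (quotientPiece I i)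
    have h2 : (quotientPiece I i).map μ = quotientPiece I (i + 1) := by
      have h3 := hμ (i + 1) (by omega)
      have h4 := hμ' (i + 1)
      rw [add_sub_cancel_right] at h3 h4
      exact le_antisymm h4 h3
    have h3 := hn₀ (i - N).toNat (by omega)
    have h4 := hn₀ (i + 1 - N).toNat (by omega)
    rw [show (N : ℤ) + (i - N).toNat = i by omega] at h3
    rw [show (N : ℤ) + (i + 1 - N).toNat = i + 1 by omega] at h4
    rw [h2, h3, h4, Nat.add_eq_left, Submodule.finrank_eq_zero] at h1
    have h5 : Ideal.Quotient.mk I s ∈ quotientPiece I i ⊓ LinearMap.ker μ := by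
      refine ⟨⟨s, hs, rfl⟩, ?_⟩
      rw [SetLike.mem_coe, LinearMap.mem_ker, LinearMap.mulRight_apply, ← map_mul, mul_comm]
      exact Ideal.Quotient.eq_zero_iff_mem.mpr hsI
    rw [h1, Submodule.mem_bot] at h5
    exact Ideal.Quotient.eq_zero_iff_mem.mp h5
  have hinj' : ∀ (a : ℕ) (i : ℤ), (N + n₀ : ℤ) ≤ i → ∀ s ∈ polyPiece σ k i, ℓ ^ a * s ∈ I → s ∈ I := by
    intro a
    induction a with
    | zero =>
      intro i hi s hs h
      simpa using h
    | succ a ih =>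
      intro i hi s hs h
      refine hinj i hi s hs (ih (1 + i) (by omega) _ (polyPiece_mul_mem hℓ hs) ?_)
      rwa [← mul_assoc, ← pow_succ]
  refine ⟨N + n₀, fun i hi => ?_⟩
  have h1 := finrank_map_add_finrank_inf_ker ψ.toLinearMap (polyPiece σ k i)
  have h2 := finrank_map_add_finrank_inf_ker (Ideal.Quotient.mkₐ k I).toLinearMap (polyPiece σ k i)
  rw [show (polyPiece σ k i).map ψ.toLinearMap = ⊤ from htop i (by omega), finrank_top] at h1
  have h3 : polyPiece σ k i ⊓ LinearMap.ker ψ.toLinearMap =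
      polyPiece σ k i ⊓ LinearMap.ker (Ideal.Quotient.mkₐ k I).toLinearMap := by
    ext s
    simp only [Submodule.mem_inf, LinearMap.mem_ker, AlgHom.toLinearMap_apply,
      Ideal.Quotient.mkₐ_eq_mk, Ideal.Quotient.eq_zero_iff_mem]
    refine and_congr_right fun hs => ⟨fun h => ?_, hψI s⟩
    have h' : s ∈ RingHom.ker ψ := h
    rw [hker] at h'
    obtain ⟨a, ha⟩ := exists_pow_mul_mem_of_mem_sup hI hℓ hs h'
    exact hinj' a i hi s hs ha
  rw [h3] at h1
  have h4 : Module.finrank k (quotientPiece I i) +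
      Module.finrank k (polyPiece σ k i ⊓ LinearMap.ker (Ideal.Quotient.mkₐ k I).toLinearMap :
        Submodule k (MvPolynomial σ k)) = Module.finrank k (polyPiece σ k i) := h2
  omega

end Dehomogenization

/-! ### A reduced plane curve has finitely many singular points -/

section Singular

attribute [local instance] MvPolynomial.gradedAlgebra

lemma eval_smul_of_isHomogeneous {σ k : Type*} [Finite σ] [Field k] {p : MvPolynomial σ k} {n : ℕ}
    (hp : p.IsHomogeneous n) (c : k) (v : σ → k) : eval (c • v) p = c ^ n * eval v p := by
  cases nonempty_fintype σ
  rw [eval_eq', eval_eq', Finset.mul_sum]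
  refine Finset.sum_congr rfl fun d hd => ?_
  have hdeg : ∑ i, d i = n := by
    have := hp (mem_support_iff.mp hd)
    rw [← Finsupp.degree_eq_sum, Finsupp.degree_eq_weight_one]
    exact this
  simp only [Pi.smul_apply, smul_eq_mul, mul_pow, Finset.prod_mul_distrib, Finset.prod_pow_eq_pow_sum,
    hdeg]
  ring

/-- A polynomial over a field of characteristic zero all of whose partial derivatives vanish is
constant. -/
lemma eq_C_of_pderiv_eq_zero {σ k : Type*} [Field k] [CharZero k] {p : MvPolynomial σ k}
    (h : ∀ i, pderiv i p = 0) : p = C (constantCoeff p) := by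
  classical
  ext m
  rw [coeff_C]
  split_ifs with hm
  · rw [← hm, constantCoeff_eq]
  · obtain ⟨i, hi⟩ : ∃ i, m i ≠ 0 := by
      by_contra! h0
      exact hm (Finsupp.ext fun i => (h0 i).symm)
    have h1 := congrArg (coeff (m - Finsupp.single i 1)) (h i)
    rw [coeff_pderiv, coeff_zero, tsub_add_cancel_of_le
      (Finsupp.single_le_iff.mpr (Nat.one_le_iff_ne_zero.mpr hi))] at h1
    exact (mul_eq_zero.mp h1).resolve_right (Nat.cast_add_one_ne_zero _)

lemma totalDegree_pderiv_lt {σ k : Type*} [Field k] {p : MvPolynomial σ k} {i : σ}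
    (h : pderiv i p ≠ 0) : (pderiv i p).totalDegree < p.totalDegree := by
  obtain ⟨m, hm, hdeg⟩ := Finset.exists_mem_eq_sup (pderiv i p).support
    (support_nonempty.mpr h) fun s => s.sum fun _ e => e
  change (pderiv i p).totalDegree = _ at hdeg
  have h1 : m + Finsupp.single i 1 ∈ p.support := by
    rw [mem_support_iff] at hm ⊢
    rw [coeff_pderiv] at hm
    exact left_ne_zero_of_mul hm
  have h2 := le_totalDegree h1
  rw [hdeg]
  refine lt_of_lt_of_le ?_ h2
  change (m.degree : ℕ) < (m + Finsupp.single i 1).degree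
  simp

variable {f : MvPolynomial (Fin 3) ℂ} {d : ℕ}

lemma isHomogeneous_jacobianIdeal (hf : f.IsHomogeneous d) :
    (jacobianIdeal f).IsHomogeneous (homogeneousSubmodule (Fin 3) ℂ) := by
  refine Ideal.homogeneous_span _ _ ?_
  rintro _ ⟨i, rfl⟩
  exact ⟨d - 1, hf.pderiv⟩

/-- The partial derivatives of a square-free form have no common factor: such a factor `h` divides `f`
by Euler's identity, say `f = h g`, so that `h` divides `g ∂h` and hence `∂h` for every partial
derivative. -/
lemma not_forall_prime_dvd_pderiv (hd : 1 ≤ d) (hf : f.IsHomogeneous d) (hred : Squarefree f)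
    {h : MvPolynomial (Fin 3) ℂ} (hh : Prime h) : ¬ ∀ i, h ∣ pderiv i f := by
  intro hdvd
  have hfh : h ∣ f := by
    rw [← Ideal.mem_span_singleton]
    refine (Ideal.span_le.mpr ?_ : jacobianIdeal f ≤ Ideal.span {h}) (mem_jacobianIdeal hd hf)
    rintro _ ⟨i, rfl⟩
    exact Ideal.mem_span_singleton.mpr (hdvd i)
  obtain ⟨g, rfl⟩ := hfh
  have hg : ¬ h ∣ g := fun hg => hh.not_isUnit (hred h (mul_dvd_mul_left h hg))
  have hder : ∀ i, h ∣ pderiv i h := by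
    intro i
    have h1 := hdvd i
    rw [Derivation.leibniz, smul_eq_mul, smul_eq_mul,
      dvd_add_right (Dvd.intro _ rfl)] at h1
    exact (hh.dvd_or_dvd h1).resolve_left hg
  have hzero : ∀ i, pderiv i h = 0 := by
    intro i
    by_contra hne
    obtain ⟨c, hc⟩ := hder i
    have hlt := totalDegree_pderiv_lt hne
    rw [hc, totalDegree_mul_of_isDomain hh.ne_zero (right_ne_zero_of_mul (hc ▸ hne))] at hlt
    omega
  have hC := eq_C_of_pderiv_eq_zero hzero
  refine hh.not_isUnit ?_
  rw [hC]
  refine (isUnit_iff_ne_zero.mpr fun h0 => hh.ne_zero ?_).map C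
  rw [hC, h0, C_0]

/-- There is no chain of five prime ideals in a polynomial ring in three variables over a field. -/
lemma not_chain_of_primes {k : Type*} [Field k] {P : Fin 5 → Ideal (MvPolynomial (Fin 3) k)}
    (hP : ∀ i, (P i).IsPrime) : ¬ StrictMono P := by
  intro hmono
  let s : LTSeries (PrimeSpectrum (MvPolynomial (Fin 3) k)) :=
    { length := 4
      toFun := fun i => ⟨P i, hP i⟩
      step := fun i => hmono (Fin.castSucc_lt_succ (i := i)) }
  have h := Order.LTSeries.length_le_krullDim s
  change ((4 : ℕ) : WithBot ℕ∞) ≤ ringKrullDim (MvPolynomial (Fin 3) k) at h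
  rw [ringKrullDim_of_isNoetherianRing, ringKrullDim_eq_zero_of_field, zero_add,
    Nat.card_eq_fintype_card, Fintype.card_fin] at h
  exact absurd h (by decide)

/-- A prime ideal `P` that contains the Jacobian ideal of a square-free form and `x_c - 1` is maximal.
Otherwise there is a chain of five primes: zero, a prime element, the ideal generated by the forms in
`P`, the ideal `P` itself, and a maximal ideal. -/
lemma isMaximal_of_jacobianIdeal_le (hd : 1 ≤ d) (hf : f.IsHomogeneous d) (hred : Squarefree f)
    {P : Ideal (MvPolynomial (Fin 3) ℂ)} (hP : P.IsPrime) (hJ : jacobianIdeal f ≤ P) {c : Fin 3}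
    (hc : X c - 1 ∈ P) : P.IsMaximal := by
  by_contra hmax
  let H := P.homogeneousCore (homogeneousSubmodule (Fin 3) ℂ)
  have hH : H.toIdeal.IsPrime := hP.homogeneousCore
  have hHP : H.toIdeal < P := by
    refine lt_of_le_of_ne (Ideal.toIdeal_homogeneousCore_le _ P) fun heq => hP.ne_top ?_
    rw [Ideal.eq_top_iff_one, ← heq]
    have h1 := homogeneousComponent_mem_of_mem H.isHomogeneous (heq ▸ hc) 0
    rw [homogeneousComponent_zero] at h1
    have h2 : coeff 0 (X c - 1 : MvPolynomial (Fin 3) ℂ) = -1 := by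
      rw [← constantCoeff_eq]
      simp
    rw [h2, C_neg, C_1] at h1
    exact (neg_mem_iff).mp h1
  have hJH : jacobianIdeal f ≤ H.toIdeal := by
    rw [← (isHomogeneous_jacobianIdeal hf).toIdeal_homogeneousCore_eq_self]
    exact Ideal.homogeneousCore_mono _ hJ
  have hH0 : H.toIdeal ≠ ⊥ := fun h0 =>
    jacobianIdeal_ne_bot hd hf hred.ne_zero (le_bot_iff.mp (h0 ▸ hJH))
  obtain ⟨h, hhH, hh⟩ := hH.exists_mem_prime_of_ne_bot hH0
  have hspan : Ideal.span {h} < H.toIdeal := by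
    refine lt_of_le_of_ne ((Ideal.span_singleton_le_iff_mem _).mpr hhH) fun heq => ?_
    refine not_forall_prime_dvd_pderiv hd hf hred hh fun i => ?_
    rw [← Ideal.mem_span_singleton, heq]
    exact hJH (Ideal.subset_span ⟨i, rfl⟩)
  obtain ⟨Q, hQ, hPQ⟩ := Ideal.exists_le_maximal P hP.ne_top
  have hPQ' : P < Q := lt_of_le_of_ne hPQ fun heq => hmax (heq ▸ hQ)
  refine not_chain_of_primes (P := ![⊥, Ideal.span {h}, H.toIdeal, P, Q]) ?_ ?_
  · intro i
    fin_cases i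
    · exact Ideal.isPrime_bot
    · exact (Ideal.span_singleton_prime hh.ne_zero).mpr hh
    · exact hH
    · exact hP
    · exact hQ.isPrime
  · refine Fin.strictMono_iff_lt_succ.mpr fun i => ?_
    fin_cases i
    · exact bot_lt_iff_ne_bot.mpr (by simpa using hh.ne_zero)
    · exact hspan
    · exact hHP
    · exact hPQ'

lemma pointIdeal_injective {σ : Type} : Function.Injective (pointIdeal (σ := σ)) := by
  intro u w h
  funext j
  have h1 : X j - C (w j) ∈ pointIdeal u := by
    rw [h]
    simp [pointIdeal]
  simpa [pointIdeal, sub_eq_zero] using h1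

lemma finite_affine_singular_points (hd : 1 ≤ d) (hf : f.IsHomogeneous d) (hred : Squarefree f)
    (c : Fin 3) : {u : Fin 3 → ℂ | u c = 1 ∧ ∀ i, eval u (pderiv i f) = 0}.Finite := by
  let Q := jacobianIdeal f ⊔ Ideal.span {X c - 1}
  refine Set.Finite.of_injOn (f := pointIdeal) (t := Q.minimalPrimes) ?_
    pointIdeal_injective.injOn (Ideal.finite_minimalPrimes_of_isNoetherianRing _ Q)
  rintro u ⟨huc, hu⟩
  have hle : Q ≤ pointIdeal u := by
    refine sup_le (Ideal.span_le.mpr ?_) ((Ideal.span_singleton_le_iff_mem _).mpr ?_)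
    · rintro _ ⟨i, rfl⟩
      exact hu i
    · simp [pointIdeal, huc]
  refine ⟨⟨inferInstance, hle⟩, ?_⟩
  rintro P ⟨hP, hQP⟩ hPu
  have hmax := isMaximal_of_jacobianIdeal_le hd hf hred hP (le_sup_left.trans hQP)
    (hQP (Submodule.mem_sup_right (Ideal.mem_span_singleton_self _)))
  exact (hmax.eq_of_le (Ideal.IsPrime.ne_top inferInstance) hPu).ge

/-- The set of singular points of the curve `f = 0`. -/
def singularPoints (f : MvPolynomial (Fin 3) ℂ) : Set (Projectivization ℂ (Fin 3 → ℂ)) :=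
  {p | ∀ i, eval p.rep (pderiv i f) = 0}

lemma rep_chart_ne_zero (p : Projectivization ℂ (Fin 3 → ℂ)) : p.rep (chart p) ≠ 0 :=
  (exists_rep_ne_zero p).choose_spec

lemma finite_singularPoints (hd : 1 ≤ d) (hf : f.IsHomogeneous d) (hred : Squarefree f) :
    (singularPoints f).Finite := by
  let N : Projectivization ℂ (Fin 3 → ℂ) → Fin 3 → ℂ := fun p => (p.rep (chart p))⁻¹ • p.rep
  refine Set.Finite.of_injOn (f := N) (t := ⋃ c : Fin 3,
    {u : Fin 3 → ℂ | u c = 1 ∧ ∀ i, eval u (pderiv i f) = 0}) ?_ ?_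
    (Set.finite_iUnion fun c => finite_affine_singular_points hd hf hred c)
  · intro p hp
    refine Set.mem_iUnion.mpr ⟨chart p, inv_mul_cancel₀ (rep_chart_ne_zero p), fun i => ?_⟩
    rw [eval_smul_of_isHomogeneous hf.pderiv, hp i, mul_zero]
  · intro p _ q _ hpq
    rw [← p.mk_rep, ← q.mk_rep, Projectivization.mk_eq_mk_iff']
    refine ⟨p.rep (chart p) * (q.rep (chart q))⁻¹, ?_⟩
    rw [mul_smul]
    change _ • N q = _
    rw [← hpq, smul_inv_smul₀ (rep_chart_ne_zero p)]

end Singular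

/-! ### Splitting the Hilbert function over the points of a finite projective scheme -/

section Split

attribute [local instance] MvPolynomial.gradedAlgebra

/-- The Nullstellensatz over `ℂ`. -/
lemma mem_radical_of_forall_eval_eq_zero {σ : Type*} [Finite σ] {I : Ideal (MvPolynomial σ ℂ)}
    {p : MvPolynomial σ ℂ} (h : ∀ w : σ → ℂ, (∀ q ∈ I, eval w q = 0) → eval w p = 0) :
    p ∈ I.radical := by
  rw [← vanishingIdeal_zeroLocus_eq_radical (k := ℂ) (K := ℂ) I]
  intro w hw
  have hev : ∀ q : MvPolynomial σ ℂ, aeval w q = eval w q := fun q => by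
    rw [← coe_aeval_eq_eval]
    rfl
  rw [hev]
  refine h w fun q hq => ?_
  rw [← hev]
  exact hw q hq

variable {v : Fin 3 → ℂ}

/-- The homogeneous ideal of the line `ℂ v` through the origin, that is, of the point of the projective
plane with homogeneous coordinates `v`; it is generated by the linear forms vanishing at `v`. -/
def lineIdeal (v : Fin 3 → ℂ) : Ideal (MvPolynomial (Fin 3) ℂ) :=
  Ideal.span {L | L ∈ polyPiece (Fin 3) ℂ 1 ∧ eval v L = 0}

lemma mem_polyPiece_one_iff {L : MvPolynomial (Fin 3) ℂ} :
    L ∈ polyPiece (Fin 3) ℂ 1 ↔ L.IsHomogeneous 1 := by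
  rw [← Nat.cast_one, polyPiece_natCast, mem_homogeneousSubmodule]

lemma eval_smul_linear {L : MvPolynomial (Fin 3) ℂ} (hL : L ∈ polyPiece (Fin 3) ℂ 1) (c : ℂ)
    (v : Fin 3 → ℂ) : eval (c • v) L = c * eval v L := by
  rw [eval_smul_of_isHomogeneous (mem_polyPiece_one_iff.mp hL), pow_one]

lemma isHomogeneous_lineIdeal_pow (v : Fin 3 → ℂ) (N : ℕ) :
    (lineIdeal v ^ N).IsHomogeneous (homogeneousSubmodule (Fin 3) ℂ) := by
  induction N with
  | zero =>
    rw [pow_zero, Ideal.one_eq_top]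
    exact Ideal.IsHomogeneous.top _
  | succ N ih =>
    rw [pow_succ]
    refine ih.mul (Ideal.homogeneous_span _ _ ?_)
    rintro L ⟨hL, -⟩
    exact ⟨1, mem_polyPiece_one_iff.mp hL⟩

lemma lineIdeal_le_pointIdeal (v : Fin 3 → ℂ) (c : ℂ) : lineIdeal v ≤ pointIdeal (c • v) := by
  refine Ideal.span_le.mpr ?_
  rintro L ⟨hL, hLv⟩
  change eval (c • v) L = 0
  rw [eval_smul_linear hL, hLv, mul_zero]

lemma X_sub_mem_lineIdeal {ℓ : MvPolynomial (Fin 3) ℂ} (hℓ : ℓ ∈ polyPiece (Fin 3) ℂ 1)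
    (hv : eval v ℓ ≠ 0) (j : Fin 3) : X j - C (v j / eval v ℓ) * ℓ ∈ lineIdeal v := by
  refine Ideal.subset_span ⟨?_, ?_⟩
  · rw [mem_polyPiece_one_iff] at *
    refine (isHomogeneous_X _ _).sub ?_
    have := (isHomogeneous_C (Fin 3) (v j / eval v ℓ)).mul hℓ
    rwa [zero_add] at this
  · simp [div_mul_cancel₀ _ hv]

/-- In the affine chart `ℓ = 1` the ideal of a point is generated by its homogeneous ideal. -/
lemma X_sub_C_mem_sup {ℓ : MvPolynomial (Fin 3) ℂ} (hℓ : ℓ ∈ polyPiece (Fin 3) ℂ 1)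
    (hv : eval v ℓ ≠ 0) (j : Fin 3) :
    X j - C (v j / eval v ℓ) ∈ lineIdeal v ⊔ Ideal.span {ℓ - 1} := by
  have h : X j - C (v j / eval v ℓ) =
      (X j - C (v j / eval v ℓ) * ℓ) + C (v j / eval v ℓ) * (ℓ - 1) := by ring
  rw [h]
  exact Ideal.add_mem _ (Submodule.mem_sup_left (X_sub_mem_lineIdeal hℓ hv j))
    (Ideal.mul_mem_left _ _ (Submodule.mem_sup_right (Ideal.mem_span_singleton_self _)))

lemma pow_le_lineIdeal_pow_sup {ℓ : MvPolynomial (Fin 3) ℂ} (hℓ : ℓ ∈ polyPiece (Fin 3) ℂ 1)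
    (hv : eval v ℓ ≠ 0) (N : ℕ) :
    Ideal.span (Set.range (X : Fin 3 → MvPolynomial (Fin 3) ℂ)) ^ (N + 1) ≤
      lineIdeal v ^ N ⊔ Ideal.span {ℓ} := by
  have h : Ideal.span (Set.range (X : Fin 3 → MvPolynomial (Fin 3) ℂ)) ≤
      lineIdeal v ⊔ Ideal.span {ℓ} := by
    rw [Ideal.span_le]
    rintro _ ⟨j, rfl⟩
    have h1 : (X j : MvPolynomial (Fin 3) ℂ) =
        (X j - C (v j / eval v ℓ) * ℓ) + C (v j / eval v ℓ) * ℓ := by ring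
    rw [SetLike.mem_coe, h1]
    exact Ideal.add_mem _ (Submodule.mem_sup_left (X_sub_mem_lineIdeal hℓ hv j))
      (Ideal.mul_mem_left _ _ (Submodule.mem_sup_right (Ideal.mem_span_singleton_self _)))
  refine (Ideal.pow_right_mono h _).trans (Ideal.sup_pow_add_le_pow_sup_pow.trans ?_)
  rw [pow_one]

/-- The part of a projective scheme at one point, cut out by a power of the ideal of that point, has a
Hilbert function whose eventual value can be computed in any affine chart `ℓ = 1` containing the point. -/
lemma exists_finrank_local {J : Ideal (MvPolynomial (Fin 3) ℂ)}
    (hJ : J.IsHomogeneous (homogeneousSubmodule (Fin 3) ℂ)) {ℓ : MvPolynomial (Fin 3) ℂ}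
    (hℓ : ℓ ∈ polyPiece (Fin 3) ℂ 1) (hv : eval v ℓ ≠ 0) (N : ℕ) {B : Type*} [CommRing B]
    [Algebra ℂ B] {ψ : MvPolynomial (Fin 3) ℂ →ₐ[ℂ] B} (hψ : Function.Surjective ψ)
    (hker : RingHom.ker ψ = J ⊔ lineIdeal v ^ N ⊔ Ideal.span {ℓ - 1}) :
    Module.Finite ℂ B ∧ ∃ K : ℤ, ∀ i, K ≤ i →
      Module.finrank ℂ (quotientPiece (J ⊔ lineIdeal v ^ N) i) = Module.finrank ℂ B :=
  exists_forall_finrank_quotientPiece_eq (hJ.sup (isHomogeneous_lineIdeal_pow v N)) hℓ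
    ((pow_le_lineIdeal_pow_sup hℓ hv N).trans (sup_le_sup_right le_sup_right _)) hψ hker

lemma ker_mkₐ {R A : Type*} [CommRing R] [CommRing A] [Algebra R A] (I : Ideal A) :
    RingHom.ker (Ideal.Quotient.mkₐ R I) = I := by
  ext x
  rw [RingHom.mem_ker, Ideal.Quotient.mkₐ_eq_mk, Ideal.Quotient.eq_zero_iff_mem]

lemma prod_sup_le {R ι : Type*} [CommRing R] (s : Finset ι) (A : Ideal R) (B : ι → Ideal R) :
    ∏ i ∈ s, (A ⊔ B i) ≤ A ⊔ ∏ i ∈ s, B i := by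
  classical
  induction s using Finset.induction with
  | empty => simp
  | insert a s ha ih =>
    rw [Finset.prod_insert ha, Finset.prod_insert ha]
    refine (Ideal.mul_mono le_rfl ih).trans ?_
    have h1 : A * (A ⊔ ∏ i ∈ s, B i) ≤ A := Ideal.mul_le_left
    have h2 : B a * A ≤ A := Ideal.mul_le_right
    rw [Ideal.sup_mul, Ideal.mul_sup (B a)]
    exact sup_le (le_sup_of_le_left h1) (sup_le (le_sup_of_le_left h2) le_sup_right)

variable {ι : Type*} [Fintype ι] {w : ι → Fin 3 → ℂ} {J : Ideal (MvPolynomial (Fin 3) ℂ)}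

/-- If the zeros of `J` lie on the lines `ℂ wᵢ`, at least one in number, then a power of the product of
the ideals of these lines is contained in `J`. -/
lemma exists_prod_lineIdeal_pow_le [Nonempty ι]
    (hzero : ∀ u ≠ 0, (∀ p ∈ J, eval u p = 0) → ∃ i, ∃ c : ℂ, u = c • w i) :
    ∃ N : ℕ, (∏ i, lineIdeal (w i)) ^ N ≤ J := by
  refine Ideal.exists_pow_le_of_le_radical_of_fg (fun p hp => ?_) (IsNoetherian.noetherian _)
  refine mem_radical_of_forall_eval_eq_zero fun u hu => ?_
  obtain ⟨i, c, rfl⟩ : ∃ i, ∃ c : ℂ, u = c • w i := by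
    by_cases h0 : u = 0
    · exact ⟨Classical.arbitrary ι, 0, by rw [h0, zero_smul]⟩
    · exact hzero u h0 hu
  exact lineIdeal_le_pointIdeal (w i) c
    ((Ideal.prod_le_inf.trans (Finset.inf_le (Finset.mem_univ i))) hp)

/-- For a homogeneous ideal `J` with all its projective zeros among the points `wᵢ`, the Hilbert function
of `S / J` is eventually the sum of the lengths of the local schemes at these points. The latter are cut
out by `J` and a high power of the ideal of `wᵢ`, in the affine chart given by a linear form `ℓ` that
does not vanish at any of the points; the Chinese remainder theorem is applied there. -/
theorem exists_finrank_eq_sum (hJ : J.IsHomogeneous (homogeneousSubmodule (Fin 3) ℂ))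
    (hzero : ∀ u ≠ 0, (∀ p ∈ J, eval u p = 0) → ∃ i, ∃ c : ℂ, u = c • w i)
    (hdist : ∀ i j, i ≠ j → ∀ c : ℂ, w i ≠ c • w j) {ℓ : MvPolynomial (Fin 3) ℂ}
    (hℓ : ℓ ∈ polyPiece (Fin 3) ℂ 1) (hw : ∀ i, eval (w i) ℓ ≠ 0) :
    ∃ N₀ : ℕ, ∀ N, N₀ ≤ N → ∃ K : ℤ, ∀ n, K ≤ n → Module.finrank ℂ (quotientPiece J n) =
      ∑ i, Module.finrank ℂ
        (MvPolynomial (Fin 3) ℂ ⧸ (J ⊔ lineIdeal (w i) ^ N ⊔ Ideal.span {ℓ - 1})) := by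
  classical
  -- `J` and `ℓ` have only the origin as a common zero
  obtain ⟨M, hM⟩ : ∃ M : ℕ, Ideal.span (Set.range (X : Fin 3 → MvPolynomial (Fin 3) ℂ)) ^ M ≤
      J ⊔ Ideal.span {ℓ} := by
    refine Ideal.exists_pow_le_of_le_radical_of_fg (Ideal.span_le.mpr ?_)
      (IsNoetherian.noetherian _)
    rintro _ ⟨j, rfl⟩
    refine mem_radical_of_forall_eval_eq_zero fun u hu => ?_
    by_contra hne
    obtain ⟨i, c, rfl⟩ := hzero u (by
      rintro rfl
      simp at hne) fun p hp => hu p (Submodule.mem_sup_left hp)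
    have h1 := hu ℓ (Submodule.mem_sup_right (Ideal.mem_span_singleton_self _))
    rw [eval_smul_linear hℓ] at h1
    rcases mul_eq_zero.mp h1 with h | h
    · simp [h] at hne
    · exact hw i h
  obtain ⟨N₀, hN₀⟩ : ∃ N₀ : ℕ, (∏ i, lineIdeal (w i)) ^ N₀ ≤ J ⊔ Ideal.span {ℓ - 1} := by
    refine Ideal.exists_pow_le_of_le_radical_of_fg (fun p hp => ?_) (IsNoetherian.noetherian _)
    refine mem_radical_of_forall_eval_eq_zero fun u hu => ?_
    have h1 := hu (ℓ - 1) (Submodule.mem_sup_right (Ideal.mem_span_singleton_self _))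
    obtain ⟨i, c, rfl⟩ := hzero u (by
      rintro rfl
      have h2 := eval_smul_linear hℓ 0 0
      rw [zero_smul, zero_mul] at h2
      rw [map_sub, h2] at h1
      simp at h1) fun p hp => hu p (Submodule.mem_sup_left hp)
    exact lineIdeal_le_pointIdeal (w i) c
      ((Ideal.prod_le_inf.trans (Finset.inf_le (Finset.mem_univ i))) hp)
  refine ⟨N₀, fun N hN => ?_⟩
  let Q : ι → Ideal (MvPolynomial (Fin 3) ℂ) := fun i => J ⊔ lineIdeal (w i) ^ N ⊔ Ideal.span {ℓ - 1}
  have hcop : Pairwise (Function.onFun IsCoprime Q) := by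
    intro i j hij
    have hne : ∃ c, w i c / eval (w i) ℓ ≠ w j c / eval (w j) ℓ := by
      by_contra! h
      refine hdist i j hij (eval (w i) ℓ / eval (w j) ℓ) (funext fun c => ?_)
      have := h c
      rw [Pi.smul_apply, smul_eq_mul, div_mul_eq_mul_div, mul_div_assoc, ← this,
        mul_div_cancel₀ _ (hw i)]
    obtain ⟨c, hc⟩ := hne
    have h1 : IsCoprime (lineIdeal (w i) ⊔ Ideal.span {ℓ - 1})
        (lineIdeal (w j) ⊔ Ideal.span {ℓ - 1}) := by
      rw [Ideal.isCoprime_iff_sup_eq]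
      refine Ideal.eq_top_of_isUnit_mem _ (x := C (w j c / eval (w j) ℓ - w i c / eval (w i) ℓ)) ?_
        ((isUnit_iff_ne_zero.mpr (sub_ne_zero.mpr hc.symm)).map C)
      have h2 : (C (w j c / eval (w j) ℓ - w i c / eval (w i) ℓ) : MvPolynomial (Fin 3) ℂ) =
          (X c - C (w i c / eval (w i) ℓ)) - (X c - C (w j c / eval (w j) ℓ)) := by
        rw [C_sub]
        ring
      rw [h2]
      exact Ideal.sub_mem _ (Submodule.mem_sup_left (X_sub_C_mem_sup hℓ (hw i) c))
        (Submodule.mem_sup_right (X_sub_C_mem_sup hℓ (hw j) c))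
    have h3 : ∀ i, (lineIdeal (w i) ⊔ Ideal.span {ℓ - 1}) ^ (N + 1) ≤ Q i := by
      intro i
      refine Ideal.sup_pow_add_le_pow_sup_pow.trans ?_
      rw [pow_one]
      exact sup_le_sup_right le_sup_right _
    have h4 := (h1.pow (m := N + 1) (n := N + 1))
    rw [Ideal.isCoprime_iff_sup_eq] at h4
    change IsCoprime (Q i) (Q j)
    rw [Ideal.isCoprime_iff_sup_eq, eq_top_iff, ← h4]
    exact sup_le_sup (h3 i) (h3 j)
  have hinf : J ⊔ Ideal.span {ℓ - 1} = ⨅ i, Q i := by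
    apply le_antisymm
    · exact le_iInf fun i => sup_le_sup_right le_sup_left _
    · have h1 := Ideal.prod_eq_iInf_of_pairwise_isCoprime (s := Finset.univ) (J := Q)
        (fun i _ j _ hij => hcop hij)
      simp only [Finset.mem_univ, iInf_pos] at h1
      rw [← h1]
      have h2 : ∀ i, Q i = (J ⊔ Ideal.span {ℓ - 1}) ⊔ lineIdeal (w i) ^ N := fun i => by
        simp only [Q]
        rw [sup_assoc, sup_comm (lineIdeal (w i) ^ N), ← sup_assoc]
      rw [Finset.prod_congr rfl fun i _ => h2 i]
      refine (prod_sup_le _ _ _).trans (sup_le le_rfl ?_)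
      rw [Finset.prod_pow]
      exact (Ideal.pow_le_pow_right hN).trans hN₀
  obtain ⟨-, K, hK⟩ := exists_forall_finrank_quotientPiece_eq hJ hℓ hM
    (Ideal.Quotient.mkₐ_surjective ℂ (J ⊔ Ideal.span {ℓ - 1})) (ker_mkₐ _)
  refine ⟨K, fun n hn => ?_⟩
  have hfin : ∀ i, Module.Finite ℂ (MvPolynomial (Fin 3) ℂ ⧸ Q i) := fun i =>
    (exists_finrank_local hJ hℓ (hw i) N (Ideal.Quotient.mkₐ_surjective ℂ (Q i)) (ker_mkₐ _)).1
  rw [hK n hn, ← Module.finrank_pi_fintype ℂ (M := fun i => MvPolynomial (Fin 3) ℂ ⧸ Q i), hinf]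
  let E := Ideal.quotientInfRingEquivPiQuotient Q hcop
  exact LinearEquiv.finrank_eq
    { E with
      map_smul' := fun a x => by
        obtain ⟨p, rfl⟩ := Ideal.Quotient.mk_surjective x
        rfl }

end Split

/-! ### Local Tjurina numbers -/

section Local

/-- Modulo an ideal `𝔞` that contains `s 𝔪^N` for some `s ∉ 𝔪`, the local ring at the maximal ideal `𝔪` is
the quotient by `𝔞 + 𝔪^N`. -/
lemma exists_surjective_to_quotient_localization {k R : Type*} [Field k] [CommRing R] [Algebra k R]
    (𝔪 𝔞 : Ideal R) [h𝔪 : 𝔪.IsMaximal] {N : ℕ} {s : R} (hs : s ∉ 𝔪) (hsN : ∀ x ∈ 𝔪 ^ N, s * x ∈ 𝔞) :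
    ∃ g : R →ₐ[k] Localization.AtPrime 𝔪 ⧸ 𝔞.map (algebraMap R (Localization.AtPrime 𝔪)),
      Function.Surjective g ∧ RingHom.ker g = 𝔞 ⊔ 𝔪 ^ N := by
  let g := (Ideal.Quotient.mkₐ k (𝔞.map (algebraMap R (Localization.AtPrime 𝔪)))).comp
    (IsScalarTower.toAlgHom k R (Localization.AtPrime 𝔪))
  have hg : ∀ r, g r = 0 ↔ ∃ t ∉ 𝔪, t * r ∈ 𝔞 := by
    intro r
    change Ideal.Quotient.mk _ (algebraMap R (Localization.AtPrime 𝔪) r) = 0 ↔ _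
    rw [Ideal.Quotient.eq_zero_iff_mem,
      IsLocalization.algebraMap_mem_map_algebraMap_iff 𝔪.primeCompl]
    rfl
  -- elements outside `𝔪` are invertible modulo `𝔪 ^ N`
  have hinv : ∀ t ∉ 𝔪, ∃ t', t * t' - 1 ∈ 𝔪 ^ N := by
    intro t ht
    have h1 : IsCoprime (Ideal.span {t}) 𝔪 := by
      rw [Ideal.isCoprime_iff_sup_eq, sup_comm]
      exact h𝔪.out.2 _ (left_lt_sup.mpr fun h => ht (h (Ideal.mem_span_singleton_self t)))
    have h2 := h1.pow_right (n := N)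
    obtain ⟨a, ha, b, hb, hab⟩ := Ideal.isCoprime_iff_exists.mp h2
    obtain ⟨t', rfl⟩ := Ideal.mem_span_singleton'.mp ha
    refine ⟨t', ?_⟩
    rw [← hab, mul_comm t, sub_add_cancel_left]
    exact (𝔪 ^ N).neg_mem hb
  have hN0 : ∀ x ∈ 𝔪 ^ N, g x = 0 := fun x hx => (hg x).mpr ⟨s, hs, hsN x hx⟩
  refine ⟨g, fun y => ?_, ?_⟩
  · obtain ⟨z, rfl⟩ := Ideal.Quotient.mk_surjective y
    obtain ⟨r, t, rfl⟩ := IsLocalization.exists_mk'_eq 𝔪.primeCompl z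
    obtain ⟨t', ht'⟩ := hinv t t.2
    refine ⟨r * t', ?_⟩
    have h1 : g t * g t' = 1 := by
      rw [← map_mul, ← sub_eq_zero, ← map_one g, ← map_sub]
      exact hN0 _ ht'
    have h2 : Ideal.Quotient.mk (𝔞.map (algebraMap R (Localization.AtPrime 𝔪)))
        (IsLocalization.mk' _ r t) * g t = g r := by
      change Ideal.Quotient.mk _ _ * Ideal.Quotient.mk _ _ = Ideal.Quotient.mk _ _
      rw [← map_mul]
      congr 1
      exact IsLocalization.mk'_spec _ r t
    rw [map_mul, ← h2, mul_assoc, h1, mul_one]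
  · apply le_antisymm
    · intro r hr
      obtain ⟨t, ht, htr⟩ := (hg r).mp hr
      obtain ⟨t', ht'⟩ := hinv t ht
      have : r = t' * (t * r) + -((t * t' - 1) * r) := by ring
      rw [this]
      exact Ideal.add_mem _ (Submodule.mem_sup_left (𝔞.mul_mem_left _ htr))
        (Submodule.mem_sup_right (Submodule.neg_mem _ (Ideal.mul_mem_right _ _ ht')))
    · refine sup_le (fun r hr => (hg r).mpr ⟨1, ?_, by rwa [one_mul]⟩) hN0
      exact (Ideal.ne_top_iff_one 𝔪).mp h𝔪.ne_top

/-- If the point does not lie on the scheme, the local Tjurina number is zero. -/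
lemma localTjurina_eq_zero {σ : Type} {g : MvPolynomial σ ℂ} {q : σ → ℂ}
    (h : ∃ a ∈ Ideal.span (insert g (Set.range fun s => pderiv s g)), eval q a ≠ 0) :
    localTjurina g q = 0 := by
  obtain ⟨a, ha, hq⟩ := h
  have htop : (Ideal.span (insert g (Set.range fun s => pderiv s g))).map
      (algebraMap (MvPolynomial σ ℂ) (Localization.AtPrime (pointIdeal q))) = ⊤ := by
    refine Ideal.eq_top_of_isUnit_mem _ (Ideal.mem_map_of_mem _ ha) ?_
    exact IsLocalization.map_units (Localization.AtPrime (pointIdeal q))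
      (⟨a, hq⟩ : (pointIdeal q).primeCompl)
  have := Ideal.Quotient.subsingleton_iff.mpr htop
  exact Module.finrank_zero_of_subsingleton

lemma pointIdeal_eq_span {σ : Type} (q : σ → ℂ) :
    pointIdeal q = Ideal.span (Set.range fun j => X j - C (q j)) := by
  apply le_antisymm
  · intro p hp
    have h : (Ideal.Quotient.mkₐ ℂ (Ideal.span (Set.range fun j => X j - C (q j)))) =
        (Algebra.ofId ℂ _).comp (aeval q) := by
      refine algHom_ext fun j => ?_
      rw [Ideal.Quotient.mkₐ_eq_mk, AlgHom.comp_apply, aeval_X]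
      exact Ideal.Quotient.eq.mpr (Ideal.subset_span ⟨j, rfl⟩)
    rw [← Ideal.Quotient.eq_zero_iff_mem, ← Ideal.Quotient.mkₐ_eq_mk ℂ, h, AlgHom.comp_apply]
    have hp' : aeval q p = 0 := hp
    rw [hp', map_zero]
  · rw [Ideal.span_le]
    rintro _ ⟨j, rfl⟩
    simp [pointIdeal]

instance {σ : Type} (q : σ → ℂ) : (pointIdeal q).IsMaximal :=
  RingHom.ker_isMaximal_of_surjective _ fun c => ⟨C c, eval_C _⟩

variable {c : Fin 3}

lemma dehomogenize_X_of_ne {j : Fin 3} (h : j ≠ c) : dehomogenize c (X j) = X ⟨j, h⟩ := by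
  simp [dehomogenize, h]

lemma dehomogenize_X_self : dehomogenize c (X c) = 1 := by
  simp [dehomogenize]

/-- Dehomogenization as a homomorphism of algebras. -/
def dehomogenizeHom (c : Fin 3) :
    MvPolynomial (Fin 3) ℂ →ₐ[ℂ] MvPolynomial {j : Fin 3 // j ≠ c} ℂ :=
  aeval fun j => if h : j ≠ c then X ⟨j, h⟩ else 1

lemma dehomogenizeHom_apply (p : MvPolynomial (Fin 3) ℂ) :
    dehomogenizeHom c p = dehomogenize c p := rfl

lemma dehomogenizeHom_rename (p : MvPolynomial {j : Fin 3 // j ≠ c} ℂ) :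
    dehomogenizeHom c (rename Subtype.val p) = p := by
  have h : (dehomogenizeHom c).comp (rename Subtype.val) = AlgHom.id ℂ _ := by
    refine algHom_ext fun j => ?_
    rw [AlgHom.comp_apply, rename_X, dehomogenizeHom_apply, dehomogenize_X_of_ne j.2]
    rfl
  exact DFunLike.congr_fun h p

lemma dehomogenizeHom_surjective : Function.Surjective (dehomogenizeHom c) :=
  fun p => ⟨_, dehomogenizeHom_rename p⟩

lemma ker_dehomogenizeHom : RingHom.ker (dehomogenizeHom c) = Ideal.span {X c - 1} := by
  apply le_antisymm
  · intro p hp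
    have h : ((Ideal.Quotient.mkₐ ℂ (Ideal.span {X c - 1})).comp (rename Subtype.val)).comp
        (dehomogenizeHom c) = Ideal.Quotient.mkₐ ℂ (Ideal.span {X c - 1}) := by
      refine algHom_ext fun j => ?_
      rw [AlgHom.comp_apply, dehomogenizeHom_apply]
      by_cases hj : j = c
      · subst hj
        rw [dehomogenize_X_self, map_one, Ideal.Quotient.mkₐ_eq_mk, ← map_one (Ideal.Quotient.mk _),
          eq_comm]
        exact Ideal.Quotient.eq.mpr (Ideal.mem_span_singleton_self _)
      · rw [dehomogenize_X_of_ne hj, AlgHom.comp_apply, rename_X]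
    rw [← Ideal.Quotient.eq_zero_iff_mem, ← Ideal.Quotient.mkₐ_eq_mk ℂ, ← h, AlgHom.comp_apply,
      show dehomogenizeHom c p = 0 from hp, map_zero]
  · rw [Ideal.span_singleton_le_iff_mem, RingHom.mem_ker, map_sub, map_one, dehomogenizeHom_apply,
      dehomogenize_X_self, sub_self]

lemma eval_dehomogenizeHom (v : Fin 3 → ℂ) (hv : v c ≠ 0) (p : MvPolynomial (Fin 3) ℂ) :
    eval (fun j : {j : Fin 3 // j ≠ c} => v j / v c) (dehomogenizeHom c p) =
      eval ((v c)⁻¹ • v) p := by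
  have h : (aeval (fun j : {j : Fin 3 // j ≠ c} => v j / v c)).comp (dehomogenizeHom c) =
      aeval ((v c)⁻¹ • v) := by
    refine algHom_ext fun j => ?_
    rw [AlgHom.comp_apply, dehomogenizeHom_apply, aeval_X]
    by_cases hj : j = c
    · subst hj
      rw [dehomogenize_X_self, map_one, Pi.smul_apply, smul_eq_mul, inv_mul_cancel₀ hv]
    · rw [dehomogenize_X_of_ne hj, aeval_X, Pi.smul_apply, smul_eq_mul, div_eq_inv_mul]
  exact DFunLike.congr_fun h p

lemma pderiv_dehomogenizeHom (s : {j : Fin 3 // j ≠ c}) (p : MvPolynomial (Fin 3) ℂ) :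
    pderiv s (dehomogenizeHom c p) = dehomogenizeHom c (pderiv s.1 p) := by
  induction p using MvPolynomial.induction_on with
  | C a => simp [dehomogenizeHom]
  | add p q hp hq => rw [map_add, map_add, hp, hq, map_add, map_add]
  | mul_X p j hp =>
    have hX : pderiv s (dehomogenizeHom c (X j)) = dehomogenizeHom c (pderiv s.1 (X j)) := by
      rw [dehomogenizeHom_apply]
      by_cases hj : j = c
      · subst hj
        rw [dehomogenize_X_self, pderiv_one, pderiv_X_of_ne (Ne.symm s.2), map_zero]
      · rw [dehomogenize_X_of_ne hj]
        by_cases hs : s.1 = j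
        · subst hs
          rw [pderiv_X_self, pderiv_X_self, map_one]
        · rw [pderiv_X_of_ne fun h => hs (congrArg Subtype.val h).symm,
            pderiv_X_of_ne fun h => hs h.symm, map_zero]
    rw [map_mul, Derivation.leibniz, Derivation.leibniz, hp, hX]
    simp

/-- By Euler's identity the local equation and its partial derivatives generate the dehomogenization of
the Jacobian ideal. -/
lemma map_jacobianIdeal {f : MvPolynomial (Fin 3) ℂ} {d : ℕ} (hd : 1 ≤ d) (hf : f.IsHomogeneous d) :
    Ideal.span (insert (dehomogenize c f) (Set.range fun s => pderiv s (dehomogenize c f))) =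
      (jacobianIdeal f).map (dehomogenizeHom c) := by
  rw [← dehomogenizeHom_apply]
  apply le_antisymm
  · rw [Ideal.span_le]
    rintro _ (rfl | ⟨s, rfl⟩)
    · exact Ideal.mem_map_of_mem _ (mem_jacobianIdeal hd hf)
    · simp only
      rw [pderiv_dehomogenizeHom]
      exact Ideal.mem_map_of_mem _ (Ideal.subset_span ⟨s.1, rfl⟩)
  · rw [jacobianIdeal, Ideal.map_span, Ideal.span_le]
    rintro _ ⟨_, ⟨j, rfl⟩, rfl⟩
    have hmem : ∀ i, i ≠ c → dehomogenizeHom c (pderiv i f) ∈ Ideal.span (insert (dehomogenizeHom c f)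
        (Set.range fun s => pderiv s (dehomogenizeHom c f))) := by
      intro i hi
      rw [← pderiv_dehomogenizeHom ⟨i, hi⟩]
      exact Ideal.subset_span (Set.mem_insert_of_mem _ ⟨_, rfl⟩)
    by_cases hj : j = c
    · subst hj
      have h := congrArg (dehomogenizeHom j) hf.sum_X_mul_pderiv
      rw [map_sum, ← Finset.add_sum_erase _ _ (Finset.mem_univ j), map_mul,
        dehomogenizeHom_apply (X j), dehomogenize_X_self, one_mul] at h
      have h2 := eq_sub_of_add_eq h
      change dehomogenizeHom j (pderiv j f) ∈ _
      rw [h2, map_nsmul]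
      refine Ideal.sub_mem _ (Submodule.smul_of_tower_mem _ _
        (Ideal.subset_span (Set.mem_insert _ _))) (Ideal.sum_mem _ fun i hi => ?_)
      rw [map_mul]
      exact Ideal.mul_mem_left _ _ (hmem i (Finset.ne_of_mem_erase hi))
    · exact hmem j hj

/-- The homogeneous ideal of a point dehomogenizes to the maximal ideal of that point. -/
lemma map_lineIdeal {v : Fin 3 → ℂ} (hv : v c ≠ 0) :
    (lineIdeal v).map (dehomogenizeHom c) =
      pointIdeal fun j : {j : Fin 3 // j ≠ c} => v j / v c := by
  have hX : (X c : MvPolynomial (Fin 3) ℂ) ∈ polyPiece (Fin 3) ℂ 1 :=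
    mem_polyPiece_one_iff.mpr (isHomogeneous_X _ _)
  apply le_antisymm
  · rw [Ideal.map_le_iff_le_comap]
    intro p hp
    change eval _ (dehomogenizeHom c p) = 0
    rw [eval_dehomogenizeHom v hv]
    exact lineIdeal_le_pointIdeal v _ hp
  · rw [pointIdeal_eq_span, Ideal.span_le]
    rintro _ ⟨j, rfl⟩
    have h := Ideal.mem_map_of_mem (dehomogenizeHom c)
      (X_sub_mem_lineIdeal hX (v := v) (by simpa using hv) j.1)
    rw [map_sub, map_mul, dehomogenizeHom_apply, dehomogenizeHom_apply (X c),
      dehomogenize_X_of_ne j.2, dehomogenize_X_self, mul_one] at h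
    simpa [dehomogenizeHom] using h

lemma not_lineIdeal_le_pointIdeal {u v : Fin 3 → ℂ} (hu : u ≠ 0) (h : ∀ a : ℂ, v ≠ a • u) :
    ¬ lineIdeal u ≤ pointIdeal v := by
  obtain ⟨i, hi⟩ := Function.ne_iff.mp hu
  intro h0
  refine h (v i / u i) (funext fun j => ?_)
  have hX : (X i : MvPolynomial (Fin 3) ℂ) ∈ polyPiece (Fin 3) ℂ 1 :=
    mem_polyPiece_one_iff.mpr (isHomogeneous_X _ _)
  have h1 : eval v _ = 0 := h0 (X_sub_mem_lineIdeal hX (v := u) (by simpa using hi) j)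
  simp only [map_sub, map_mul, eval_X, eval_C, sub_eq_zero] at h1
  rw [h1, Pi.smul_apply, smul_eq_mul]
  ring

/-- The local Tjurina number at one of finitely many points `wᵢ` of the projective plane that include all
singular points, computed in the chart of any linear form `ℓ` not vanishing at the point: in both charts
one finds the eventual value of the Hilbert function of the ideal `J_f + lineIdeal (w i) ^ N`. -/
lemma finrank_eq_localTjurina {f : MvPolynomial (Fin 3) ℂ} {d : ℕ} (hd : 1 ≤ d)
    (hf : f.IsHomogeneous d) {ι : Type*} [Fintype ι] {w : ι → Fin 3 → ℂ} (hw0 : ∀ i, w i ≠ 0)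
    (hdist : ∀ i j, i ≠ j → ∀ a : ℂ, w i ≠ a • w j) {N : ℕ}
    (hN : (∏ i, lineIdeal (w i)) ^ N ≤ jacobianIdeal f) (i : ι) (hc : w i c ≠ 0)
    {ℓ : MvPolynomial (Fin 3) ℂ} (hℓ : ℓ ∈ polyPiece (Fin 3) ℂ 1) (hℓi : eval (w i) ℓ ≠ 0) :
    Module.finrank ℂ (MvPolynomial (Fin 3) ℂ ⧸
      (jacobianIdeal f ⊔ lineIdeal (w i) ^ N ⊔ Ideal.span {ℓ - 1})) =
    localTjurina (dehomogenize c f) fun j : {j : Fin 3 // j ≠ c} => w i j / w i c := by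
  classical
  have hX : (X c : MvPolynomial (Fin 3) ℂ) ∈ polyPiece (Fin 3) ℂ 1 :=
    mem_polyPiece_one_iff.mpr (isHomogeneous_X _ _)
  -- a function vanishing at all the other points, but not at `wᵢ`
  obtain ⟨s, hs, hsi⟩ : ∃ s ∈ ∏ j ∈ Finset.univ.erase i, lineIdeal (w j),
      s ∉ pointIdeal ((w i c)⁻¹ • w i) := by
    rw [← SetLike.not_le_iff_exists, Ideal.IsPrime.prod_le inferInstance]
    rintro ⟨j, hj, hle⟩
    refine not_lineIdeal_le_pointIdeal (hw0 j) (fun a ha => ?_) hle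
    refine hdist i j (Finset.ne_of_mem_erase hj).symm (w i c * a) ?_
    rw [mul_smul, ← ha, smul_smul, mul_inv_cancel₀ hc, one_smul]
  have hs' : dehomogenizeHom c (s ^ N) ∉ pointIdeal fun j : {j : Fin 3 // j ≠ c} => w i j / w i c := by
    intro h
    have h1 : eval _ (dehomogenizeHom c (s ^ N)) = 0 := h
    rw [eval_dehomogenizeHom (w i) hc, map_pow] at h1
    exact hsi (eq_zero_of_pow_eq_zero h1)
  have hsN : ∀ x ∈ (pointIdeal fun j : {j : Fin 3 // j ≠ c} => w i j / w i c) ^ N,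
      dehomogenizeHom c (s ^ N) * x ∈ (jacobianIdeal f).map (dehomogenizeHom c) := by
    intro x hx
    rw [← map_lineIdeal hc, ← Ideal.map_pow] at hx
    refine Ideal.map_mono hN ?_
    rw [← Finset.prod_erase_mul _ _ (Finset.mem_univ i), mul_pow, Ideal.map_mul]
    exact Ideal.mul_mem_mul (Ideal.mem_map_of_mem _ (Ideal.pow_mem_pow hs N)) hx
  obtain ⟨g, hsurj, hker⟩ := exists_surjective_to_quotient_localization (k := ℂ) _ _ hs' hsN
  have hker' := congrArg (Ideal.comap (dehomogenizeHom c)) (hker.trans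
    (b := (jacobianIdeal f).map (dehomogenizeHom c) ⊔ _)
    (c := (jacobianIdeal f ⊔ lineIdeal (w i) ^ N).map (dehomogenizeHom c))
    (by rw [Ideal.map_sup, Ideal.map_pow, map_lineIdeal hc]))
  rw [Ideal.comap_map_of_surjective _ dehomogenizeHom_surjective] at hker'
  change _ = _ ⊔ RingHom.ker (dehomogenizeHom c) at hker'
  rw [ker_dehomogenizeHom] at hker'
  obtain ⟨-, K, hK⟩ := exists_finrank_local (isHomogeneous_jacobianIdeal hf) hℓ hℓi N
    (Ideal.Quotient.mkₐ_surjective ℂ _) (ker_mkₐ _)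
  obtain ⟨-, K', hK'⟩ := exists_finrank_local (isHomogeneous_jacobianIdeal hf) hX
    (by rwa [eval_X]) N (ψ := g.comp (dehomogenizeHom c))
    (hsurj.comp dehomogenizeHom_surjective) hker'
  rw [← hK _ (le_max_left K K'), hK' _ (le_max_right K K'), localTjurina, map_jacobianIdeal hd hf]

end Local

/-! ### The Hilbert function of the Milnor algebra in large degrees -/

section Total

/-- Finitely many nonzero vectors are avoided by the zero set of some linear form. -/
lemma exists_linear_eval_ne_zero {ι : Type*} [Finite ι] {w : ι → Fin 3 → ℂ} (hw : ∀ i, w i ≠ 0) :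
    ∃ ℓ ∈ polyPiece (Fin 3) ℂ 1, ∀ i, eval (w i) ℓ ≠ 0 := by
  obtain ⟨φ, hφ⟩ := Module.exists_dual_forall_apply_ne_zero (K := ℂ) w hw
  refine ⟨∑ j, C (φ (Pi.single j 1)) * X j, ?_, fun i => ?_⟩
  · rw [mem_polyPiece_one_iff]
    refine IsHomogeneous.sum _ _ _ fun j _ => ?_
    have := (isHomogeneous_C (Fin 3) (φ (Pi.single j 1))).mul (isHomogeneous_X ℂ j)
    rwa [zero_add] at this
  · convert hφ i using 1
    rw [map_sum]
    conv_rhs => rw [pi_eq_sum_univ' (w i), map_sum]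
    refine Finset.sum_congr rfl fun j _ => ?_
    rw [map_mul, eval_C, eval_X, map_smul, smul_eq_mul, mul_comm]

variable {f : MvPolynomial (Fin 3) ℂ} {d : ℕ}

lemma tjurinaAt_eq_zero (hd : 1 ≤ d) (hf : f.IsHomogeneous d)
    {p : Projectivization ℂ (Fin 3 → ℂ)} (hp : p ∉ singularPoints f) : tjurinaAt f p = 0 := by
  obtain ⟨i, hi⟩ := not_forall.mp hp
  refine localTjurina_eq_zero ⟨dehomogenizeHom (chart p) (pderiv i f), ?_, ?_⟩
  · rw [map_jacobianIdeal hd hf]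
    exact Ideal.mem_map_of_mem _ (Ideal.subset_span ⟨i, rfl⟩)
  · rw [eval_dehomogenizeHom _ (rep_chart_ne_zero p), eval_smul_of_isHomogeneous hf.pderiv]
    exact mul_ne_zero (pow_ne_zero _ (inv_ne_zero (rep_chart_ne_zero p))) hi

/-- In all large degrees the Milnor algebra of a reduced plane curve has the total Tjurina number as its
dimension. -/
theorem exists_forall_finrank_milnorPiece_eq (hd : 1 ≤ d) (hf : f.IsHomogeneous d)
    (hred : Squarefree f) :
    ∃ K : ℤ, ∀ i, K ≤ i → Module.finrank ℂ (milnorPiece f i) = totalTjurina f := by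
  have hfin := finite_singularPoints hd hf hred
  have : Fintype (singularPoints f) := hfin.fintype
  let w : singularPoints f → Fin 3 → ℂ := fun p => p.1.rep
  have hw0 : ∀ p, w p ≠ 0 := fun p => p.1.rep_nonzero
  have hzero : ∀ u ≠ 0, (∀ p ∈ jacobianIdeal f, eval u p = 0) →
      ∃ i, ∃ c : ℂ, u = c • w i := by
    intro u hu h
    obtain ⟨a, ha⟩ := Projectivization.exists_smul_eq_mk_rep ℂ u hu
    refine ⟨⟨Projectivization.mk ℂ u hu, fun i => ?_⟩, ((a⁻¹ : ℂˣ) : ℂ), ?_⟩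
    · rw [← ha, Units.smul_def, eval_smul_of_isHomogeneous hf.pderiv,
        h _ (Ideal.subset_span ⟨i, rfl⟩), mul_zero]
    · change u = ((a⁻¹ : ℂˣ) : ℂ) • (Projectivization.mk ℂ u hu).rep
      rw [← ha, ← Units.smul_def, inv_smul_smul]
  have hdist : ∀ i j, i ≠ j → ∀ c : ℂ, w i ≠ c • w j := by
    intro i j hij c h
    refine hij (Subtype.ext ?_)
    rw [← i.1.mk_rep, ← j.1.mk_rep, Projectivization.mk_eq_mk_iff']
    exact ⟨c, h.symm⟩
  obtain ⟨ℓ, hℓ, hw⟩ := exists_linear_eval_ne_zero hw0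
  obtain ⟨N₀, hN₀⟩ :=
    exists_finrank_eq_sum (isHomogeneous_jacobianIdeal hf) hzero hdist hℓ hw
  obtain ⟨N, hNN, hN⟩ : ∃ N, N₀ ≤ N ∧
      ∀ _ : singularPoints f, (∏ i, lineIdeal (w i)) ^ N ≤ jacobianIdeal f := by
    rcases isEmpty_or_nonempty (singularPoints f) with he | hne
    · exact ⟨N₀, le_rfl, fun p => he.elim p⟩
    · obtain ⟨N₁, hN₁⟩ := exists_prod_lineIdeal_pow_le hzero
      exact ⟨max N₀ N₁, le_max_left _ _,
        fun _ => (Ideal.pow_le_pow_right (le_max_right N₀ N₁)).trans hN₁⟩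
  obtain ⟨K, hK⟩ := hN₀ N hNN
  refine ⟨K, fun n hn => (hK n hn).trans ?_⟩
  have hsum : totalTjurina f = ∑ p : singularPoints f, tjurinaAt f p := by
    rw [totalTjurina, ← finsum_eq_sum_of_fintype, finsum_set_coe_eq_finsum_mem]
    refine finsum_congr fun p => ?_
    by_cases hp : p ∈ singularPoints f
    · simp [hp]
    · simp [hp, tjurinaAt_eq_zero hd hf hp]
  rw [hsum]
  exact Finset.sum_congr rfl fun p _ =>
    finrank_eq_localTjurina hd hf hw0 hdist (hN p) p (rep_chart_ne_zero p.1) hℓ (hw p)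

end Total

end PlaneCurve

end

theorem theorem3p3 (d : ℕ) (hd : 1 ≤ d) (f : MvPolynomial (Fin 3) ℂ) (hf : f.IsHomogeneous d)
    (hred : Squarefree f) :
    (2 ≤ d → ∃ s r : ℤ, PlaneCurve.st f = ((s : ℝ) : EReal) ∧
      PlaneCurve.reg f = ((r : ℝ) : EReal)) ∧
    PlaneCurve.st f - 1 ≤ PlaneCurve.reg f ∧ PlaneCurve.reg f ≤ PlaneCurve.st f ∧
    (PlaneCurve.reg f = PlaneCurve.st f ↔ PlaneCurve.IsFreeCurve f) := by
  obtain ⟨K, hK⟩ := PlaneCurve.exists_forall_finrank_milnorPiece_eq hd hf hred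
  rcases hd.eq_or_lt with rfl | hd2
  -- the Milnor algebra of a line is zero
  · have htop := PlaneCurve.jacobianIdeal_eq_top_of_isHomogeneous_one hf hred.ne_zero
    have : Subsingleton (PlaneCurve.MilnorAlgebra f) := Ideal.Quotient.subsingleton_iff.mpr htop
    have hτ : PlaneCurve.totalTjurina f = 0 := by
      rw [← hK K le_rfl]
      exact Module.finrank_zero_of_subsingleton
    have hreg := PlaneCurve.reg_eq_bot_of_jacobianIdeal_eq_top htop
    have hst := PlaneCurve.st_eq_bot_of_jacobianIdeal_eq_top htop hτ
    rw [hreg, hst]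
    refine ⟨fun h => absurd h (by norm_num), ?_, le_rfl, fun _ => ?_, fun _ => rfl⟩
    · rw [sub_eq_add_neg, EReal.bot_add]
    · exact PlaneCurve.isFreeCurve_of_isHomogeneous_one hf hred.ne_zero
  · obtain ⟨s, r, hs, hr, h1, h2, h3⟩ := PlaneCurve.st_reg_of_eventually_eq hd2 hf hred.ne_zero hK
    refine ⟨fun _ => ⟨s, r, hs, hr⟩, ?_, ?_, ?_⟩
    · rw [hs, hr, ← EReal.coe_one, ← EReal.coe_sub, EReal.coe_le_coe_iff]
      exact_mod_cast h1
    · rw [hs, hr, EReal.coe_le_coe_iff]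
      exact_mod_cast h2
    · rw [hs, hr, EReal.coe_eq_coe_iff, Int.cast_inj]
      exact h3
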